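/- For a simple graph $G=(V,E)$ with $n$ vertices and $m$ edges, call $R\subseteq E$ independent if every connected component of $(V,R)$ contains at most one cycle; these are the independent sets of the bicircular matroid $B(G)$ when $G$ is connected and $m\ge n$, the bases of $B(G)$ are the maximal independent sets, and $N(G)$ denotes their number. Theorem. There is an FPRAS for counting the bases of the bicircular matroid of a connected graph $G$ with $m\ge n$, with time complexity $O(n^3m^2\varepsilon^{-2})$. In detail: there are a randomised algorithm (one fixed program) and constants $k$ and $C$ such that the following holds for every connected simple graph $G$ on the vertices $0,\dots,n-1$ with $m\ge n$ edges, given as a list of its edges in any order, and every rational error tolerance $\varepsilon=p/q$ with integers $0<p<q$. The algorithm, given $n$, $m$, $p$, $q$ and the edge list, always halts within $C\,n^3m^2\varepsilon^{-2}$ steps, and it outputs a random rational number $Y$ such that $$\Pr\bigl[\,|Y-N(G)|\le\varepsilon N(G)\,\bigr]\ge\tfrac34 .$$ The machine is a unit-cost word RAM with words of $w$ bits, for any $w$ with $2^w\ge(n+m+q)^k$; its operations are arithmetic and comparisons on words, reading and writing memory cells addressed by words, and drawing a uniformly random element of $\{0,\dots,v-1\}$ for a word $v$. Each input number occupies one word,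 and $Y$ is output as a numerator and a denominator written in base $2^w$ (a zero denominator is read as $Y=0$). -/

import Mathlib

/-! ## The bicircular matroid of a graph -/

section Bicircular

variable {V : Type*}

/-- Independence in the bicircular matroid of `G`: `R` is a set of edges of `G`, and every connected
component of `(V, R)` has at most one cycle, i.e. any two cycles of `(V, R)` that lie in the same
component have the same edges. -/
def BicircularIndep (G : SimpleGraph V) (R : Set (Sym2 V)) : Prop :=
  R ⊆ G.edgeSet ∧
    ∀ (u v : V) (p : (SimpleGraph.fromEdgeSet R).Walk u u)
      (q : (SimpleGraph.fromEdgeSet R).Walk v v),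
      p.IsCycle → q.IsCycle → (SimpleGraph.fromEdgeSet R).Reachable u v →
        ∀ e : Sym2 V, e ∈ p.edges ↔ e ∈ q.edges

/-- The bases of the bicircular matroid: its maximal independent sets. -/
def bicircularBases (G : SimpleGraph V) : Set (Set (Sym2 V)) :=
  {R | Maximal (BicircularIndep G) R}

/-- The number of bases of the bicircular matroid. -/
noncomputable def numBicircularBases (G : SimpleGraph V) : ℕ :=
  (bicircularBases G).ncard

end Bicircular

/-! ## Randomised word RAM programs -/

namespace WordRAM

/-- The arithmetic and comparison instructions on words. -/
inductive Op where
  | add | sub | mul | mulHi | div | mod | lt | eq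

/-- Semantics of the operations on `w`-bit words. Addition, subtraction and multiplication are
modulo `2 ^ w`, `mulHi` is the high word of the product, `div` and `mod` are unsigned,
comparisons return `1` or `0`. -/
def Op.eval {w : ℕ} : Op → BitVec w → BitVec w → BitVec w
  | .add, x, y => x + y
  | .sub, x, y => x - y
  | .mul, x, y => x * y
  | .mulHi, x, y => BitVec.ofNat w (x.toNat * y.toNat / 2 ^ w)
  | .div, x, y => x / y
  | .mod, x, y => x % y
  | .lt, x, y => if x.toNat < y.toNat then 1 else 0
  | .eq, x, y => if x = y then 1 else 0

/-- Expressions: constants, registers, memory cells (indirect addressing), operations.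
They do not depend on the word size. -/
inductive Expr where
  | const (a : ℕ)
  | reg (r : ℕ)
  | load (a : Expr)
  | op (o : Op) (x y : Expr)

/-- Programs of the word RAM, in structured form. A program is one fixed finite object, which does
not depend on the word size or on the input; `rand r x` puts a uniformly random element of
`{0, …, v - 1}` into register `r`, where `v` is the value of `x`. -/
inductive Cmd where
  | skip
  | assign (r : ℕ) (x : Expr)
  | store (a x : Expr)
  | rand (r : ℕ) (x : Expr)
  | seq (c d : Cmd)
  | ite (x : Expr) (c d : Cmd)
  | loop (x : Expr) (c : Cmd)

/-- Registers and memory of a machine with `w`-bit words: the `2 ^ w` memory cells are addressed by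
words. (A given program can use only the finitely many registers it mentions.) -/
structure State (w : ℕ) where
  regs : ℕ → BitVec w
  mem : BitVec w → BitVec w

/-- The value of an expression. -/
def Expr.eval {w : ℕ} (s : State w) : Expr → BitVec w
  | .const a => BitVec.ofNat w a
  | .reg r => s.regs r
  | .load a => s.mem (a.eval s)
  | .op o x y => o.eval (x.eval s) (y.eval s)

/-- Write a word into a register. -/
def State.setReg {w : ℕ} (s : State w) (r : ℕ) (x : BitVec w) : State w :=
  { s with regs := Function.update s.regs r x }

/-- Write a word into a memory cell. -/
def State.setMem {w : ℕ} (s : State w) (a x : BitVec w) : State w :=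
  { s with mem := Function.update s.mem a x }

/-- The uniform distribution on `{0, …, v - 1}` (and the constant `0` if `v = 0`). -/
noncomputable def randBelow {w : ℕ} (v : BitVec w) : PMF (BitVec w) :=
  if h : v.toNat = 0 then PMF.pure 0
  else
    haveI : NeZero v.toNat := ⟨h⟩
    (PMF.uniformOfFintype (Fin v.toNat)).map fun i => BitVec.ofNat w i

/-- A configuration: the commands that remain to be executed, and the state. -/
abbrev Config (w : ℕ) : Type := List Cmd × State w

/-- One step of the machine, of cost one. A configuration with no remaining command has halted.
(The expressions in a given program have bounded size, so charging one unit for a command agrees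
up to a constant factor with charging one unit for every operation on words.) -/
noncomputable def step {w : ℕ} : Config w → PMF (Config w)
  | ([], s) => PMF.pure ([], s)
  | (.skip :: K, s) => PMF.pure (K, s)
  | (.assign r x :: K, s) => PMF.pure (K, s.setReg r (x.eval s))
  | (.store a x :: K, s) => PMF.pure (K, s.setMem (a.eval s) (x.eval s))
  | (.rand r x :: K, s) => (randBelow (x.eval s)).map fun y => (K, s.setReg r y)
  | (.seq c d :: K, s) => PMF.pure (c :: d :: K, s)
  | (.ite x c d :: K, s) => PMF.pure (if x.eval s ≠ 0 then (c :: K, s) else (d :: K, s))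
  | (.loop x c :: K, s) =>
      PMF.pure (if x.eval s ≠ 0 then (c :: .loop x c :: K, s) else (K, s))

/-- The distribution of the configuration after `t` steps. -/
noncomputable def run {w : ℕ} : ℕ → Config w → PMF (Config w)
  | 0, c => PMF.pure c
  | t + 1, c => (step c).bind (run t)

/-- The starting state: registers are zero and the memory cells `0, 1, 2, …` hold the
given input words, followed by zeros. -/
def initState (w : ℕ) (input : List ℕ) : State w where
  regs := fun _ => 0
  mem := fun a => BitVec.ofNat w (input.getD a.toNat 0)

/-- The natural number whose digits in base `2 ^ w`, least significant first, are in the `len`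
memory cells from address `a` on. -/
def State.bigNat {w : ℕ} (s : State w) (a : BitVec w) (len : ℕ) : ℕ :=
  ∑ i ∈ Finset.range len, (s.mem (a + BitVec.ofNat w i)).toNat * 2 ^ (w * i)

/-- The output: a rational number given by a numerator and a denominator of several words.
Registers `0` and `1` hold the address and the length of the numerator, registers `2` and `3` those
of the denominator. (Denominator zero is read as the output `0`.) -/
def State.output {w : ℕ} (s : State w) : ℚ :=
  (s.bigNat (s.regs 0) (s.regs 1).toNat : ℚ) / (s.bigNat (s.regs 2) (s.regs 3).toNat : ℚ)

/-- On the given input and with `w`-bit words, `P` halts within `T` steps, whatever the random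
choices are, and with probability at least `3 / 4` its output `x` satisfies
`|x - N| ≤ ε * N`. -/
def Approximates (P : Cmd) (w : ℕ) (input : List ℕ) (T : ℕ) (N : ℕ) (ε : ℚ) : Prop :=
  (∀ c ∈ (run T ([P], initState w input)).support, c.1 = []) ∧
    3 / 4 ≤ (run T ([P], initState w input)).toOuterMeasure
      {c | |c.2.output - (N : ℚ)| ≤ ε * (N : ℚ)}

end WordRAM

/-! ## Encoding of the instances -/

/-- `e` lists the edges of `G`, each of them exactly once, as pairs of end vertices. -/
def IsEdgeList {n m : ℕ} (G : SimpleGraph (Fin n)) (e : Fin m → Fin n × Fin n) : Prop :=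
  (Function.Injective fun i => s((e i).1, (e i).2)) ∧
    (Set.range fun i => s((e i).1, (e i).2)) = G.edgeSet

/-- The input words: `n`, `m`, the numerator and the denominator of the error tolerance, and then
the end vertices of the `m` edges. -/
def inputWords {n m : ℕ} (e : Fin m → Fin n × Fin n) (p q : ℕ) : List ℕ :=
  [n, m, p, q] ++ (List.ofFn e).flatMap fun x => [(x.1 : ℕ), (x.2 : ℕ)]

/-! # An FPRAS for the bases of the bicircular matroid

Let every edge of a set `R` be owned by one of its ends, so that no vertex owns two edges:
a set of edges is independent if and only if this is possible (`bicircularIndep_arcs`,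
`exists_arcs_eq`), so independent sets are edge sets of functional graphs `v ↦ f v`, where a fixed
point owns no edge. The ownership is unique up to the choice of the roots of the trees and of the
orientation of the cycles. Call a cycle of length two bad, and likewise one of the two orientations
of each longer cycle. In a connected graph with `n ≤ m`, the bases then correspond to the functions
that choose a neighbour for every vertex and have no bad cycle (`numBicircularBases_eq`).

Such good functions are sampled by popping: always let the least unassigned vertex draw a uniformly
random neighbour, and if this closes a bad cycle, unassign the vertices of the cycle. Bad cycles of
one function are disjoint, so given the set `S` of assigned vertices the configuration remains
uniformly distributed over the `numGood S` good configurations on `S` (`sum_settle`). Consider the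
draws for `v` at times when all smaller vertices are assigned and `v` has not been assigned before
in the run: each of them succeeds with the same probability, so their number is geometrically
distributed with
mean `deg v * numGood {u | u < v} / numGood {u | u ≤ v}`. The product of these means telescopes
to `(∏ v, deg v) / N` (`prod_meanDraws`), where `N` is the number of bases. With `s` runs, of order
`n / ε ^ 2`, the counts `W v` satisfy `∏ v, W v ≈ s ^ n * (∏ v, deg v) / N`, and the output is
`(∏ v, deg v * s) / ∏ v, W v`.

The expected number of draws in a run is `n` plus `numPopped univ / numGood univ`, the expected
number of vertices that are unassigned in pops, and `numPopped ≤ (n + n ^ 3) * numGood` because a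
configuration with a single bad cycle is repaired by reversing the cycle or by an augmentation
(`numPopped_le`). Both the second moment of `∏ v, W v` and the number of draws enter one potential
function, which bounds the failure probability by induction on the number of draws
(`sum_failProb_le`); its initial value is at most `1 / 4` (`failProb_le`) when the sampling is
stopped after `40 * s * n ^ 3` draws.

For the implementation, states of the machine are described by natural numbers, and the parts of the
program without random choices have specifications `Ensures` with a bound on the time. The sampling
loop follows the abstract process draw by draw (`achieves_sample`), with time of order `m` for each
draw, so that the total time is of order `s * n ^ 3 * m`, hence at most of order
`n ^ 3 * m ^ 2 / ε ^ 2`. -/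

/-! ### Functional graphs and independent sets -/

namespace FunGraph

open Function

section Basic

variable {V : Type*}

/-- The edges `v — f v` of the functional graph of `f : V → V`. A fixed point `f v = v` stands for a
vertex that owns no edge, so partial functions on `V` are encoded as functions `V → V`. -/
def arcs (f : V → V) : Set (Sym2 V) := {e | ∃ v, f v ≠ v ∧ s(v, f v) = e}

/-- The forward orbit of `x` under `f` contains `y`. -/
def Hits (f : V → V) (x y : V) : Prop := ∃ k, f^[k] x = y

/-- No two vertices point at each other, i.e. no edge is owned by both of its ends. -/
def NoTwo (f : V → V) : Prop := ∀ v, f (f v) = v → f v = v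

lemma Hits.refl (f : V → V) (x : V) : Hits f x x := ⟨0, rfl⟩

lemma Hits.step (f : V → V) (x : V) : Hits f x (f x) := ⟨1, rfl⟩

lemma Hits.trans {f : V → V} {x y z : V} (h : Hits f x y) (h' : Hits f y z) : Hits f x z := by
  obtain ⟨k, rfl⟩ := h
  obtain ⟨l, rfl⟩ := h'
  exact ⟨l + k, iterate_add_apply f l k x⟩

lemma Hits.head {f : V → V} {x y : V} (h : Hits f (f x) y) : Hits f x y :=
  (Hits.step f x).trans h

lemma Hits.of_ne {f : V → V} {x y : V} (h : Hits f x y) (hne : x ≠ y) : Hits f (f x) y := by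
  obtain ⟨k, hk⟩ := h
  cases k with
  | zero => exact absurd hk hne
  | succ k => exact ⟨k, by simpa using hk⟩

/-- A property that holds at `x` and passes from `z` to `f z` holds on the orbit of `x`. -/
lemma Hits.induct {f : V → V} {x y : V} (h : Hits f x y) (P : V → Prop) (h0 : P x)
    (hs : ∀ z, Hits f x z → P z → P (f z)) : P y := by
  obtain ⟨k, rfl⟩ := h
  induction k with
  | zero => exact h0
  | succ k ih => rw [iterate_succ_apply']; exact hs _ ⟨k, rfl⟩ ih

/-- Backward induction along the part of the orbit of `x` that precedes `y`. -/
lemma Hits.induct_back {f : V → V} {x y : V} (h : Hits f x y) (P : V → Prop) (h0 : P y)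
    (hs : ∀ z, z ≠ y → P (f z) → P z) : P x := by
  obtain ⟨k, hk⟩ := h
  induction k generalizing x with
  | zero =>
    obtain rfl : x = y := hk
    exact h0
  | succ k ih =>
    by_cases hx : x = y
    · exact hx ▸ h0
    · exact hs x hx (ih (by simpa using hk))

lemma Hits.congr {f g : V → V} {x y : V} (h : Hits f x y) (hfg : ∀ z, Hits f x z → g z = f z) :
    Hits g x y :=
  h.induct (fun y => Hits g x y) (Hits.refl g x) fun z hz hz' =>
    hz'.trans (by rw [← hfg z hz]; exact Hits.step g z)

lemma Hits.congr_iff {f g : V → V} {x y : V} (hfg : ∀ z, Hits f x z → g z = f z) :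
    Hits g x y ↔ Hits f x y := by
  refine ⟨fun h => ?_, fun h => h.congr hfg⟩
  exact h.induct (fun y => Hits f x y) (Hits.refl f x) fun z _ hz => by
    rw [hfg z hz]; exact hz.trans (Hits.step f z)

lemma Hits.eq_of_fixed {f : V → V} {x y : V} (h : Hits f x y) (hx : f x = x) : y = x :=
  h.induct (fun y => y = x) rfl fun z _ hz => by rw [hz, hx]

/-- `x` lies on a cycle (possibly a loop) of `f`. -/
def Cyc (f : V → V) (x : V) : Prop := Hits f (f x) x

lemma Cyc.hits_symm {f : V → V} {x y : V} (hx : Cyc f x) (h : Hits f x y) : Hits f y x := by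
  refine h.induct (fun y => Hits f y x) (Hits.refl f x) fun z _ hz => ?_
  by_cases hzx : z = x
  · rw [hzx]; exact hx
  · exact hz.of_ne hzx

lemma Cyc.of_hits {f : V → V} {x y : V} (hx : Cyc f x) (h : Hits f x y) : Cyc f y := by
  by_cases hy : y = x
  · rw [hy]; exact hx
  · exact ((hx.hits_symm h).of_ne hy).trans h

lemma cyc_iff_mem_periodicPts {f : V → V} {x : V} : Cyc f x ↔ x ∈ periodicPts f := by
  rw [mem_periodicPts]
  constructor
  · rintro ⟨k, hk⟩
    exact ⟨k + 1, Nat.succ_pos k, by simpa [IsPeriodicPt, IsFixedPt] using hk⟩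
  · rintro ⟨k, hk, h⟩
    obtain ⟨k, rfl⟩ := Nat.exists_eq_succ_of_ne_zero hk.ne'
    exact ⟨k, by simpa [IsPeriodicPt, IsFixedPt] using h⟩

lemma Cyc.injOn {f : V → V} {x y : V} (hx : Cyc f x) (hy : Cyc f y) (h : f x = f y) : x = y :=
  (bijOn_periodicPts f).injOn (cyc_iff_mem_periodicPts.1 hx) (cyc_iff_mem_periodicPts.1 hy) h

lemma Cyc.exists_pred {f : V → V} {x : V} (hx : Cyc f x) : ∃ y, Hits f x y ∧ f y = x := by
  obtain ⟨k, hk⟩ := hx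
  exact ⟨f^[k] x, ⟨k, rfl⟩, by rw [← iterate_succ_apply' f, iterate_succ_apply]; exact hk⟩

/-! Adjacency in the functional graph does not change which closed sets an orbit enters. -/

lemma enters_iff_apply {f : V → V} {O : Set V} (hO : ∀ o ∈ O, f o ∈ O) (x : V) :
    (∃ o ∈ O, Hits f (f x) o) ↔ ∃ o ∈ O, Hits f x o := by
  constructor
  · rintro ⟨o, ho, h⟩
    exact ⟨o, ho, h.head⟩
  · rintro ⟨o, ho, h⟩
    by_cases hx : x = o
    · exact ⟨f x, hO x (hx ▸ ho), Hits.refl _ _⟩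
    · exact ⟨o, ho, h.of_ne hx⟩

lemma enters_iff_of_reachable {f : V → V} {O : Set V} (hO : ∀ o ∈ O, f o ∈ O) {x y : V}
    (h : (SimpleGraph.fromEdgeSet (arcs f)).Reachable x y) :
    (∃ o ∈ O, Hits f x o) ↔ ∃ o ∈ O, Hits f y o := by
  obtain ⟨p⟩ := h
  induction p with
  | nil => rfl
  | cons hadj _ ih =>
    rw [← ih]
    rw [SimpleGraph.fromEdgeSet_adj] at hadj
    obtain ⟨⟨v, -, hv⟩, -⟩ := hadj
    rcases Sym2.eq_iff.1 hv with ⟨rfl, rfl⟩ | ⟨rfl, rfl⟩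
    · exact (enters_iff_apply hO _).symm
    · exact enters_iff_apply hO _

lemma hits_iff_of_reachable {f : V → V} {a x y : V} (ha : f a = a)
    (h : (SimpleGraph.fromEdgeSet (arcs f)).Reachable x y) : Hits f x a ↔ Hits f y a := by
  simpa using enters_iff_of_reachable (O := {a}) (by simpa using ha) h

lemma reachable_of_hits {f : V → V} {x y : V} (h : Hits f x y) :
    (SimpleGraph.fromEdgeSet (arcs f)).Reachable x y := by
  refine h.induct _ (SimpleGraph.Reachable.refl x) fun z _ hz => hz.trans ?_
  by_cases hf : f z = z
  · rw [hf]
  · exact SimpleGraph.Adj.reachable ((SimpleGraph.fromEdgeSet_adj _).2 ⟨⟨z, hf, rfl⟩, Ne.symm hf⟩)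

variable [DecidableEq V]

lemma arcs_diff_subset_arcs_update (f : V → V) (z : V) :
    arcs f \ {s(z, f z)} ⊆ arcs (update f z z) := by
  rintro _ ⟨⟨v, hv, rfl⟩, hne⟩
  have hvz : v ≠ z := by rintro rfl; exact hne rfl
  exact ⟨v, by rwa [update_of_ne hvz], by rw [update_of_ne hvz]⟩

lemma hits_update_self_iff {f : V → V} {x z : V} : Hits (update f z z) x z ↔ Hits f x z := by
  constructor
  · intro h
    refine h.induct_back (fun x => Hits f x z) (Hits.refl f z) fun y hy hyz => ?_
    rw [update_of_ne hy] at hyz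
    exact hyz.head
  · intro h
    refine h.induct_back (fun x => Hits (update f z z) x z) (Hits.refl _ z)
      fun y hy hyz => Hits.head ?_
    rwa [update_of_ne hy]

/-- Every edge of a cycle of the graph `arcs f` is `z — f z` for some `z` on a cycle of the
function `f`: its removal does not separate `f z` from the new fixed point `z`. -/
lemma exists_cyc_of_mem_edges {f : V → V} {u : V}
    {p : (SimpleGraph.fromEdgeSet (arcs f)).Walk u u} (hp : p.IsCycle) {e : Sym2 V}
    (he : e ∈ p.edges) : ∃ z, f z ≠ z ∧ s(z, f z) = e ∧ Cyc f z := by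
  have hmem := p.edges_subset_edgeSet he
  rw [SimpleGraph.edgeSet_fromEdgeSet] at hmem
  obtain ⟨⟨z, hz, rfl⟩, -⟩ := hmem
  refine ⟨z, hz, rfl, ?_⟩
  have h := (SimpleGraph.adj_and_reachable_delete_edges_iff_exists_cycle.2 ⟨u, p, hp, he⟩).2
  have hle : (SimpleGraph.fromEdgeSet (arcs f)).deleteEdges {s(z, f z)} ≤
      SimpleGraph.fromEdgeSet (arcs (update f z z)) := by
    intro a b hab
    rw [SimpleGraph.deleteEdges_adj, SimpleGraph.fromEdgeSet_adj] at hab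
    exact (SimpleGraph.fromEdgeSet_adj _).2
      ⟨arcs_diff_subset_arcs_update f z ⟨hab.1.1, hab.2⟩, hab.1.2⟩
  have h' := (hits_iff_of_reachable (update_self z z f) (h.mono hle)).1 (Hits.refl _ z)
  exact hits_update_self_iff.1 h'

lemma mem_edges_of_cycles {f : V → V} {u v : V}
    {p : (SimpleGraph.fromEdgeSet (arcs f)).Walk u u}
    {q : (SimpleGraph.fromEdgeSet (arcs f)).Walk v v} (hp : p.IsCycle) (hq : q.IsCycle)
    (huv : (SimpleGraph.fromEdgeSet (arcs f)).Reachable u v) {e : Sym2 V} (he : e ∈ p.edges) :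
    e ∈ q.edges := by
  by_contra hne
  obtain ⟨z, hz, rfl, hzc⟩ := exists_cyc_of_mem_edges hp he
  -- `q` survives the removal of `z — f z`, which makes `z` a fixed point
  have hq' : ∀ e' ∈ q.edges, e' ∈ (SimpleGraph.fromEdgeSet (arcs (update f z z))).edgeSet := by
    intro e' he'
    have h1 := q.edges_subset_edgeSet he'
    rw [SimpleGraph.edgeSet_fromEdgeSet] at h1 ⊢
    exact ⟨arcs_diff_subset_arcs_update f z ⟨h1.1, fun h => hne (h ▸ he')⟩, h1.2⟩
  have hqc := hq.transfer hq'
  have hz_reach : (SimpleGraph.fromEdgeSet (arcs f)).Reachable u z :=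
    ⟨p.takeUntil z (p.fst_mem_support_of_mem_edges he)⟩
  obtain ⟨e', he'⟩ := List.exists_mem_of_ne_nil _
    (fun h => hqc.not_nil (SimpleGraph.Walk.edges_eq_nil.1 h) :
      (q.transfer _ hq').edges ≠ [])
  obtain ⟨y, hy, rfl, hyc⟩ := exists_cyc_of_mem_edges hqc he'
  rw [SimpleGraph.Walk.edges_transfer] at he'
  have hy_reach : (SimpleGraph.fromEdgeSet (arcs f)).Reachable v y :=
    ⟨q.takeUntil y (q.fst_mem_support_of_mem_edges he')⟩
  have hyz : Hits f y z := by
    have hO : ∀ o ∈ {o | Hits f z o}, f o ∈ {o | Hits f z o} :=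
      fun o ho => Hits.trans ho (Hits.step f o)
    obtain ⟨o, ho, hyo⟩ := (enters_iff_of_reachable hO
      (hz_reach.symm.trans (huv.trans hy_reach))).1 ⟨z, Hits.refl f z, Hits.refl f z⟩
    exact hyo.trans (hzc.hits_symm ho)
  have h1 := hyc.hits_symm (hits_update_self_iff.2 hyz)
  have h2 := h1.eq_of_fixed (update_self z z f)
  exact hy (by rw [h2, update_self])

/-- The edge set of a functional graph is independent. -/
lemma bicircularIndep_arcs {G : SimpleGraph V} {f : V → V}
    (hf : ∀ v, f v ≠ v → G.Adj v (f v)) : BicircularIndep G (arcs f) := by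
  refine ⟨?_, fun u v p q hp hq huv e => ⟨fun he => mem_edges_of_cycles hp hq huv he,
    fun he => mem_edges_of_cycles hq hp huv.symm he⟩⟩
  rintro _ ⟨v, hv, rfl⟩
  exact hf v hv

/-- If the orbit of `x` ends in the fixed point `a`, reversing the path from `x` to `a` makes `x`
the fixed point in the place of `a`, without changing the edges. -/
lemma exists_reroot {f : V → V} (hf : NoTwo f) {x a : V} (ha : f a = a) (h : Hits f x a) :
    ∃ f', NoTwo f' ∧ arcs f' = arcs f ∧ f' x = x ∧ ∀ z, z ≠ x → (f' z = z ↔ f z = z ∧ z ≠ a) := by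
  obtain ⟨k, hk⟩ := h
  induction k generalizing x with
  | zero =>
    obtain rfl : x = a := hk
    exact ⟨f, hf, rfl, ha, fun z hz => by simp [hz]⟩
  | succ k ih =>
    by_cases hxa : f x = x
    · have : x = a := by rw [← hk, iterate_fixed hxa]
      subst this
      exact ⟨f, hf, rfl, ha, fun z hz => by simp [hz]⟩
    obtain ⟨g, hg2, hg, hgx, hgfix⟩ := ih (x := f x) (by simpa using hk)
    have hgx1 : g x = f x := by
      have : s(x, f x) ∈ arcs g := hg ▸ ⟨x, hxa, rfl⟩
      obtain ⟨z, hz, hzx⟩ := this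
      rcases Sym2.eq_iff.1 hzx with ⟨rfl, h⟩ | ⟨rfl, h⟩
      · exact h
      · exact absurd hgx hz
    set y := f x with hy
    set g' := update (update g y x) x x with hg'
    have h1 : g' x = x := update_self _ _ _
    have h2 : g' y = x := by rw [hg', update_of_ne hxa, update_self]
    have h3 : ∀ z, z ≠ x → z ≠ y → g' z = g z := fun z hz hz' => by
      rw [hg', update_of_ne hz, update_of_ne hz']
    refine ⟨g', ?_, ?_, h1, ?_⟩
    · intro v hv
      by_cases hvx : v = x
      · rw [hvx, h1]
      by_cases hvy : v = y
      · rw [hvy, h2, h1] at hv; exact absurd hv.symm hxa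
      rw [h3 v hvx hvy] at hv ⊢
      by_cases hgv : g v = x
      · rw [hgv, h1] at hv; exact absurd hv.symm hvx
      by_cases hgv' : g v = y
      · rw [hgv', h2] at hv; exact absurd hv.symm hvx
      rw [h3 _ hgv hgv'] at hv
      exact hg2 v hv
    · rw [← hg]
      ext e
      constructor
      · rintro ⟨v, hv, rfl⟩
        by_cases hvx : v = x
        · exact absurd (hvx ▸ h1) hv
        by_cases hvy : v = y
        · rw [hvy, h2]
          exact ⟨x, by rw [hgx1]; exact hxa, by rw [hgx1]; exact Sym2.eq_swap⟩
        rw [h3 v hvx hvy] at hv ⊢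
        exact ⟨v, hv, rfl⟩
      · rintro ⟨v, hv, rfl⟩
        by_cases hvx : v = x
        · rw [hvx, hgx1]
          exact ⟨y, by rw [h2]; exact Ne.symm hxa, by rw [h2]; exact Sym2.eq_swap⟩
        by_cases hvy : v = y
        · exact absurd (hvy ▸ hgx) hv
        exact ⟨v, by rwa [h3 v hvx hvy], by rw [h3 v hvx hvy]⟩
    · intro z hz
      by_cases hzy : z = y
      · rw [hzy, h2]
        constructor
        · intro h; exact absurd h.symm hxa
        · rintro ⟨h, h'⟩
          exact absurd (by rw [← hk, iterate_succ_apply, iterate_fixed h]) h'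
      · rw [h3 z hz hzy, hgfix z hzy]

/-- A fixed point `x` may take over an edge `x — y` that has no owner yet. -/
lemma noTwo_update {f : V → V} (hf : NoTwo f) {x y : V} (hx : f x = x) (hxy : x ≠ y)
    (he : s(x, y) ∉ arcs f) :
    NoTwo (update f x y) ∧ arcs (update f x y) = insert s(x, y) (arcs f) := by
  have hyx : f y ≠ x := fun h => he ⟨y, by rw [h]; exact hxy, by rw [h]; exact Sym2.eq_swap⟩
  constructor
  · intro v hv
    by_cases hvx : v = x
    · rw [hvx, update_self, update_of_ne hxy.symm] at hv
      exact absurd hv hyx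
    · rw [update_of_ne hvx] at hv ⊢
      by_cases hfv : f v = x
      · rw [hfv, update_self] at hv
        exact absurd (hv ▸ hfv) hyx
      · rw [update_of_ne hfv] at hv
        exact hf v hv
  · ext e
    constructor
    · rintro ⟨v, hv, rfl⟩
      by_cases hvx : v = x
      · left; rw [hvx, update_self]
      · right
        rw [update_of_ne hvx] at hv ⊢
        exact ⟨v, hv, rfl⟩
    · rintro (rfl | ⟨v, hv, rfl⟩)
      · exact ⟨x, by rw [update_self]; exact hxy.symm, by rw [update_self]⟩
      · have hvx : v ≠ x := by rintro rfl; exact hv hx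
        exact ⟨v, by rwa [update_of_ne hvx], by rw [update_of_ne hvx]⟩

/-- Rerooting at `x` and then giving the edge `x — y` to `x`. -/
lemma exists_insert {f : V → V} (hf : NoTwo f) {x y a : V} (ha : f a = a) (h : Hits f x a)
    (hxy : x ≠ y) (he : s(x, y) ∉ arcs f) :
    ∃ f', NoTwo f' ∧ arcs f' = insert s(x, y) (arcs f) ∧ ∀ z, f' z = z ↔ f z = z ∧ z ≠ a := by
  obtain ⟨g, hg2, hg, hgx, hgfix⟩ := exists_reroot hf ha h
  obtain ⟨h1, h2⟩ := noTwo_update hg2 hgx hxy (hg ▸ he)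
  refine ⟨_, h1, by rw [h2, hg], fun z => ?_⟩
  by_cases hz : z = x
  · rw [hz, update_self]
    refine ⟨fun h => absurd h.symm hxy, fun ⟨h', hne⟩ => absurd (h.eq_of_fixed h').symm hne⟩
  · rw [update_of_ne hz, hgfix z hz]

end Basic

end FunGraph

/-! ### Independent sets are edge sets of functional graphs -/

namespace FunGraph

open Function

section Independent

variable {V : Type*} {G : SimpleGraph V}

lemma bicircularIndep_mono {R R' : Set (Sym2 V)} (h : BicircularIndep G R) (hR : R' ⊆ R) :
    BicircularIndep G R' := by
  have hle : SimpleGraph.fromEdgeSet R' ≤ SimpleGraph.fromEdgeSet R :=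
    SimpleGraph.fromEdgeSet_mono hR
  refine ⟨hR.trans h.1, fun u v p q hp hq huv e => ?_⟩
  have := h.2 u v (p.mapLe hle) (q.mapLe hle) (hp.mapLe hle) (hq.mapLe hle) (huv.mono hle) e
  simpa [SimpleGraph.Walk.edges_mapLe_eq_edges] using this

lemma exists_hits_cyc [Finite V] {f : V → V} (x : V) : ∃ z, Hits f x z ∧ Cyc f z := by
  obtain ⟨i, j, hij, h⟩ := Finite.exists_ne_map_eq_of_infinite fun k => f^[k] x
  wlog hlt : i < j generalizing i j
  · exact this j i hij.symm h.symm (by omega)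
  obtain ⟨k, rfl⟩ := Nat.exists_eq_add_of_lt hlt
  refine ⟨f^[i] x, ⟨i, rfl⟩, ⟨k, ?_⟩⟩
  have h : f^[i] x = f^[i + k + 1] x := h
  conv_rhs => rw [h]
  rw [← iterate_succ_apply' f, ← iterate_add_apply]
  exact congrArg (fun t => f^[t] x) (by omega)

/-- A cycle of length at least three of the function `f` gives a cycle of the graph. -/
lemma exists_isCycle_of_cyc {f : V → V} (hf : NoTwo f) {x : V} (hx : Cyc f x) (hfx : f x ≠ x) :
    ∃ (u : V) (p : (SimpleGraph.fromEdgeSet (arcs f)).Walk u u), p.IsCycle ∧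
      s(x, f x) ∈ p.edges := by
  classical
  refine SimpleGraph.adj_and_reachable_delete_edges_iff_exists_cycle.1
    ⟨(SimpleGraph.fromEdgeSet_adj _).2 ⟨⟨x, hfx, rfl⟩, Ne.symm hfx⟩, ?_⟩
  refine SimpleGraph.Reachable.mono ?_
    (reachable_of_hits (hits_update_self_iff.2 hx : Hits (update f x x) (f x) x)).symm
  intro a b hab
  obtain ⟨⟨v, hv, hvab⟩, hne⟩ := (SimpleGraph.fromEdgeSet_adj _).1 hab
  have hvx : v ≠ x := by rintro rfl; exact hv (update_self _ _ _)
  rw [update_of_ne hvx] at hv hvab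
  rw [SimpleGraph.deleteEdges_adj, SimpleGraph.fromEdgeSet_adj]
  refine ⟨⟨⟨v, hv, hvab⟩, hne⟩, ?_⟩
  rw [← hvab]
  intro h
  rcases Sym2.eq_iff.1 h with ⟨h1, -⟩ | ⟨h1, h2⟩
  · exact hvx h1
  · exact hfx (hf x (by rw [← h1, h2]))

/-- Every independent set is the edge set of a functional graph in which no edge has two owners.
Edges are added one by one; if neither end of the new edge can be freed, both lie in components with
a cycle already, and the new edge makes two cycles in one component. -/
lemma exists_arcs_eq [Finite V] {R : Set (Sym2 V)} (hR : BicircularIndep G R) :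
    ∃ f : V → V, NoTwo f ∧ arcs f = R := by
  classical
  induction R, R.toFinite using Set.Finite.induction_on with
  | empty =>
    refine ⟨id, fun v _ => rfl, ?_⟩
    ext e
    simp [arcs]
  | @insert e R heR _ ih =>
    obtain ⟨f, hf, rfl⟩ := ih (bicircularIndep_mono hR (Set.subset_insert e R))
    induction e with | h a b => ?_
    have hadj : G.Adj a b := hR.1 (Set.mem_insert _ _)
    by_cases ha : ∃ z, f z = z ∧ Hits f a z
    · obtain ⟨z, hz, haz⟩ := ha
      obtain ⟨f', h1, h2, -⟩ := exists_insert hf hz haz hadj.ne heR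
      exact ⟨f', h1, h2⟩
    by_cases hb : ∃ z, f z = z ∧ Hits f b z
    · obtain ⟨z, hz, hbz⟩ := hb
      obtain ⟨f', h1, h2, -⟩ := exists_insert hf hz hbz hadj.ne.symm (Sym2.eq_swap ▸ heR)
      exact ⟨f', h1, by rw [h2, Sym2.eq_swap]⟩
    exfalso
    obtain ⟨x, hax, hx⟩ := exists_hits_cyc (f := f) a
    obtain ⟨y, hby, hy⟩ := exists_hits_cyc (f := f) b
    obtain ⟨u, p, hp, hxp⟩ := exists_isCycle_of_cyc hf hx fun h => ha ⟨x, h, hax⟩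
    obtain ⟨v, q, hq, hyq⟩ := exists_isCycle_of_cyc hf hy fun h => hb ⟨y, h, hby⟩
    have hle : SimpleGraph.fromEdgeSet (arcs f) ≤
        SimpleGraph.fromEdgeSet (insert s(a, b) (arcs f)) :=
      SimpleGraph.fromEdgeSet_mono (Set.subset_insert _ _)
    have hua : (SimpleGraph.fromEdgeSet (arcs f)).Reachable u a :=
      (p.takeUntil x (p.fst_mem_support_of_mem_edges hxp)).reachable.trans
        (reachable_of_hits hax).symm
    have hvb : (SimpleGraph.fromEdgeSet (arcs f)).Reachable v b :=
      (q.takeUntil y (q.fst_mem_support_of_mem_edges hyq)).reachable.trans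
        (reachable_of_hits hby).symm
    have hab : (SimpleGraph.fromEdgeSet (insert s(a, b) (arcs f))).Adj a b :=
      (SimpleGraph.fromEdgeSet_adj _).2 ⟨Set.mem_insert _ _, hadj.ne⟩
    have huv := (hua.mono hle).trans (hab.reachable.trans (hvb.mono hle).symm)
    have hpq := hR.2 u v (p.mapLe hle) (q.mapLe hle) (hp.mapLe hle) (hq.mapLe hle) huv
    simp only [SimpleGraph.Walk.edges_mapLe_eq_edges] at hpq
    -- the cycles have the same edges, hence `a` and `b` are connected without the new edge
    have hxq := (hpq _).1 hxp
    have hreach : (SimpleGraph.fromEdgeSet (arcs f)).Reachable a b :=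
      (reachable_of_hits hax).trans
        ((q.takeUntil x (q.fst_mem_support_of_mem_edges hxq)).reachable.symm.trans hvb)
    have hdel : SimpleGraph.fromEdgeSet (arcs f) ≤
        (SimpleGraph.fromEdgeSet (insert s(a, b) (arcs f))).deleteEdges {s(a, b)} := by
      intro c d hcd
      rw [SimpleGraph.fromEdgeSet_adj] at hcd
      rw [SimpleGraph.deleteEdges_adj, SimpleGraph.fromEdgeSet_adj]
      exact ⟨⟨Set.mem_insert_of_mem _ hcd.1, hcd.2⟩, fun h => heR (h ▸ hcd.1)⟩
    obtain ⟨t, r, hr, hab_r⟩ := SimpleGraph.adj_and_reachable_delete_edges_iff_exists_cycle.1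
      ⟨hab, hreach.mono hdel⟩
    have hta : (SimpleGraph.fromEdgeSet (insert s(a, b) (arcs f))).Reachable t a :=
      ⟨r.takeUntil a (r.fst_mem_support_of_mem_edges hab_r)⟩
    have h1 := (hR.2 t u r (p.mapLe hle) hr (hp.mapLe hle) (hta.trans (hua.mono hle).symm) _).1
      hab_r
    rw [SimpleGraph.Walk.edges_mapLe_eq_edges] at h1
    have h2 := p.edges_subset_edgeSet h1
    rw [SimpleGraph.edgeSet_fromEdgeSet] at h2
    exact heR h2.1

lemma ncard_arcs {f : V → V} (hf : NoTwo f) : (arcs f).ncard = {v | f v ≠ v}.ncard := by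
  have h : arcs f = (fun v => s(v, f v)) '' {v | f v ≠ v} := by
    ext e
    simp [arcs]
  rw [h]
  refine Set.InjOn.ncard_image fun v hv v' _ h => ?_
  rcases Sym2.eq_iff.1 h with ⟨h, -⟩ | ⟨h1, h2⟩
  · exact h
  · exact absurd (hf v (by rw [h2, ← h1])) hv

variable [Fintype V]

/-- In a connected graph with at least as many edges as vertices, the tree of vertices whose orbit
ends in a given fixed point `a` can be left along an edge, or there is an edge that closes a cycle
in it. -/
lemma exists_free_edge (hG : G.Connected) (hm : Fintype.card V ≤ G.edgeSet.ncard) {f : V → V}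
    {a : V} (ha : f a = a) :
    ∃ x y, G.Adj x y ∧ Hits f x a ∧ s(x, y) ∉ arcs f := by
  classical
  by_cases hall : ∀ w, Hits f w a
  · have hcard : (arcs f).ncard < G.edgeSet.ncard := by
      have hsub : arcs f ⊆ (fun v => s(v, f v)) '' {a}ᶜ := by
        rintro _ ⟨v, hv, rfl⟩
        exact ⟨v, by rintro rfl; exact hv ha, rfl⟩
      have h1 := Set.ncard_le_ncard hsub
      have h2 := Set.ncard_image_le (f := fun v => s(v, f v)) (Set.toFinite ({a}ᶜ : Set V))
      have h3 := Set.ncard_add_ncard_compl ({a} : Set V)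
      rw [Set.ncard_singleton, Nat.card_eq_fintype_card] at h3
      omega
    obtain ⟨e, he, he'⟩ := Set.exists_mem_notMem_of_ncard_lt_ncard hcard
    induction e with | h x y => exact ⟨x, y, he, hall x, he'⟩
  · push Not at hall
    obtain ⟨w, hw⟩ := hall
    obtain ⟨p⟩ := hG.preconnected a w
    obtain ⟨d, -, hd1, hd2⟩ := p.exists_boundary_dart {x | Hits f x a} (Hits.refl f a) hw
    refine ⟨d.fst, d.snd, d.adj, hd1, ?_⟩
    rintro ⟨v, hv, hve⟩
    rcases Sym2.eq_iff.1 hve with ⟨h1, h2⟩ | ⟨h1, h2⟩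
    · refine hd2 ?_
      have : v ≠ a := by rintro rfl; exact hv ha
      rw [← h2]
      exact Hits.of_ne (h1 ▸ hd1) this
    · refine hd2 (Hits.head ?_)
      rw [← h1, h2]
      exact hd1

end Independent

end FunGraph

/-! ### Orientations of the cycles -/

namespace FunGraph

open Function

section Orientation

variable {V : Type*} [LinearOrder V]

/-- `x` is the least vertex of a cycle of `f`, `y` is its predecessor on the cycle, and `y` does not
exceed the successor `f x`. Of the two orientations of a cycle of length at least three, exactly one
is bad in this sense; cycles of length two are always bad, and loops are not. -/
def BadMin (f : V → V) (x y : V) : Prop :=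
  f y = x ∧ f x ≠ x ∧ Hits f x y ∧ (∀ z, Hits f x z → x ≤ z) ∧ y ≤ f x

/-- `v` lies on a bad cycle of `f`. -/
def BadThru (f : V → V) (v : V) : Prop := ∃ x y, BadMin f x y ∧ Hits f x v

/-- `f` has no bad cycle. -/
def Good (f : V → V) : Prop := ∀ x y, ¬ BadMin f x y

lemma BadMin.cyc {f : V → V} {x y : V} (h : BadMin f x y) : Cyc f x := by
  obtain ⟨h1, h2, h3, -⟩ := h
  have : Hits f x x := Hits.trans h3 (h1 ▸ Hits.step f y)
  have hyx : Hits f y x := h1 ▸ Hits.step f y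
  by_cases hxy : x = y
  · exact absurd (by rw [← hxy] at h1; exact h1) h2
  · exact (h3.of_ne hxy).trans hyx

lemma BadThru.cyc {f : V → V} {v : V} (h : BadThru f v) : Cyc f v := by
  obtain ⟨x, y, h, hv⟩ := h
  exact h.cyc.of_hits hv

lemma BadThru.of_hits {f : V → V} {v w : V} (h : BadThru f v) (hw : Hits f v w) :
    BadThru f w := by
  obtain ⟨x, y, h, hv⟩ := h
  exact ⟨x, y, h, hv.trans hw⟩

lemma BadThru.ne {f : V → V} {v : V} (h : BadThru f v) : f v ≠ v := by
  intro hv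
  obtain ⟨x, y, h, hxv⟩ := h
  have := (h.cyc.hits_symm hxv).eq_of_fixed hv
  exact h.2.1 (this ▸ hv)

lemma BadMin.badThru {f : V → V} {x y : V} (h : BadMin f x y) : BadThru f x :=
  ⟨x, y, h, Hits.refl f x⟩

lemma good_iff {f : V → V} : Good f ↔ ∀ v, ¬ BadThru f v :=
  ⟨fun h _ ⟨x, y, hb, _⟩ => h x y hb, fun h x _ hb => h x hb.badThru⟩

/-- The test made by the program: `x` is the least vertex of the cycle through `v`, and `y` its
predecessor. -/
lemma badThru_iff {f : V → V} {v x y : V} (hv : Cyc f v) (hx : Hits f v x) (hfx : f x ≠ x)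
    (hmin : ∀ z, Hits f v z → x ≤ z) (hy : Hits f x y) (hyx : f y = x) :
    BadThru f v ↔ y ≤ f x := by
  constructor
  · rintro ⟨x', y', hb, hv'⟩
    have hvx' := hb.cyc.hits_symm hv'
    obtain rfl : x' = x := le_antisymm (hb.2.2.2.1 x (hv'.trans hx)) (hmin x' hvx')
    have : y' = y := ((hv.of_hits hx).of_hits hb.2.2.1).injOn
      ((hv.of_hits hx).of_hits hy) (hb.1.trans hyx.symm)
    exact this ▸ hb.2.2.2.2
  · intro h
    exact ⟨x, y, ⟨hyx, hfx, hy, fun z hz => hmin z (hx.trans hz), h⟩, hv.hits_symm hx⟩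

/-- Badness of a cycle depends only on the values on the cycle. -/
lemma BadMin.congr {f g : V → V} {x y : V} (h : BadMin f x y) (hfg : ∀ z, Hits f x z → g z = f z) :
    BadMin g x y := by
  obtain ⟨h1, h2, h3, h4, h5⟩ := h
  have hx := hfg x (Hits.refl f x)
  refine ⟨by rw [hfg y h3, h1], by rwa [hx], h3.congr hfg, fun z hz => h4 z ?_, by rwa [hx]⟩
  exact (Hits.congr_iff hfg).1 hz

lemma BadThru.congr {f g : V → V} {v : V} (h : BadThru f v) (hfg : ∀ z, Hits f v z → g z = f z) :
    BadThru g v := by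
  obtain ⟨x, y, hb, hv⟩ := h
  have hfg' : ∀ z, Hits f x z → g z = f z := fun z hz =>
    hfg z ((hb.cyc.hits_symm hv).trans hz)
  exact ⟨x, y, hb.congr hfg', hv.congr hfg'⟩

lemma Good.noTwo {f : V → V} (hf : Good f) : NoTwo f := by
  have key : ∀ v, f (f v) = v → v < f v → False := by
    intro v hv hlt
    refine hf v (f v) ⟨hv, hlt.ne', Hits.step f v, fun z hz => ?_, le_rfl⟩
    have : z = v ∨ z = f v := hz.induct (fun z => z = v ∨ z = f v) (Or.inl rfl) fun z _ h => by
      rcases h with rfl | rfl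
      · exact Or.inr rfl
      · exact Or.inl hv
    rcases this with rfl | rfl
    · exact le_rfl
    · exact hlt.le
  intro v hv
  rcases lt_trichotomy v (f v) with h | h | h
  · exact (key v hv h).elim
  · exact h.symm
  · exact (key (f v) (by rw [hv]) (by rwa [hv])).elim

omit [LinearOrder V] in
/-- Two functions with the same edges and the same fixed points differ by reversal of cycles. -/
lemma reversed_of_ne {f g : V → V} (hf : NoTwo f) (harcs : arcs f = arcs g)
    (hfix : ∀ v, f v = v ↔ g v = v) {v : V} (hv : f v ≠ g v) :
    g (f v) = v ∧ f (f v) ≠ g (f v) := by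
  have hfv : f v ≠ v := fun h => hv (h.trans ((hfix v).1 h).symm)
  have : s(v, f v) ∈ arcs g := harcs ▸ ⟨v, hfv, rfl⟩
  obtain ⟨z, hz, hzv⟩ := this
  rcases Sym2.eq_iff.1 hzv with ⟨rfl, h⟩ | ⟨rfl, h⟩
  · exact absurd h.symm hv
  · refine ⟨h, fun h' => hfv (hf v (h'.trans h))⟩

variable [Finite V]

omit [LinearOrder V] in
lemma cyc_of_ne {f g : V → V} (hf : NoTwo f)
    (harcs : arcs f = arcs g) (hfix : ∀ v, f v = v ↔ g v = v) {v : V} (hv : f v ≠ g v) :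
    Cyc f v ∧ ∀ z, Hits f v z → f z ≠ g z ∧ Hits g z v := by
  have hrev := fun {v} => reversed_of_ne (v := v) hf harcs hfix
  have hD : ∀ w, f w ≠ g w → ∀ z, Hits f w z → f z ≠ g z := fun w hw z hz =>
    hz.induct (fun z => f z ≠ g z) hw fun z _ h => (hrev h).2
  have hback : ∀ z, Hits f v z → Hits g z v := fun z hz =>
    hz.induct (fun z => Hits g z v) (Hits.refl g v) fun z hvz h =>
      Hits.head (by rwa [(hrev (hD v hv z hvz)).1])
  refine ⟨?_, fun z hz => ⟨hD v hv z hz, hback z hz⟩⟩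
  obtain ⟨z, hvz, hz⟩ := exists_hits_cyc (f := f) v
  refine ((hback z hvz).induct (fun v => Cyc f v ∧ f v ≠ g v) ⟨hz, hD v hv z hvz⟩
    fun w _ hw => ?_).1
  obtain ⟨y, hy, hyw⟩ := hw.1.exists_pred
  have hDy := hD w hw.2 y hy
  have hgw : g w = y := by rw [← hyw]; exact (hrev hDy).1
  rw [hgw]
  exact ⟨hw.1.of_hits hy, hDy⟩

/-- If two functions with the same edges and the same fixed points differ at `v`, then `v` lies on
a cycle of one that is reversed in the other, and it is bad in exactly one of them. -/
lemma badThru_iff_not_of_ne {f g : V → V} (hf : NoTwo f) (hg : NoTwo g)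
    (harcs : arcs f = arcs g) (hfix : ∀ v, f v = v ↔ g v = v) {v : V} (hv : f v ≠ g v) :
    (∀ z, Hits f v z → f z ≠ g z) ∧ (BadThru f v ↔ ¬ BadThru g v) := by
  have hrev := fun {v} => reversed_of_ne (v := v) hf harcs hfix
  have hc := fun {v} => cyc_of_ne (v := v) hf harcs hfix
  have hc' := fun {v} => cyc_of_ne (v := v) hg harcs.symm fun v => (hfix v).symm
  have hcyc := (hc hv).1
  have hD : ∀ z, Hits f v z → f z ≠ g z := fun z hz => ((hc hv).2 z hz).1
  have hiff : ∀ z, Hits f v z ↔ Hits g v z := by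
    intro z
    constructor
    · intro h
      obtain ⟨h1, h2⟩ := (hc hv).2 z h
      exact (hc' h1.symm).1.hits_symm h2
    · intro h
      obtain ⟨h1, h2⟩ := (hc' hv.symm).2 z h
      exact (hc h1.symm).1.hits_symm h2
  refine ⟨hD, ?_⟩
  obtain ⟨x, hx, hmin⟩ := Set.exists_min_image {z | Hits f v z} id (Set.toFinite _)
    ⟨v, Hits.refl f v⟩
  have hmin : ∀ z, Hits f v z → x ≤ z := hmin
  have hx : Hits f v x := hx
  obtain ⟨y, hy, hyx⟩ := (hcyc.of_hits hx).exists_pred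
  have hgx : g x = y := by rw [← hyx]; exact (hrev (hD y (hx.trans hy))).1
  have hne : f x ≠ y := fun h => hD x hx (h.trans hgx.symm)
  have hfx : f x ≠ x := fun h => hne (by
    rw [h]; exact (hy.eq_of_fixed h).symm)
  have hgfx : g (f x) = x := (hrev (hD x hx)).1
  have hf_iff : BadThru f v ↔ y ≤ f x := badThru_iff hcyc hx hfx hmin hy hyx
  have hgc : Cyc g v := (hc' hv.symm).1
  have hgx' : Hits g v x := (hiff x).1 hx
  have hg_iff : BadThru g v ↔ f x ≤ y := by
    rw [← hgx]
    refine badThru_iff hgc hgx' (fun h => hfx ((hfix x).2 h))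
      (fun z hz => hmin z ((hiff z).2 hz)) ?_ hgfx
    exact (hgc.hits_symm hgx').trans ((hiff _).1 (hx.trans (Hits.step f x)))
  rw [hf_iff, hg_iff, not_le]
  exact ⟨fun h => lt_of_le_of_ne h hne.symm, le_of_lt⟩

lemma eq_of_good {f g : V → V} (hf : Good f) (hg : Good g) (harcs : arcs f = arcs g)
    (hfix : ∀ v, f v = v ↔ g v = v) : f = g := by
  funext v
  by_contra hv
  have := (badThru_iff_not_of_ne hf.noTwo hg.noTwo harcs hfix hv).2
  exact good_iff.1 hf v (this.2 (good_iff.1 hg v))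

/-- Reversing all bad cycles. -/
lemma exists_good {f : V → V} (hf : NoTwo f) :
    ∃ g, Good g ∧ arcs g = arcs f ∧ ∀ v, g v = v ↔ f v = v := by
  classical
  set g : V → V := fun z => if BadThru f z then f^[minimalPeriod f z - 1] z else f z with hg
  have hgB : ∀ z, BadThru f z → BadThru f (g z) ∧ f (g z) = z ∧ g (f z) = z := by
    intro z hz
    have hper := cyc_iff_mem_periodicPts.1 hz.cyc
    have hpos := minimalPeriod_pos_of_mem_periodicPts hper
    have h1 : g z = f^[minimalPeriod f z - 1] z := if_pos hz
    have h2 : g (f z) = f^[minimalPeriod f z - 1] (f z) := by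
      rw [hg]
      simp only [if_pos (hz.of_hits (Hits.step f z)), minimalPeriod_apply hper]
    refine ⟨h1 ▸ hz.of_hits ⟨_, rfl⟩, ?_, ?_⟩
    · rw [h1, ← iterate_succ_apply' f, Nat.succ_eq_add_one, Nat.sub_add_cancel hpos,
        iterate_minimalPeriod]
    · rw [h2, ← iterate_succ_apply, Nat.succ_eq_add_one, Nat.sub_add_cancel hpos,
        iterate_minimalPeriod]
  have hgN : ∀ z, ¬ BadThru f z → g z = f z := fun z hz => if_neg hz
  have hfix : ∀ v, g v = v ↔ f v = v := by
    intro v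
    by_cases hv : BadThru f v
    · obtain ⟨-, h2, h3⟩ := hgB v hv
      exact ⟨fun h => by rw [h] at h2; exact h2, fun h => by rw [h] at h3; exact h3⟩
    · rw [hgN v hv]
  have harcs : arcs g = arcs f := by
    ext e
    constructor
    · rintro ⟨v, hv, rfl⟩
      by_cases hvB : BadThru f v
      · obtain ⟨h1, h2, h3⟩ := hgB v hvB
        exact ⟨g v, by rw [h2]; exact hv.symm, by rw [h2]; exact Sym2.eq_swap⟩
      · rw [hgN v hvB] at hv ⊢
        exact ⟨v, hv, rfl⟩
    · rintro ⟨v, hv, rfl⟩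
      by_cases hvB : BadThru f v
      · obtain ⟨h1, h2, h3⟩ := hgB v hvB
        exact ⟨f v, by rw [h3]; exact hv.symm, by rw [h3]; exact Sym2.eq_swap⟩
      · exact ⟨v, by rwa [hgN v hvB], by rw [hgN v hvB]⟩
  have hg2 : NoTwo g := by
    intro v hv
    by_cases hvB : BadThru f v
    · obtain ⟨h1, h2, h3⟩ := hgB v hvB
      have h4 := (hgB _ h1).2.1
      rw [hv] at h4
      exact (hfix v).2 (hf v (by rw [h4, h2]))
    · by_cases hB : BadThru f (g v)
      · exact absurd (hv ▸ (hgB _ hB).1) hvB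
      · rw [hgN _ hB] at hv
        rw [hgN v hvB] at hv ⊢
        exact hf v hv
  refine ⟨g, good_iff.2 fun v hv => ?_, harcs, hfix⟩
  by_cases hvB : BadThru f v
  · by_cases hne : f v = g v
    · obtain ⟨h1, h2, h3⟩ := hgB v hvB
      rw [← hne] at h2
      exact hvB.ne (hf v h2)
    · exact (badThru_iff_not_of_ne hf hg2 harcs.symm (fun v => (hfix v).symm) hne).2.1 hvB hv
  · refine hvB (hv.congr fun z hz => ?_)
    by_cases hz' : BadThru f z
    · have : BadThru f v := (hv.cyc.hits_symm hz).induct (fun z => BadThru f z) hz'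
        fun z _ h => (hgB z h).1
      exact absurd this hvB
    · exact (hgN z hz').symm

end Orientation

end FunGraph

/-! ### Configurations and bases -/

namespace FunGraph

open Function

section Conf

variable {V : Type*}

/-- `f` assigns a neighbour to every vertex of `S`; the vertices outside `S` are unassigned, i.e.
fixed points. -/
def IsConf (G : SimpleGraph V) (S : Finset V) (f : V → V) : Prop :=
  (∀ v ∈ S, G.Adj v (f v)) ∧ ∀ v ∉ S, f v = v

lemma IsConf.eq_self_iff {G : SimpleGraph V} {S : Finset V} {f : V → V} (h : IsConf G S f) (v : V) :
    f v = v ↔ v ∉ S :=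
  ⟨fun hv hS => (h.1 v hS).ne hv.symm, h.2 v⟩

lemma IsConf.arcs_subset {G : SimpleGraph V} {S : Finset V} {f : V → V} (h : IsConf G S f) :
    arcs f ⊆ G.edgeSet := by
  rintro _ ⟨v, hv, rfl⟩
  exact h.1 v (by by_contra hS; exact hv (h.2 v hS))

lemma isConf_of_arcs_subset {G : SimpleGraph V} {S : Finset V} {f : V → V}
    (h : arcs f ⊆ G.edgeSet) (hS : ∀ v, f v = v ↔ v ∉ S) : IsConf G S f :=
  ⟨fun v hv => h ⟨v, fun h => (hS v).1 h hv, rfl⟩, fun v hv => (hS v).2 hv⟩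

variable [Fintype V] [LinearOrder V]

open Classical in
/-- The configurations on `S` without bad cycles. -/
noncomputable def goodConf (G : SimpleGraph V) (S : Finset V) : Finset (V → V) :=
  Finset.univ.filter fun f => IsConf G S f ∧ Good f

lemma mem_goodConf {G : SimpleGraph V} {S : Finset V} {f : V → V} :
    f ∈ goodConf G S ↔ IsConf G S f ∧ Good f := by
  simp [goodConf]

variable {G : SimpleGraph V}

/-- A good configuration that misses `a` extends, up to rerooting and reversal of cycles, to one
that misses one vertex less, with one more edge. -/
lemma exists_augment (hG : G.Connected) (hm : Fintype.card V ≤ G.edgeSet.ncard) {S : Finset V}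
    {f : V → V} (hconf : IsConf G S f) (hf : NoTwo f) {a : V} (ha : a ∉ S) :
    ∃ g ∈ goodConf G (insert a S), ∃ t, s(t, g t) ∉ arcs f ∧
      arcs g = insert s(t, g t) (arcs f) := by
  have hfa : f a = a := hconf.2 a ha
  obtain ⟨x, y, hxy, hx, he⟩ := exists_free_edge hG hm hfa
  obtain ⟨f₁, h1, h2, h3⟩ := exists_insert hf hfa hx hxy.ne he
  obtain ⟨g, hg, hg2, hg3⟩ := exists_good h1
  have harcs := hg2.trans h2
  refine ⟨g, mem_goodConf.2 ⟨isConf_of_arcs_subset ?_ fun v => ?_, hg⟩, ?_⟩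
  · rw [harcs]
    exact Set.insert_subset hxy hconf.arcs_subset
  · rw [hg3, h3, hconf.eq_self_iff, Finset.mem_insert, not_or, and_comm]
  · have : s(x, y) ∈ arcs g := harcs ▸ Set.mem_insert _ _
    obtain ⟨t, -, ht⟩ := this
    exact ⟨t, by rwa [ht], by rw [ht, harcs]⟩

lemma goodConf_empty : goodConf G ∅ = {id} := by
  ext f
  rw [mem_goodConf, Finset.mem_singleton]
  constructor
  · intro h
    funext v
    exact h.1.2 v (Finset.notMem_empty v)
  · rintro rfl
    exact ⟨⟨fun v hv => absurd hv (Finset.notMem_empty v), fun v _ => rfl⟩,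
      fun x y h => h.2.1 rfl⟩

lemma goodConf_nonempty (hG : G.Connected) (hm : Fintype.card V ≤ G.edgeSet.ncard)
    (S : Finset V) : (goodConf G S).Nonempty := by
  induction S using Finset.induction_on with
  | empty => exact ⟨id, by rw [goodConf_empty]; exact Finset.mem_singleton_self _⟩
  | insert a S ha ih =>
    obtain ⟨f, hf⟩ := ih
    rw [mem_goodConf] at hf
    obtain ⟨g, hg, -⟩ := exists_augment hG hm hf.1 hf.2.noTwo ha
    exact ⟨g, hg⟩

/-- The bases are the edge sets of the good configurations on the whole vertex set. -/
lemma bijOn_arcs (hG : G.Connected) (hm : Fintype.card V ≤ G.edgeSet.ncard) :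
    Set.BijOn arcs (goodConf G Finset.univ : Set (V → V)) (bicircularBases G) := by
  have hind : ∀ {S : Finset V} {f : V → V}, IsConf G S f → BicircularIndep G (arcs f) :=
    fun hf => bicircularIndep_arcs fun v hv => hf.arcs_subset ⟨v, hv, rfl⟩
  refine ⟨fun f hf => ?_, fun f hf g hg h => ?_, fun R hR => ?_⟩
  · rw [Finset.mem_coe, mem_goodConf] at hf
    refine ⟨hind hf.1, fun R hR hle => ?_⟩
    obtain ⟨g, hg, rfl⟩ := exists_arcs_eq hR
    have h1 : {v | f v ≠ v} = Set.univ := by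
      ext v
      simp [hf.1.eq_self_iff]
    have h2 : (arcs g).ncard ≤ (arcs f).ncard := by
      rw [ncard_arcs hg, ncard_arcs hf.2.noTwo, h1]
      exact Set.ncard_le_ncard (Set.subset_univ _)
    exact (Set.eq_of_subset_of_ncard_le hle h2).symm.subset
  · rw [Finset.mem_coe, mem_goodConf] at hf hg
    exact eq_of_good hf.2 hg.2 h fun v => by rw [hf.1.eq_self_iff, hg.1.eq_self_iff]
  · obtain ⟨f, hf, rfl⟩ := exists_arcs_eq hR.prop
    obtain ⟨g, hg, hg2, hg3⟩ := exists_good hf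
    refine ⟨g, ?_, hg2⟩
    rw [Finset.mem_coe, mem_goodConf]
    refine ⟨isConf_of_arcs_subset (hg2 ▸ hR.prop.1) fun v => ?_, hg⟩
    simp only [Finset.mem_univ, not_true_eq_false, iff_false, hg3]
    intro hv
    set S : Finset V := Finset.univ.filter fun v => f v ≠ v with hS
    have hconf : IsConf G S f := isConf_of_arcs_subset hR.prop.1 fun v => by simp [hS]
    obtain ⟨g', hg', t, ht, hgt⟩ := exists_augment hG hm hconf hf
      (a := v) (by simp [hS, hv])
    have := hR.2 (hind (mem_goodConf.1 hg').1) (hgt ▸ Set.subset_insert _ _)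
    exact ht (this (hgt ▸ Set.mem_insert _ _))

lemma numBicircularBases_eq (hG : G.Connected) (hm : Fintype.card V ≤ G.edgeSet.ncard) :
    numBicircularBases G = (goodConf G Finset.univ).card := by
  rw [numBicircularBases, ← (bijOn_arcs hG hm).ncard_eq, Set.ncard_coe_finset]

end Conf

end FunGraph

/-! ### Popping a bad cycle -/

namespace FunGraph

open Function

section Pop

variable {V : Type*}

open Classical in
/-- Unassign all vertices in the orbit of `v`. -/
noncomputable def pop (f : V → V) (v : V) : V → V := fun z => if Hits f v z then z else f z

open Classical in
/-- The restriction of `f` to the orbit of `v`. -/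
noncomputable def cyclePart (f : V → V) (v : V) : V → V := fun z => if Hits f v z then f z else z

open Classical in
/-- The function that agrees with `c` where `c` is defined, and with `f` elsewhere. -/
noncomputable def merge (c f : V → V) : V → V := fun z => if c z ≠ z then c z else f z

open Classical in
/-- The assigned vertices. -/
noncomputable def supp [Fintype V] (c : V → V) : Finset V := Finset.univ.filter fun z => c z ≠ z

lemma pop_merge {c f : V → V} {v : V} (hc : ∀ z, c z ≠ z ↔ Hits c v z)
    (hf : ∀ z, c z ≠ z → f z = z) : pop (merge c f) v = f := by
  have hagree : ∀ z, Hits c v z → merge c f z = c z := fun z hz => if_pos ((hc z).2 hz)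
  funext z
  by_cases hz : Hits c v z
  · rw [pop, if_pos ((Hits.congr_iff hagree).2 hz), hf z ((hc z).2 hz)]
  · rw [pop, if_neg (fun h => hz ((Hits.congr_iff hagree).1 h)), merge,
      if_neg (fun h => hz ((hc z).1 h))]

lemma mem_supp [Fintype V] {c : V → V} {z : V} : z ∈ supp c ↔ c z ≠ z := by simp [supp]

open Classical in
/-- The neighbours of `v`. -/
noncomputable def nbrs [Fintype V] (G : SimpleGraph V) (v : V) : Finset V :=
  Finset.univ.filter (G.Adj v)

lemma mem_nbrs [Fintype V] {G : SimpleGraph V} {v w : V} : w ∈ nbrs G v ↔ G.Adj v w := by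
  simp [nbrs]

variable [LinearOrder V]

lemma good_update_iff_good_pop {f : V → V} {v : V} (h : BadThru f v) :
    Good (update f v v) ↔ Good (pop f v) := by
  rw [good_iff, good_iff]
  refine forall_congr' fun x => not_congr ?_
  constructor
  · intro hx
    refine hx.congr fun z hz => ?_
    have hzb := hx.of_hits hz
    have hzv : z ≠ v := by rintro rfl; exact hzb.ne (update_self _ _ _)
    have hvz : ¬ Hits f v z := by
      intro hvz
      have h1 := hits_update_self_iff.2 (h.cyc.hits_symm hvz)
      exact hzv ((hzb.cyc.hits_symm h1).eq_of_fixed (update_self _ _ _))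
    rw [update_of_ne hzv, pop, if_neg hvz]
  · intro hx
    refine hx.congr fun z hz => ?_
    have hzb := (hx.of_hits hz).ne
    have hvz : ¬ Hits f v z := fun h => hzb (if_pos h)
    have hzv : z ≠ v := by rintro rfl; exact hvz (Hits.refl _ _)
    rw [update_of_ne hzv, pop, if_neg hvz]

lemma good_iff_good_update {f : V → V} {v : V} :
    Good f ↔ Good (update f v v) ∧ ¬ BadThru f v := by
  constructor
  · refine fun h => ⟨good_iff.2 fun x hx => good_iff.1 h x (hx.congr fun z hz => ?_),
      good_iff.1 h v⟩
    have hzv : z ≠ v := by rintro rfl; exact (hx.of_hits hz).ne (update_self _ _ _)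
    rw [update_of_ne hzv]
  · rintro ⟨h, hv⟩
    refine good_iff.2 fun x hx => good_iff.1 h x (hx.congr fun z hz => ?_)
    have hzv : z ≠ v := by rintro rfl; exact hv (hx.of_hits hz)
    rw [update_of_ne hzv]

variable [Fintype V] (G : SimpleGraph V)

open Classical in
/-- The bad directed cycles of `G`, as functions that are the identity off the cycle. -/
noncomputable def badCycles : Finset (V → V) :=
  Finset.univ.filter fun c => (∀ v, c v ≠ v → G.Adj v (c v)) ∧
    ∃ x, BadThru c x ∧ ∀ z, c z ≠ z → Hits c x z

open Classical in
/-- The configurations on `S` whose only bad cycle goes through `v`. -/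
noncomputable def poppable (S : Finset V) (v : V) : Finset (V → V) :=
  Finset.univ.filter fun f => IsConf G S f ∧ BadThru f v ∧ Good (pop f v)

open Classical in
/-- The bad cycles through `v` inside `S`. -/
noncomputable def badCyclesAt (S : Finset V) (v : V) : Finset (V → V) :=
  (badCycles G).filter fun c => v ∈ supp c ∧ supp c ⊆ S

open Classical in
/-- The bad cycles inside `S`. -/
noncomputable def badCyclesIn (S : Finset V) : Finset (V → V) :=
  (badCycles G).filter fun c => supp c ⊆ S

variable {G}

lemma mem_badCyclesAt {S : Finset V} {v : V} {c : V → V} :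
    c ∈ badCyclesAt G S v ↔ ((∀ v, c v ≠ v → G.Adj v (c v)) ∧ BadThru c v ∧
      ∀ z, c z ≠ z ↔ Hits c v z) ∧ supp c ⊆ S := by
  simp only [badCyclesAt, badCycles, Finset.mem_filter, Finset.mem_univ, true_and, mem_supp]
  constructor
  · rintro ⟨⟨h1, x, hx, h2⟩, h3, h4⟩
    have hv := hx.of_hits (h2 v h3)
    exact ⟨⟨h1, hv, fun z => ⟨fun hz => (hx.cyc.hits_symm (h2 v h3)).trans (h2 z hz),
      fun hz => (hv.of_hits hz).ne⟩⟩, h4⟩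
  · rintro ⟨⟨h1, h2, h3⟩, h4⟩
    exact ⟨⟨h1, v, h2, fun z hz => (h3 z).1 hz⟩, h2.ne, h4⟩

lemma mem_poppable {S : Finset V} {v : V} {f : V → V} :
    f ∈ poppable G S v ↔ IsConf G S f ∧ BadThru f v ∧ Good (pop f v) := by
  simp [poppable]

/-- A configuration whose only bad cycle goes through `v` consists of that cycle and a good
configuration on the other vertices. This independence is what makes popping work. -/
lemma sum_poppable {M : Type*} [AddCommMonoid M] (S : Finset V) (v : V) (H : (V → V) → M) :
    ∑ f ∈ poppable G S v, H (pop f v) =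
      ∑ c ∈ badCyclesAt G S v, ∑ f ∈ goodConf G (S \ supp c), H f := by
  rw [Finset.sum_sigma']
  refine Finset.sum_bij' (fun f _ => ⟨cyclePart f v, pop f v⟩) (fun p _ => merge p.1 p.2)
    ?_ ?_ ?_ ?_ fun _ _ => rfl
  · intro f hf
    obtain ⟨h1, h2, h3⟩ := mem_poppable.1 hf
    have hagree : ∀ z, Hits f v z → cyclePart f v z = f z := fun z hz => if_pos hz
    have hsupp : ∀ z, cyclePart f v z ≠ z ↔ Hits f v z := by
      intro z
      by_cases hz : Hits f v z
      · rw [hagree z hz]; exact ⟨fun _ => hz, fun _ => (h2.of_hits hz).ne⟩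
      · exact ⟨fun h => absurd (if_neg hz) h, fun h => absurd h hz⟩
    have hsub : ∀ z, Hits f v z → z ∈ S := fun z hz => by
      by_contra hS
      exact (h2.of_hits hz).ne (h1.2 z hS)
    simp only [Finset.mem_sigma, mem_badCyclesAt, mem_goodConf]
    refine ⟨⟨⟨fun z hz => ?_, h2.congr hagree, fun z => ?_⟩, fun z hz => ?_⟩, ⟨fun z hz => ?_,
      fun z hz => ?_⟩, h3⟩
    · rw [hagree z ((hsupp z).1 hz)]
      exact h1.1 z (hsub z ((hsupp z).1 hz))
    · rw [hsupp, Hits.congr_iff hagree]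
    · exact hsub z ((hsupp z).1 (mem_supp.1 hz))
    · rw [Finset.mem_sdiff, mem_supp, hsupp] at hz
      rw [pop, if_neg hz.2]
      exact h1.1 z hz.1
    · rw [Finset.mem_sdiff, mem_supp, hsupp] at hz
      by_cases hvz : Hits f v z
      · exact if_pos hvz
      · rw [pop, if_neg hvz]
        exact h1.2 z fun h => hz ⟨h, hvz⟩
  · rintro ⟨c, f⟩ hp
    simp only [Finset.mem_sigma, mem_badCyclesAt, mem_goodConf] at hp
    obtain ⟨⟨⟨h1, h2, h3⟩, h4⟩, h5, h6⟩ := hp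
    have hagree : ∀ z, Hits c v z → merge c f z = c z := fun z hz => if_pos ((h3 z).2 hz)
    have hpop : pop (merge c f) v = f := pop_merge h3 fun z hz =>
      h5.2 z fun h => (Finset.mem_sdiff.1 h).2 (mem_supp.2 hz)
    refine mem_poppable.2 ⟨⟨fun z hz => ?_, fun z hz => ?_⟩, h2.congr hagree, by rwa [hpop]⟩
    · by_cases hc : c z ≠ z
      · simp only [merge, if_pos hc]; exact h1 z hc
      · simp only [merge, if_neg hc]
        exact h5.1 z (Finset.mem_sdiff.2 ⟨hz, by rwa [mem_supp]⟩)
    · have hc : ¬ c z ≠ z := fun hc => hz (h4 (mem_supp.2 hc))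
      simp only [merge, if_neg hc]
      exact h5.2 z fun h => hz (Finset.mem_sdiff.1 h).1
  · intro f hf
    obtain ⟨h1, h2, h3⟩ := mem_poppable.1 hf
    funext z
    by_cases hz : Hits f v z
    · simp [merge, cyclePart, hz, (h2.of_hits hz).ne]
    · simp [merge, cyclePart, hz, pop]
  · rintro ⟨c, f⟩ hp
    simp only [Finset.mem_sigma, mem_badCyclesAt, mem_goodConf] at hp
    obtain ⟨⟨⟨h1, h2, h3⟩, h4⟩, h5, h6⟩ := hp
    have hagree : ∀ z, Hits c v z → merge c f z = c z := fun z hz => if_pos ((h3 z).2 hz)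
    have hpop : pop (merge c f) v = f := pop_merge h3 fun z hz =>
      h5.2 z fun h => (Finset.mem_sdiff.1 h).2 (mem_supp.2 hz)
    have hpart : cyclePart (merge c f) v = c := by
      funext z
      by_cases hz : Hits c v z
      · rw [cyclePart, if_pos ((Hits.congr_iff hagree).2 hz), hagree z hz]
      · rw [cyclePart, if_neg (fun h => hz ((Hits.congr_iff hagree).1 h))]
        by_contra h
        exact hz ((h3 z).1 (Ne.symm h))
    simp only [hpop, hpart]

open Classical in
/-- The configuration after the draw that turned it into `f` by assigning `v`: a bad cycle through
`v` is popped. -/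
noncomputable def settle (f : V → V) (v : V) : V → V := if BadThru f v then pop f v else f

/-- If the configuration is uniformly distributed over the good configurations on `S`, then after
a draw at `v`, and given the set of assigned vertices, it is again uniformly distributed over the
good configurations on that set. -/
lemma sum_settle {M : Type*} [AddCommMonoid M] {S : Finset V} {v : V} (hv : v ∉ S)
    (H : (V → V) → M) :
    ∑ f ∈ goodConf G S, ∑ w ∈ nbrs G v, H (settle (update f v w) v) =
      ∑ f ∈ goodConf G (insert v S), H f +
        ∑ c ∈ badCyclesAt G (insert v S) v, ∑ f ∈ goodConf G (insert v S \ supp c), H f := by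
  classical
  have h1 : ∑ f ∈ goodConf G S, ∑ w ∈ nbrs G v, H (settle (update f v w) v) =
      ∑ f ∈ Finset.univ.filter fun f => IsConf G (insert v S) f ∧ Good (update f v v),
        H (settle f v) := by
    rw [← Finset.sum_product']
    refine Finset.sum_bij' (fun p _ => update p.1 v p.2) (fun f _ => (update f v v, f v))
      ?_ ?_ ?_ ?_ fun _ _ => rfl
    · rintro ⟨f, w⟩ hp
      simp only [Finset.mem_product, mem_goodConf, mem_nbrs] at hp
      obtain ⟨⟨hc, hg⟩, hw⟩ := hp
      simp only [Finset.mem_filter, Finset.mem_univ, true_and, update_idem]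
      refine ⟨⟨fun z hz => ?_, fun z hz => ?_⟩, ?_⟩
      · by_cases hzv : z = v
        · subst hzv; rwa [update_self]
        · rw [update_of_ne hzv]
          exact hc.1 z ((Finset.mem_insert.1 hz).resolve_left hzv)
      · rw [Finset.mem_insert, not_or] at hz
        rw [update_of_ne hz.1]
        exact hc.2 z hz.2
      · rwa [update_eq_self_iff.2 (hc.2 v hv).symm]
    · intro f hf
      simp only [Finset.mem_filter, Finset.mem_univ, true_and] at hf
      simp only [Finset.mem_product, mem_goodConf, mem_nbrs]
      refine ⟨⟨⟨fun z hz => ?_, fun z hz => ?_⟩, hf.2⟩, hf.1.1 v (Finset.mem_insert_self v S)⟩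
      · rw [update_of_ne (by rintro rfl; exact hv hz)]
        exact hf.1.1 z (Finset.mem_insert_of_mem hz)
      · by_cases hzv : z = v
        · subst hzv; rw [update_self]
        · rw [update_of_ne hzv]
          exact hf.1.2 z (by simp [hzv, hz])
    · rintro ⟨f, w⟩ hp
      simp only [Finset.mem_product, mem_goodConf] at hp
      simp [update_eq_self_iff, hp.1.1.2 v hv]
    · intro f _
      simp
  rw [h1, ← Finset.sum_filter_add_sum_filter_not _ (fun f => BadThru f v), add_comm,
    ← sum_poppable]
  congr 1
  · refine Finset.sum_congr ?_ fun f hf => ?_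
    · ext f
      simp only [Finset.mem_filter, Finset.mem_univ, true_and, mem_goodConf]
      rw [and_assoc, ← good_iff_good_update]
    · rw [mem_goodConf] at hf
      rw [settle, if_neg (good_iff.1 hf.2 v)]
  · refine Finset.sum_congr ?_ fun f hf => ?_
    · ext f
      simp only [Finset.mem_filter, Finset.mem_univ, true_and, mem_poppable]
      constructor
      · rintro ⟨⟨a, b⟩, c⟩; exact ⟨a, c, (good_update_iff_good_pop c).1 b⟩
      · rintro ⟨a, b, c⟩; exact ⟨⟨a, (good_update_iff_good_pop b).2 c⟩, b⟩
    · rw [settle, if_pos (mem_poppable.1 hf).2.1]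

end Pop

end FunGraph

/-! ### Counting good configurations -/

namespace FunGraph

open Function

section Count

variable {V : Type*} [Fintype V] [LinearOrder V] (G : SimpleGraph V)

/-- The number of good configurations on `S`. -/
noncomputable def numGood (S : Finset V) : ℕ := (goodConf G S).card

/-- The number of pairs of a vertex and a configuration on `S` whose only bad cycle goes through
this vertex. Divided by `numGood G S`, it is the expected number of vertices that get unassigned
until all vertices of `S` are assigned. -/
noncomputable def numPopped (S : Finset V) : ℕ :=
  ∑ c ∈ badCyclesIn G S, (supp c).card * numGood G (S \ supp c)

variable {G}

lemma numGood_mul_card_nbrs {S : Finset V} {v : V} (hv : v ∉ S) :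
    numGood G S * (nbrs G v).card = numGood G (insert v S) +
      ∑ c ∈ badCyclesAt G (insert v S) v, numGood G (insert v S \ supp c) := by
  have := sum_settle (G := G) hv (fun _ => (1 : ℕ))
  simpa [numGood] using this

lemma badCyclesAt_eq_filter (S : Finset V) (v : V) :
    badCyclesAt G S v = (badCyclesIn G S).filter fun c => v ∈ supp c := by
  ext c
  simp only [badCyclesAt, badCyclesIn, Finset.mem_filter]
  tauto

/-- The balance equation of `numPopped` for a draw at `v`. -/
lemma numPopped_balance {S : Finset V} {v : V} (hv : v ∉ S) :
    numPopped G S * (nbrs G v).card +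
        ∑ c ∈ badCyclesAt G (insert v S) v, (supp c).card * numGood G (insert v S \ supp c) =
      numPopped G (insert v S) +
        ∑ c ∈ badCyclesAt G (insert v S) v, numPopped G (insert v S \ supp c) := by
  classical
  have h1 : numPopped G (insert v S) =
      ∑ c ∈ badCyclesAt G (insert v S) v, (supp c).card * numGood G (insert v S \ supp c) +
      ∑ c ∈ badCyclesIn G S, (supp c).card * numGood G (insert v S \ supp c) := by
    rw [numPopped, ← Finset.sum_filter_add_sum_filter_not _ (fun c => v ∈ supp c),
      badCyclesAt_eq_filter]
    congr 1
    refine Finset.sum_congr ?_ fun _ _ => rfl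
    ext c
    simp only [badCyclesIn, Finset.mem_filter]
    constructor
    · rintro ⟨⟨h1, h2⟩, h3⟩
      exact ⟨h1, (Finset.subset_insert_iff_of_notMem h3).1 h2⟩
    · rintro ⟨h1, h2⟩
      exact ⟨⟨h1, h2.trans (Finset.subset_insert v S)⟩, fun h => hv (h2 h)⟩
  have h2 : ∑ c ∈ badCyclesAt G (insert v S) v, numPopped G (insert v S \ supp c) =
      ∑ c ∈ badCyclesIn G S, ∑ c' ∈ badCyclesAt G (insert v (S \ supp c)) v,
        (supp c).card * numGood G (insert v (S \ supp c) \ supp c') := by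
    have hsd : ∀ c ∈ badCyclesIn G S, insert v (S \ supp c) = insert v S \ supp c := by
      intro c hc
      rw [Finset.insert_sdiff_of_notMem]
      exact fun h => hv ((Finset.mem_filter.1 hc).2 h)
    have hr : ∀ c ∈ badCyclesIn G S, (∑ c' ∈ badCyclesAt G (insert v (S \ supp c)) v,
        (supp c).card * numGood G (insert v (S \ supp c) \ supp c')) =
        ∑ c' ∈ badCyclesAt G (insert v S \ supp c) v,
          (supp c).card * numGood G ((insert v S \ supp c) \ supp c') :=
      fun c hc => by rw [hsd c hc]
    rw [Finset.sum_congr rfl hr]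
    simp only [numPopped]
    rw [Finset.sum_comm' (t' := badCyclesIn G S)
      (s' := fun c => badCyclesAt G (insert v S \ supp c) v)]
    · exact Finset.sum_congr rfl fun c _ => Finset.sum_congr rfl fun c' _ => by
        rw [sdiff_right_comm]
    · intro c' c
      simp only [badCyclesAt, badCyclesIn, Finset.mem_filter, Finset.subset_sdiff]
      constructor
      · rintro ⟨⟨h1, h2, h3⟩, h4, h5, h6⟩
        refine ⟨⟨h1, h2, h3, h6.symm⟩, h4, ?_⟩
        exact (Finset.subset_insert_iff_of_notMem fun h => Finset.disjoint_left.1 h6 h h2).1 h5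
      · rintro ⟨⟨h1, h2, h3, h4⟩, h5, h6⟩
        exact ⟨⟨h1, h2, h3⟩, h5, h6.trans (Finset.subset_insert v S), h4.symm⟩
  have h3 : numPopped G S * (nbrs G v).card =
      ∑ c ∈ badCyclesIn G S, (supp c).card * numGood G (insert v S \ supp c) +
      ∑ c ∈ badCyclesIn G S, ∑ c' ∈ badCyclesAt G (insert v (S \ supp c)) v,
        (supp c).card * numGood G (insert v (S \ supp c) \ supp c') := by
    rw [numPopped, Finset.sum_mul, ← Finset.sum_add_distrib]
    refine Finset.sum_congr rfl fun c hc => ?_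
    rw [mul_assoc, numGood_mul_card_nbrs (fun h => hv (Finset.mem_sdiff.1 h).1), mul_add,
      Finset.mul_sum, Finset.insert_sdiff_of_notMem _ fun h => hv ((Finset.mem_filter.1 hc).2 h)]
  rw [h1, h2, h3]
  ring

lemma numPopped_eq_sum (S : Finset V) : numPopped G S = ∑ v, (poppable G S v).card := by
  classical
  have h : ∀ v, (poppable G S v).card =
      ∑ c ∈ badCyclesAt G S v, numGood G (S \ supp c) := fun v => by
    simpa [numGood] using sum_poppable S v (fun _ => (1 : ℕ)) (G := G)
  simp only [h, numPopped, badCyclesAt_eq_filter]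
  rw [Finset.sum_comm' (t' := badCyclesIn G S) (s' := fun c => supp c)]
  · simp
  · intro v c
    simp [and_comm]

/-- Configurations whose only bad cycle has length at least three become good by reversing it. -/
lemma card_poppable_long (S : Finset V) (v : V) :
    ((poppable G S v).filter fun f => ¬ f (f v) = v).card ≤ numGood G S := by
  classical
  have hno : ∀ f ∈ (poppable G S v).filter fun f => ¬ f (f v) = v, IsConf G S f ∧ BadThru f v ∧
      Good (pop f v) ∧ NoTwo f := by
    intro f hf
    rw [Finset.mem_filter, mem_poppable] at hf
    obtain ⟨⟨h1, h2, h3⟩, h4⟩ := hf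
    refine ⟨h1, h2, h3, fun w hw => ?_⟩
    by_contra hne
    by_cases hvw : Hits f v w
    · have : v = w ∨ v = f w := (h2.cyc.hits_symm hvw).induct (fun z => z = w ∨ z = f w)
        (Or.inl rfl) fun z _ h => by
          rcases h with rfl | rfl
          · exact Or.inr rfl
          · exact Or.inl hw
      rcases this with rfl | rfl
      · exact h4 hw
      · exact h4 (by rw [hw])
    · have hvw' : ¬ Hits f v (f w) := fun h => hvw (by rw [← hw]; exact h.trans (Hits.step f _))
      have h5 : pop f v w = f w := if_neg hvw
      have h6 : pop f v (f w) = w := by rw [pop, if_neg hvw', hw]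
      have := h3.noTwo w (by rw [h5, h6])
      exact hne (h5 ▸ this)
  choose! φ hφ1 hφ2 hφ3 using fun f hf => exists_good (hno f hf).2.2.2
  refine Finset.card_le_card_of_injOn φ (fun f hf => ?_) fun f hf g hg hfg => ?_
  · rw [Finset.mem_coe, mem_goodConf]
    refine ⟨isConf_of_arcs_subset (hφ2 f hf ▸ (hno f hf).1.arcs_subset) fun v => ?_, hφ1 f hf⟩
    rw [hφ3 f hf, (hno f hf).1.eq_self_iff]
  · have harcs : arcs f = arcs g := by rw [← hφ2 f hf, ← hφ2 g hg, hfg]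
    have hfix : ∀ v, f v = v ↔ g v = v := fun v => by
      rw [← hφ3 f hf, ← hφ3 g hg, hfg]
    obtain ⟨-, hf1, hf2, hf3⟩ := hno f hf
    obtain ⟨-, hg1, hg2, hg3⟩ := hno g hg
    -- a bad vertex lies on the cycle through `v`
    have hbad : ∀ {f : V → V}, BadThru f v → Good (pop f v) → ∀ z, BadThru f z → Hits f z v := by
      intro f hf1 hf2 z hz
      by_contra hzv
      refine good_iff.1 hf2 z (hz.congr fun y hy => if_neg fun h => hzv ?_)
      exact hy.trans (hf1.cyc.hits_symm h)
    funext z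
    by_contra hne
    have h1 := badThru_iff_not_of_ne hf3 hg3 harcs hfix hne
    have h2 := badThru_iff_not_of_ne hg3 hf3 harcs.symm (fun v => (hfix v).symm) (Ne.symm hne)
    have hne' : f v ≠ g v := by
      by_cases hz : BadThru f z
      · exact h1.1 v (hbad hf1 hf2 z hz)
      · have hz : BadThru g z := by
          by_contra h
          exact hz (h1.2.2 h)
        exact (h2.1 v (hbad hg1 hg2 z hz)).symm
    exact (badThru_iff_not_of_ne hf3 hg3 harcs hfix hne').2.1 hf1 hg1

/-- A configuration whose only bad cycle is `v ⇄ f v` becomes good by unassigning `v` and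
augmenting. It is determined by the resulting good configuration, the neighbour `f v` and the owner
of the additional edge. -/
lemma card_poppable_short (hG : G.Connected) (hm : Fintype.card V ≤ G.edgeSet.ncard)
    (S : Finset V) (v : V) :
    ((poppable G S v).filter fun f => f (f v) = v).card ≤
      numGood G S * (Fintype.card V * Fintype.card V) := by
  classical
  have hno : ∀ f ∈ (poppable G S v).filter fun f => f (f v) = v, v ∈ S ∧
      IsConf G (S.erase v) (update f v v) ∧ Good (update f v v) := by
    intro f hf
    rw [Finset.mem_filter, mem_poppable] at hf
    obtain ⟨⟨h1, h2, h3⟩, h4⟩ := hf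
    refine ⟨by by_contra hS; exact h2.ne (h1.2 v hS), ⟨fun z hz => ?_, fun z hz => ?_⟩,
      (good_update_iff_good_pop h2).2 h3⟩
    · rw [Finset.mem_erase] at hz
      rw [update_of_ne hz.1]
      exact h1.1 z hz.2
    · by_cases hzv : z = v
      · rw [hzv, update_self]
      · rw [update_of_ne hzv]
        exact h1.2 z fun h => hz (Finset.mem_erase.2 ⟨hzv, h⟩)
  have : Nonempty V := ⟨v⟩
  choose! φ hφ τ hτ1 hτ2 using fun f hf => exists_augment hG hm (hno f hf).2.1
    (hno f hf).2.2.noTwo (Finset.notMem_erase v S)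
  have hcard : numGood G S * (Fintype.card V * Fintype.card V) =
      (goodConf G S ×ˢ (Finset.univ : Finset (V × V))).card := by
    simp [numGood]
  rw [hcard]
  refine Finset.card_le_card_of_injOn (fun f => (φ f, f v, τ f)) (fun f hf => ?_)
    fun f hf g hg hfg => ?_
  · simp only [Finset.coe_product, Set.mem_prod, Finset.mem_coe, Finset.mem_univ, and_true]
    have := hφ f hf
    rwa [Finset.insert_erase (hno f hf).1] at this
  · simp only [Prod.mk.injEq] at hfg
    obtain ⟨hfg, hv, ht⟩ := hfg
    have harcs : arcs (update f v v) = arcs (update g v v) := by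
      have h1 := hτ2 f hf
      have h2 := hτ2 g hg
      have h3 := hτ1 f hf
      have h4 := hτ1 g hg
      rw [← hfg, ← ht] at h2 h4
      rw [← Set.insert_sdiff_self_of_notMem h3, ← Set.insert_sdiff_self_of_notMem h4, ← h1, ← h2]
    have h := eq_of_good (hno f hf).2.2 (hno g hg).2.2 harcs fun z => by
      rw [(hno f hf).2.1.eq_self_iff, (hno g hg).2.1.eq_self_iff]
    have : update (update f v v) v (f v) = update (update g v v) v (g v) := by rw [h, hv]
    simpa using this

lemma numPopped_le (hG : G.Connected) (hm : Fintype.card V ≤ G.edgeSet.ncard) (S : Finset V) :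
    numPopped G S ≤ (Fintype.card V + Fintype.card V ^ 3) * numGood G S := by
  classical
  rw [numPopped_eq_sum]
  calc ∑ v, (poppable G S v).card
      ≤ ∑ _v : V, (numGood G S * (Fintype.card V * Fintype.card V) + numGood G S) := by
        refine Finset.sum_le_sum fun v _ => ?_
        rw [← Finset.card_filter_add_card_filter_not (fun f : V → V => f (f v) = v)]
        exact add_le_add (card_poppable_short hG hm S v) (card_poppable_long S v)
    _ = (Fintype.card V + Fintype.card V ^ 3) * numGood G S := by
        rw [Finset.sum_const, Finset.card_univ, smul_eq_mul]
        ring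

lemma numGood_pos (hG : G.Connected) (hm : Fintype.card V ≤ G.edgeSet.ncard) (S : Finset V) :
    0 < numGood G S :=
  Finset.card_pos.2 (goodConf_nonempty hG hm S)

end Count

end FunGraph

/-! ### The sampling process and its potential -/

namespace FunGraph

open Function

section Sampling

variable {n : ℕ}

/-- State of the sampling process: the current configuration, the number of vertices that have been
assigned for the first time in the current run, the number of runs not yet finished, and for each
vertex the number of draws made for its first assignments, over all runs. -/
structure Sim (n : ℕ) where
  conf : Fin n → Fin n
  stage : ℕ
  runs : ℕ
  counts : Fin n → ℕ

open Classical in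
/-- The state after the draw of the neighbour `w` for the vertex `v`. When all vertices are
assigned, a new run starts with the empty configuration. -/
noncomputable def Sim.next (a : Sim n) (v w : Fin n) : Sim n :=
  let f := update a.conf v w
  let W := if v.val = a.stage then update a.counts v (a.counts v + 1) else a.counts
  if BadThru f v then ⟨pop f v, a.stage, a.runs, W⟩
  else if v.val = a.stage then
    if a.stage + 1 = n then ⟨id, 0, a.runs - 1, W⟩ else ⟨f, a.stage + 1, a.runs, W⟩
  else ⟨f, a.stage, a.runs, W⟩

/-- `v` is the least unassigned vertex. -/
def IsLeastFree (f : Fin n → Fin n) (v : Fin n) : Prop := f v = v ∧ ∀ u < v, f u ≠ u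

lemma IsLeastFree.unique {f : Fin n → Fin n} {v w : Fin n} (hv : IsLeastFree f v)
    (hw : IsLeastFree f w) : v = w := by
  rcases lt_trichotomy v w with h | h | h
  · exact absurd hv.1 (hw.2 v h)
  · exact h
  · exact absurd hw.1 (hv.2 w h)

open Classical in
/-- The probability that within `d` draws the process does not finish all runs with counts that
satisfy `ok`. Each draw is made for the least unassigned vertex. -/
noncomputable def failProb (G : SimpleGraph (Fin n)) (ok : (Fin n → ℕ) → Prop) :
    ℕ → Sim n → ℝ
  | 0, a => if a.runs = 0 ∧ ok a.counts then 0 else 1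
  | d + 1, a =>
    if a.runs = 0 then (if ok a.counts then 0 else 1)
    else if h : ∃ v, IsLeastFree a.conf v then
      (∑ w ∈ nbrs G h.choose, failProb G ok d (a.next h.choose w)) / (nbrs G h.choose).card
    else 1

variable {G : SimpleGraph (Fin n)} {ok : (Fin n → ℕ) → Prop}

lemma failProb_of_runs_eq_zero (d : ℕ) {a : Sim n} (ha : a.runs = 0) [Decidable (ok a.counts)] :
    failProb G ok d a = if ok a.counts then 0 else 1 := by
  cases d <;> simp [failProb, ha]

lemma failProb_zero {a : Sim n} (ha : a.runs ≠ 0) : failProb G ok 0 a = 1 := by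
  simp [failProb, ha]

lemma failProb_succ (d : ℕ) {a : Sim n} (ha : a.runs ≠ 0) {v : Fin n}
    (hv : IsLeastFree a.conf v) :
    failProb G ok (d + 1) a =
      (∑ w ∈ nbrs G v, failProb G ok d (a.next v w)) / (nbrs G v).card := by
  have h : ∃ v, IsLeastFree a.conf v := ⟨v, hv⟩
  have hc : h.choose = v := h.choose_spec.unique hv
  rw [failProb, if_neg ha, dif_pos h, hc]

/-- The vertices before `i`. -/
def below (n i : ℕ) : Finset (Fin n) := Finset.univ.filter fun v => v.val < i

lemma mem_below {i : ℕ} {v : Fin n} : v ∈ below n i ↔ v.val < i := by simp [below]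

lemma below_zero : below n 0 = ∅ := by ext; simp [mem_below]

lemma below_self : below n n = Finset.univ := by ext; simp [mem_below]

lemma below_succ (v : Fin n) : below n (v.val + 1) = insert v (below n v.val) := by
  ext u
  simp only [mem_below, Finset.mem_insert, Fin.ext_iff]
  omega

variable (G)

/-- The expected number of draws for the first assignment of `v`, given that the configuration on
the smaller vertices is a uniformly random good one. -/
noncomputable def meanDraws (v : Fin n) : ℝ :=
  (nbrs G v).card * numGood G (below n v) / numGood G (below n (v + 1))

/-- The expected number of draws until all vertices are assigned, given that the configuration is a
uniformly random good one on `S`. -/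
noncomputable def remDraws (S : Finset (Fin n)) : ℝ :=
  (n - S.card : ℝ) + numPopped G Finset.univ / numGood G Finset.univ - numPopped G S / numGood G S

/-- Conditional second moment of the deviation of `∏ v, X v` from `A`, where `X v` is `W v` plus the
sum of `k v` geometric random variables of mean `τ v`, all of them independent. -/
noncomputable def sqDev (τ : Fin n → ℝ) (A : ℝ) (W k : Fin n → ℝ) : ℝ :=
  ∏ v, ((W v + k v * τ v) ^ 2 + k v * (τ v ^ 2 - τ v)) - 2 * A * ∏ v, (W v + k v * τ v) + A ^ 2

lemma sqDev_nonneg {τ : Fin n → ℝ} {A : ℝ} {W k : Fin n → ℝ} (hτ : ∀ v, 1 ≤ τ v)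
    (hk : ∀ v, 0 ≤ k v) : 0 ≤ sqDev τ A W k := by
  have h : (∏ v, (W v + k v * τ v)) ^ 2 ≤
      ∏ v, ((W v + k v * τ v) ^ 2 + k v * (τ v ^ 2 - τ v)) := by
    rw [← Finset.prod_pow]
    refine Finset.prod_le_prod (fun v _ => sq_nonneg _) fun v _ => ?_
    have : 0 ≤ k v * (τ v ^ 2 - τ v) := mul_nonneg (hk v) (by nlinarith [hτ v])
    linarith
  rw [sqDev]
  nlinarith [sq_nonneg (∏ v, (W v + k v * τ v) - A)]

/-- A draw for `v` succeeds with probability `1 / τ v`. -/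
lemma sqDev_step (τ : Fin n → ℝ) (A : ℝ) (W W' k k' : Fin n → ℝ) (v : Fin n)
    (hW : W' v = W v + 1) (hW' : ∀ u ≠ v, W' u = W u) (hk : k' v = k v - 1)
    (hk' : ∀ u ≠ v, k' u = k u) :
    sqDev τ A W' k' + (τ v - 1) * sqDev τ A W' k = τ v * sqDev τ A W k := by
  simp only [sqDev]
  simp only [← Finset.mul_prod_erase Finset.univ _ (Finset.mem_univ v)]
  have h1 : ∀ u ∈ Finset.univ.erase v, W' u = W u := fun u hu => hW' u (Finset.ne_of_mem_erase hu)
  have h2 : ∀ u ∈ Finset.univ.erase v, k' u = k u := fun u hu => hk' u (Finset.ne_of_mem_erase hu)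
  have key (φ : ℝ → ℝ → ℝ → ℝ) : ∏ u ∈ Finset.univ.erase v, φ (W' u) (k' u) (τ u) =
      ∏ u ∈ Finset.univ.erase v, φ (W u) (k u) (τ u) :=
    Finset.prod_congr rfl fun u hu => by rw [h1 u hu, h2 u hu]
  have key' (φ : ℝ → ℝ → ℝ → ℝ) : ∏ u ∈ Finset.univ.erase v, φ (W' u) (k u) (τ u) =
      ∏ u ∈ Finset.univ.erase v, φ (W u) (k u) (τ u) :=
    Finset.prod_congr rfl fun u hu => by rw [h1 u hu]
  have e1 := key fun W k τ => (W + k * τ) ^ 2 + k * (τ ^ 2 - τ)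
  have e2 := key fun W k τ => W + k * τ
  have e3 := key' fun W k τ => (W + k * τ) ^ 2 + k * (τ ^ 2 - τ)
  have e4 := key' fun W k τ => W + k * τ
  rw [e1, e2, e3, e4, hW, hk]
  ring

variable {G}

lemma meanDraws_eq (hpos : ∀ S, 0 < numGood G S) (v : Fin n) :
    meanDraws G v * numGood G (insert v (below n v)) =
      numGood G (below n v) * (nbrs G v).card := by
  rw [meanDraws, below_succ]
  have : (0 : ℝ) < numGood G (insert v (below n v)) := by exact_mod_cast hpos _
  field_simp

lemma one_le_meanDraws (hpos : ∀ S, 0 < numGood G S) (v : Fin n) : 1 ≤ meanDraws G v := by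
  have h0 : (0 : ℝ) < numGood G (insert v (below n v)) := by exact_mod_cast hpos _
  have h := numGood_mul_card_nbrs (G := G) (S := below n v) (v := v) (by simp [mem_below])
  have h1 : (numGood G (insert v (below n v)) : ℝ) ≤ numGood G (below n v) * (nbrs G v).card := by
    exact_mod_cast h ▸ Nat.le_add_right _ _
  rw [← meanDraws_eq hpos] at h1
  exact le_of_mul_le_mul_right (by linarith) h0

/-- Every draw decreases the expected number of remaining draws by one on average. -/
lemma remDraws_balance (hpos : ∀ S, 0 < numGood G S) {S : Finset (Fin n)} {v : Fin n} (hv : v ∉ S) :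
    numGood G (insert v S) * remDraws G (insert v S) +
        ∑ c ∈ badCyclesAt G (insert v S) v,
          numGood G (insert v S \ supp c) * remDraws G (insert v S \ supp c) =
      numGood G S * (nbrs G v).card * (remDraws G S - 1) := by
  have hg : ∀ S, (numGood G S : ℝ) ≠ 0 := fun S => by exact_mod_cast (hpos S).ne'
  have h : ∀ S, (numGood G S : ℝ) * remDraws G S = (n - S.card : ℝ) * numGood G S +
      numPopped G Finset.univ / numGood G Finset.univ * numGood G S - numPopped G S := fun S => by
    rw [remDraws]
    have := hg S
    have := hg Finset.univ
    field_simp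
  have h1 := numGood_mul_card_nbrs (G := G) hv
  have h2 := numPopped_balance (G := G) hv
  have hcard : ∀ c ∈ badCyclesAt G (insert v S) v,
      (((insert v S \ supp c).card : ℕ) : ℝ) = S.card + 1 - (supp c).card := by
    intro c hc
    have hsub := (mem_badCyclesAt.1 hc).2
    rw [Finset.card_sdiff_of_subset hsub, Nat.cast_sub (Finset.card_le_card hsub),
      Finset.card_insert_of_notMem hv]
    push_cast
    ring
  have h1' : (numGood G S : ℝ) * (nbrs G v).card = numGood G (insert v S) +
      ∑ c ∈ badCyclesAt G (insert v S) v, (numGood G (insert v S \ supp c) : ℝ) := by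
    exact_mod_cast h1
  have h2' : (numPopped G S : ℝ) * (nbrs G v).card + ∑ c ∈ badCyclesAt G (insert v S) v,
        ((supp c).card : ℝ) * numGood G (insert v S \ supp c) =
      numPopped G (insert v S) +
        ∑ c ∈ badCyclesAt G (insert v S) v, (numPopped G (insert v S \ supp c) : ℝ) := by
    exact_mod_cast h2
  rw [show (numGood G S : ℝ) * (nbrs G v).card * (remDraws G S - 1) =
    (numGood G S * remDraws G S) * (nbrs G v).card - numGood G S * (nbrs G v).card by ring]
  simp only [h]
  rw [Finset.sum_congr rfl fun c hc => by rw [hcard c hc], Finset.card_insert_of_notMem hv]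
  rw [Finset.sum_congr rfl fun c _ => show
    ((n : ℝ) - (S.card + 1 - (supp c).card)) * numGood G (insert v S \ supp c) +
      numPopped G Finset.univ / numGood G Finset.univ * numGood G (insert v S \ supp c) -
      numPopped G (insert v S \ supp c) =
    ((n : ℝ) - (S.card + 1) + numPopped G Finset.univ / numGood G Finset.univ) *
      numGood G (insert v S \ supp c) + (supp c).card * numGood G (insert v S \ supp c) -
      numPopped G (insert v S \ supp c) by ring]
  rw [Finset.sum_sub_distrib, Finset.sum_add_distrib, ← Finset.mul_sum]
  push_cast
  linear_combination -((n : ℝ) - (S.card + 1) +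
    numPopped G Finset.univ / numGood G Finset.univ) * h1' + h2'

variable (G)

/-- The number of runs in which the vertex `v` still has to be assigned for the first time. -/
def toDo (stage runs : ℕ) (v : Fin n) : ℕ := if v.val < stage then runs - 1 else runs

/-- The potential of the process, for a uniformly random good configuration on `S`: the expected
squared deviation of the final product of the counts from `A`, weighted by `α`, and the expected
total number of draws, weighted by `β`. Here `F - d` draws have been made; the constant `B` keeps
the second part nonnegative. -/
noncomputable def potential (α β A F B : ℝ) (d : ℕ) (S : Finset (Fin n)) (stage runs : ℕ)
    (W : Fin n → ℕ) : ℝ :=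
  α * sqDev (meanDraws G) A (fun v => W v) (fun v => toDo stage runs v) +
    β * (F - d + (runs - 1) * remDraws G ∅ + remDraws G S + B)

variable {G}

/-- The potential dominates the failure probability, averaged over the good configurations. -/
theorem sum_failProb_le (hpos : ∀ S, 0 < numGood G S) {α β A F B : ℝ} (hα : 0 ≤ α) (hβ : 0 ≤ β)
    (hF : 1 ≤ β * F) (hB : ∀ S, (numPopped G S : ℝ) ≤ B * numGood G S)
    (hok : ∀ W : Fin n → ℕ, ¬ ok W → 1 ≤ α * (∏ v, (W v : ℝ) - A) ^ 2) (d : ℕ) (hd : (d : ℝ) ≤ F)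
    (S : Finset (Fin n)) (stage runs : ℕ) (W : Fin n → ℕ) (hS : S ⊆ below n stage)
    (hstage : stage < n) (hruns : runs = 0 → S = ∅) :
    ∑ f ∈ goodConf G S, failProb G ok d ⟨f, stage, runs, W⟩ ≤
      numGood G S * potential G α β A F B d S stage runs W := by
  classical
  have hg : ∀ S, (0 : ℝ) < numGood G S := fun S => by exact_mod_cast hpos S
  have hB0 : 0 ≤ B := by
    by_contra h
    have h1 := hB ∅
    have h2 : (0 : ℝ) ≤ numPopped G ∅ := Nat.cast_nonneg _
    nlinarith [hg ∅]
  have hrem : ∀ S, 0 ≤ remDraws G S + B := by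
    intro S
    have h1 : (numPopped G S : ℝ) / numGood G S ≤ B := (div_le_iff₀ (hg S)).2 (hB S)
    have h2 : 0 ≤ (numPopped G Finset.univ : ℝ) / numGood G Finset.univ := by positivity
    have h3 : (S.card : ℝ) ≤ n := by
      exact_mod_cast (Finset.card_le_univ S).trans_eq (Fintype.card_fin n)
    rw [remDraws]
    linarith
  have hempty : 0 ≤ remDraws G (∅ : Finset (Fin n)) := by
    have : numPopped G (∅ : Finset (Fin n)) = 0 := by
      refine Finset.sum_eq_zero fun c hc => ?_
      have := (Finset.mem_filter.1 hc).2
      rw [Finset.subset_empty.1 this]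
      simp
    rw [remDraws, this]
    simp only [Finset.card_empty, CharP.cast_eq_zero, sub_zero, zero_div]
    positivity
  have huniv : remDraws G (Finset.univ : Finset (Fin n)) = 0 := by simp [remDraws]
  have hsq : ∀ stage runs (W : Fin n → ℕ), 0 ≤ α * sqDev (meanDraws G) A (fun v => W v)
      (fun v => (toDo stage runs v : ℝ)) := fun stage runs W =>
    mul_nonneg hα (sqDev_nonneg (one_le_meanDraws hpos) fun v => Nat.cast_nonneg _)
  -- the process has finished
  have hdone : ∀ (d : ℕ), (d : ℝ) ≤ F → ∀ (stage : ℕ) (W : Fin n → ℕ),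
      ∑ f ∈ goodConf G ∅, failProb G ok d ⟨f, stage, 0, W⟩ ≤
        numGood G (∅ : Finset (Fin n)) * potential G α β A F B d ∅ stage 0 W := by
    intro d hd stage W
    rw [Finset.sum_congr rfl fun f _ => show failProb G ok d ⟨f, stage, 0, W⟩ =
        if ok W then 0 else 1 from failProb_of_runs_eq_zero d rfl, Finset.sum_const,
      nsmul_eq_mul, numGood]
    refine mul_le_mul_of_nonneg_left ?_ (Nat.cast_nonneg _)
    have h0 : sqDev (meanDraws G) A (fun v => W v) (fun v => (toDo stage 0 v : ℝ)) =
        (∏ v, (W v : ℝ) - A) ^ 2 := by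
      simp only [sqDev, toDo, zero_tsub, ite_self, CharP.cast_eq_zero, zero_mul, add_zero,
        Finset.prod_pow]
      ring
    have h1 : 0 ≤ β * (F - d + (((0 : ℕ) : ℝ) - 1) * remDraws G ∅ + remDraws G ∅ + B) := by
      refine mul_nonneg hβ ?_
      push_cast
      linarith
    rw [potential, h0]
    split_ifs with h
    · have := mul_nonneg hα (sq_nonneg (∏ v, (W v : ℝ) - A))
      linarith
    · linarith [hok W h]
  induction d generalizing S stage runs W with
  | zero =>
    by_cases hr : runs = 0
    · subst hr
      rw [hruns rfl]
      exact hdone 0 hd stage W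
    · rw [Finset.sum_congr rfl fun f _ => failProb_zero (a := ⟨f, stage, runs, W⟩) hr,
        Finset.sum_const, nsmul_eq_mul, numGood]
      refine mul_le_mul_of_nonneg_left ?_ (Nat.cast_nonneg _)
      have h1 : (1 : ℝ) ≤ runs := by exact_mod_cast Nat.one_le_iff_ne_zero.2 hr
      have h2 : 0 ≤ β * ((runs - 1) * remDraws G ∅ + (remDraws G S + B)) :=
        mul_nonneg hβ (add_nonneg (mul_nonneg (by linarith) hempty) (hrem S))
      have h3 := hsq stage runs W
      rw [potential]
      push_cast
      nlinarith
  | succ d ih =>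
    by_cases hr : runs = 0
    · subst hr
      rw [hruns rfl]
      exact hdone (d + 1) hd stage W
    have hd' : (d : ℝ) ≤ F := by push_cast at hd; linarith
    have hr1 : 1 ≤ runs := Nat.one_le_iff_ne_zero.2 hr
    obtain ⟨v, hvS, hvmin⟩ : ∃ v, v ∉ S ∧ ∀ u < v, u ∈ S := by
      have hne : (Finset.univ \ S).Nonempty :=
        ⟨⟨stage, hstage⟩, by simpa using fun h => lt_irrefl _ (mem_below.1 (hS h))⟩
      refine ⟨(Finset.univ \ S).min' hne, by simpa using Finset.min'_mem _ hne, fun u hu => ?_⟩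
      by_contra h
      exact absurd (Finset.min'_le _ u (by simpa using h)) (not_le.2 hu)
    have hvstage : v.val ≤ stage := by
      by_contra h
      exact lt_irrefl _ (mem_below.1 (hS (hvmin ⟨stage, hstage⟩ (not_le.1 h))))
    set D : ℝ := ((nbrs G v).card : ℝ) with hD
    have hbase := numGood_mul_card_nbrs (G := G) hvS
    have hbase' : (numGood G S : ℝ) * D = numGood G (insert v S) +
        ∑ c ∈ badCyclesAt G (insert v S) v, (numGood G (insert v S \ supp c) : ℝ) := by
      rw [hD]
      exact_mod_cast hbase
    have hD0 : 0 < D := by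
      have : 0 < (numGood G S : ℝ) * D := by
        rw [hbase']
        exact add_pos_of_pos_of_nonneg (hg _) (Finset.sum_nonneg fun _ _ => Nat.cast_nonneg _)
      exact pos_of_mul_pos_right this (hg S).le
    set W' : Fin n → ℕ := if v.val = stage then update W v (W v + 1) else W with hW'
    set H : (Fin n → Fin n) → ℝ := fun f =>
      if f v = v then failProb G ok d ⟨f, stage, runs, W'⟩
      else if v.val = stage then
        if stage + 1 = n then failProb G ok d ⟨id, 0, runs - 1, W'⟩
        else failProb G ok d ⟨f, stage + 1, runs, W'⟩
      else failProb G ok d ⟨f, stage, runs, W'⟩ with hH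
    have hsum : ∑ f ∈ goodConf G S, failProb G ok (d + 1) ⟨f, stage, runs, W⟩ =
        (∑ f ∈ goodConf G S, ∑ w ∈ nbrs G v, H (settle (update f v w) v)) / D := by
      rw [Finset.sum_div]
      refine Finset.sum_congr rfl fun f hf => ?_
      have hconf := (mem_goodConf.1 hf).1
      rw [failProb_succ d (a := ⟨f, stage, runs, W⟩) hr (v := v)
        ⟨hconf.2 v hvS, fun u hu h => (hconf.eq_self_iff u).1 h (hvmin u hu)⟩]
      congr 1
      refine Finset.sum_congr rfl fun w hw => ?_
      have hwv : w ≠ v := (mem_nbrs.1 hw).ne.symm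
      simp only [Sim.next, hH, settle]
      by_cases hbad : BadThru (update f v w) v
      · have hpop : pop (update f v w) v v = v := if_pos (Hits.refl _ v)
        simp only [if_pos hbad, if_pos hpop]
        rfl
      · simp only [if_neg hbad, update_self, if_neg hwv]
        split_ifs <;> simp_all
    rw [hsum, sum_settle hvS, div_le_iff₀ hD0]
    have hsub : insert v S ⊆ below n (stage + 1) := by
      intro u hu
      rw [mem_below]
      rcases Finset.mem_insert.1 hu with rfl | hu
      · omega
      · have := mem_below.1 (hS hu); omega
    have hbelow : ∀ c ∈ badCyclesAt G (insert v S) v, insert v S \ supp c ⊆ below n stage := by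
      intro c hc u hu
      rw [Finset.mem_sdiff] at hu
      have hvc : v ∈ supp c := mem_supp.2 (mem_badCyclesAt.1 hc).1.2.1.ne
      rcases Finset.mem_insert.1 hu.1 with rfl | h
      · exact absurd hvc hu.2
      · exact hS h
    -- a popped cycle
    have hfail : ∑ c ∈ badCyclesAt G (insert v S) v, ∑ f ∈ goodConf G (insert v S \ supp c), H f ≤
        ∑ c ∈ badCyclesAt G (insert v S) v, numGood G (insert v S \ supp c) *
          potential G α β A F B d (insert v S \ supp c) stage runs W' := by
      refine Finset.sum_le_sum fun c hc => ?_
      refine le_trans (le_of_eq (Finset.sum_congr rfl fun f hf => ?_))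
        (ih hd' _ stage runs W' (hbelow c hc) hstage fun h => absurd h hr)
      have hvc : v ∈ supp c := mem_supp.2 (mem_badCyclesAt.1 hc).1.2.1.ne
      have hfv : f v = v := (mem_goodConf.1 hf).1.2 v fun h => (Finset.mem_sdiff.1 h).2 hvc
      simp only [hH, if_pos hfv]
    have hfree : ∀ f ∈ goodConf G (insert v S), ¬ f v = v := fun f hf h =>
      ((mem_goodConf.1 hf).1.eq_self_iff v).1 h (Finset.mem_insert_self v S)
    have hbal := remDraws_balance hpos hvS
    by_cases hvs : v.val = stage
    · have hSeq : S = below n v := by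
        refine Finset.Subset.antisymm (hvs ▸ hS) fun u hu => hvmin u (mem_below.1 hu)
      have hW'v : W' = update W v (W v + 1) := if_pos hvs
      have hstep := sqDev_step (meanDraws G) A (fun u => (W u : ℝ)) (fun u => (W' u : ℝ))
        (fun u => (toDo stage runs u : ℝ)) (fun u => (toDo (stage + 1) runs u : ℝ)) v
        (by rw [hW'v]; simp) (fun u hu => by rw [hW'v, update_of_ne hu])
        (by simp [toDo, hvs, Nat.cast_sub hr1])
        (fun u hu => by
          have : (u.val < stage + 1) ↔ (u.val < stage) := by
            have := Fin.val_ne_of_ne hu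
            omega
          simp [toDo, this])
      have hmean := meanDraws_eq hpos v
      rw [← hSeq, ← hD] at hmean
      have hsucc : ∑ f ∈ goodConf G (insert v S), H f ≤ numGood G (insert v S) *
          (α * sqDev (meanDraws G) A (fun u => (W' u : ℝ))
              (fun u => (toDo (stage + 1) runs u : ℝ)) +
            β * (F - d + (runs - 1) * remDraws G ∅ + remDraws G (insert v S) + B)) := by
        by_cases hn : stage + 1 = n
        · have h1 : ∑ f ∈ goodConf G (insert v S), H f = numGood G (insert v S) *
              failProb G ok d ⟨id, 0, runs - 1, W'⟩ := by
            rw [Finset.sum_congr rfl fun f hf => by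
              simp only [hH, if_neg (hfree f hf), if_pos hvs, if_pos hn]; rfl, Finset.sum_const,
              nsmul_eq_mul, numGood]
          have h2 := ih hd' ∅ 0 (runs - 1) W' (by simp) (by omega) fun _ => rfl
          rw [goodConf_empty, Finset.sum_singleton, numGood, goodConf_empty,
            Finset.card_singleton, Nat.cast_one, one_mul, potential] at h2
          have h3 : insert v S = Finset.univ := by
            rw [hSeq, ← below_succ, hvs, hn, below_self]
          have h4 : ∀ u : Fin n, toDo (stage + 1) runs u = toDo 0 (runs - 1) u := fun u => by
            simp [toDo, hn]
          rw [h1]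
          refine mul_le_mul_of_nonneg_left ?_ (hg _).le
          simp only [h4, h3, huniv]
          refine h2.trans (le_of_eq ?_)
          rw [Nat.cast_sub hr1]
          push_cast
          ring
        · refine le_trans (le_of_eq (Finset.sum_congr rfl fun f hf => ?_))
            (ih hd' _ (stage + 1) runs W' hsub (by omega) fun h => absurd h hr)
          simp only [hH, if_neg (hfree f hf), if_pos hvs, if_neg hn]
      refine (add_le_add hsucc hfail).trans (le_of_eq ?_)
      simp only [potential]
      set X := sqDev (meanDraws G) A (fun u => (W' u : ℝ)) (fun u => (toDo (stage + 1) runs u : ℝ))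
      set Y := sqDev (meanDraws G) A (fun u => (W' u : ℝ)) (fun u => (toDo stage runs u : ℝ))
      set Z := sqDev (meanDraws G) A (fun u => (W u : ℝ)) (fun u => (toDo stage runs u : ℝ))
      set τ := meanDraws G v
      set R := F - d + (runs - 1) * remDraws G (∅ : Finset (Fin n)) with hR
      rw [Finset.sum_congr rfl fun c _ => show
        (numGood G (insert v S \ supp c) : ℝ) *
          (α * Y + β * (R + remDraws G (insert v S \ supp c) + B)) =
        (α * Y + β * (R + B)) * numGood G (insert v S \ supp c) +
          β * (numGood G (insert v S \ supp c) * remDraws G (insert v S \ supp c)) by ring,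
        Finset.sum_add_distrib, ← Finset.mul_sum, ← Finset.mul_sum]
      push_cast
      rw [show F - (d + 1 : ℝ) + (runs - 1) * remDraws G (∅ : Finset (Fin n)) = R - 1 by
        rw [hR]; ring]
      linear_combination (-(α * Y + β * (R + B))) * hbase' + β * hbal +
        α * (numGood G (insert v S) : ℝ) * hstep - α * (Y - Z) * hmean
    · have hsucc : ∑ f ∈ goodConf G (insert v S), H f ≤ numGood G (insert v S) *
          potential G α β A F B d (insert v S) stage runs W' := by
        refine le_trans (le_of_eq (Finset.sum_congr rfl fun f hf => ?_))
          (ih hd' _ stage runs W' ?_ hstage fun h => absurd h hr)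
        · simp only [hH, if_neg (hfree f hf), if_neg hvs]
        · intro u hu
          rw [mem_below]
          rcases Finset.mem_insert.1 hu with rfl | hu
          · omega
          · exact mem_below.1 (hS hu)
      have hW'v : W' = W := if_neg hvs
      refine (add_le_add hsucc hfail).trans (le_of_eq ?_)
      simp only [potential, hW'v]
      set Z := sqDev (meanDraws G) A (fun u => (W u : ℝ)) (fun u => (toDo stage runs u : ℝ))
      set R := F - d + (runs - 1) * remDraws G (∅ : Finset (Fin n)) with hR
      rw [Finset.sum_congr rfl fun c _ => show
        (numGood G (insert v S \ supp c) : ℝ) *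
          (α * Z + β * (R + remDraws G (insert v S \ supp c) + B)) =
        (α * Z + β * (R + B)) * numGood G (insert v S \ supp c) +
          β * (numGood G (insert v S \ supp c) * remDraws G (insert v S \ supp c)) by ring,
        Finset.sum_add_distrib, ← Finset.mul_sum, ← Finset.mul_sum]
      push_cast
      rw [show F - (d + 1 : ℝ) + (runs - 1) * remDraws G (∅ : Finset (Fin n)) = R - 1 by
        rw [hR]; ring]
      linear_combination (-(α * Z + β * (R + B))) * hbase' + β * hbal

end Sampling

end FunGraph

/-! ### Accuracy of the estimate -/

namespace FunGraph

open Function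

section Estimate

variable {n : ℕ} {G : SimpleGraph (Fin n)}

/-- The product of the means telescopes. -/
lemma prod_meanDraws (hpos : ∀ S, 0 < numGood G S) (s : ℝ) :
    (∏ v, s * meanDraws G v) * numGood G Finset.univ = ∏ v, ((nbrs G v).card * s) := by
  have hg : ∀ S, (numGood G S : ℝ) ≠ 0 := fun S => by exact_mod_cast (hpos S).ne'
  have h1 : ∏ v : Fin n, ((numGood G (below n v) : ℝ) / numGood G (below n (v + 1))) =
      1 / numGood G Finset.univ := by
    have h (k : ℕ) : ∏ i ∈ Finset.range k,
        ((numGood G (below n i) : ℝ) / numGood G (below n (i + 1))) =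
        numGood G (below n 0) / numGood G (below n k) := by
      induction k with
      | zero => simp [hg]
      | succ k ih => rw [Finset.prod_range_succ, ih, div_mul_div_cancel₀ (hg _)]
    rw [Fin.prod_univ_eq_prod_range
      (fun i => (numGood G (below n i) : ℝ) / numGood G (below n (i + 1))) n, h, below_self,
      below_zero, numGood, goodConf_empty, Finset.card_singleton, Nat.cast_one]
  have h2 : ∏ v, s * meanDraws G v = (∏ v, ((nbrs G v).card * s)) *
      ∏ v : Fin n, ((numGood G (below n v) : ℝ) / numGood G (below n (v + 1))) := by
    rw [← Finset.prod_mul_distrib]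
    refine Finset.prod_congr rfl fun v _ => ?_
    rw [meanDraws]
    ring
  rw [h2, h1]
  rw [mul_assoc, one_div_mul_cancel (hg _), mul_one]

lemma one_add_inv_pow_le {s : ℝ} (n : ℕ) (hs : 0 < s) (hn : (n : ℝ) ≤ s) :
    (1 + 1 / s) ^ n ≤ 1 + 2 * n / s := by
  have h1 : (1 + 1 / s) ^ n ≤ Real.exp (n / s) := by
    have h : 1 + 1 / s ≤ Real.exp (1 / s) := by
      have := Real.add_one_le_exp (1 / s)
      linarith
    calc (1 + 1 / s) ^ n ≤ Real.exp (1 / s) ^ n := pow_le_pow_left₀ (by positivity) h n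
      _ = Real.exp (n / s) := by rw [← Real.exp_nat_mul]; congr 1; ring
  have hx0 : (0 : ℝ) ≤ n / s := by positivity
  have hx1 : (n : ℝ) / s ≤ 1 := (div_le_one hs).2 hn
  have h2 := Real.abs_exp_sub_one_sub_id_le (x := n / s) (by rw [abs_of_nonneg hx0]; exact hx1)
  have h3 := (abs_le.1 h2).2
  have h4 : 2 * (n : ℝ) / s = 2 * (n / s) := by ring
  rw [h4]
  nlinarith

/-- The output computed from the counts `W` of `s` runs is within the tolerance. -/
def Accurate (G : SimpleGraph (Fin n)) (s : ℕ) (ε : ℚ) (W : Fin n → ℕ) : Prop :=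
  |((∏ v, ((nbrs G v).card * s) : ℕ) : ℚ) / ((∏ v, W v : ℕ) : ℚ) - numGood G Finset.univ| ≤
    ε * numGood G Finset.univ

lemma accurate_of_abs_lt (hpos : ∀ S, 0 < numGood G S) {s : ℕ} (hs : 0 < s) {ε : ℚ}
    (hε1 : ε < 1) {W : Fin n → ℕ} {A : ℝ} (hA : A = ∏ v, s * meanDraws G v)
    (h : |(∏ v, (W v : ℝ)) - A| < ε / 2 * A) : Accurate G s ε W := by
  have hτ : 0 < A := by
    rw [hA]
    refine Finset.prod_pos fun v _ => mul_pos (by exact_mod_cast hs) ?_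
    linarith [one_le_meanDraws hpos v]
  have hε1' : (ε : ℝ) < 1 := by exact_mod_cast hε1
  have hN : (0 : ℝ) < numGood G Finset.univ := by exact_mod_cast hpos _
  set N : ℝ := (numGood G Finset.univ : ℝ) with hNdef
  set P : ℝ := ∏ v, (W v : ℝ) with hP
  obtain ⟨h1, h2⟩ := abs_lt.1 h
  have hε0 : 0 < (ε : ℝ) := by
    by_contra hneg
    have := abs_nonneg (P - A)
    nlinarith
  have hP2 : A / 2 < P := by nlinarith
  have hP0 : 0 < P := by linarith
  have key : |A * N / P - N| ≤ ε * N := by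
    have h3 : A * N / P - N = (A - P) * N / P := by field_simp
    rw [h3, abs_div, abs_mul, abs_of_pos hN, abs_of_pos hP0, div_le_iff₀ hP0, abs_sub_comm]
    nlinarith [mul_pos hε0 hN, mul_pos hN (sub_pos.2 hP2), mul_pos hN (sub_pos.2 h)]
  have hprod := prod_meanDraws hpos (G := G) (s : ℝ)
  rw [← hA, ← hNdef] at hprod
  rw [hprod] at key
  rw [Accurate]
  have : ((|((∏ v, ((nbrs G v).card * s) : ℕ) : ℚ) / ((∏ v, W v : ℕ) : ℚ) -
      numGood G Finset.univ| : ℚ) : ℝ) ≤ ((ε * numGood G Finset.univ : ℚ) : ℝ) := by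
    push_cast
    exact key
  exact_mod_cast this

/-- The process is accurate with probability at least `3 / 4`, for the number `s` of runs and
the bound `40 * s * n ^ 3` on the number of draws. -/
theorem failProb_le (hG : G.Connected) (hm : n ≤ G.edgeSet.ncard) {p q s : ℕ} (hp : 0 < p)
    (hpq : p < q) (hs : 64 * n * ((q : ℝ) / p) ^ 2 ≤ s) :
    failProb G (Accurate G s ((p : ℚ) / q)) (40 * s * n ^ 3) ⟨id, 0, s, fun _ => 0⟩ ≤ 1 / 4 := by
  have hn0 : 0 < n := Fin.pos_iff_nonempty.2 hG.nonempty
  have hm' : Fintype.card (Fin n) ≤ G.edgeSet.ncard := by rwa [Fintype.card_fin]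
  have hpos := numGood_pos hG hm'
  have hn1 : (1 : ℝ) ≤ n := by exact_mod_cast hn0
  have hp' : (0 : ℝ) < p := by exact_mod_cast hp
  have hq' : (0 : ℝ) < q := by exact_mod_cast hp.trans hpq
  have hpq' : (p : ℝ) < q := by exact_mod_cast hpq
  have hr1 : 1 ≤ ((q : ℝ) / p) ^ 2 := one_le_pow₀ ((one_le_div hp').2 hpq'.le)
  have hsn : (n : ℝ) ≤ s := by nlinarith
  have hs0' : (0 : ℝ) < s := by linarith
  have hs0 : 0 < s := by exact_mod_cast hs0'
  set ε : ℚ := (p : ℚ) / q with hε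
  have hεR : ((ε : ℚ) : ℝ) = p / q := by rw [hε]; push_cast; rfl
  have hε1 : ε < 1 := by
    rw [hε, div_lt_one (by exact_mod_cast hp.trans hpq)]
    exact_mod_cast hpq
  set A : ℝ := ∏ v, s * meanDraws G v with hA
  have hA0 : 0 < A := Finset.prod_pos fun v _ =>
    mul_pos hs0' (by linarith [one_le_meanDraws hpos v])
  set F : ℝ := ((40 * s * n ^ 3 : ℕ) : ℝ) with hF
  have hFeq : F = 40 * s * n ^ 3 := by rw [hF]; push_cast; ring
  have hF0 : 0 < F := by rw [hFeq]; positivity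
  set B : ℝ := n + n ^ 3 with hB
  set α : ℝ := 1 / (ε / 2 * A) ^ 2 with hα
  have hδA : 0 < (ε : ℝ) / 2 * A := by rw [hεR]; positivity
  have hBbound : ∀ S, (numPopped G S : ℝ) ≤ B * numGood G S := fun S => by
    have := numPopped_le hG hm' S
    rw [Fintype.card_fin] at this
    rw [hB]
    exact_mod_cast this
  have main := sum_failProb_le (ok := Accurate G s ε) hpos (α := α) (β := 1 / F) (A := A) (F := F)
    (B := B) (by positivity) (by positivity) (by rw [one_div_mul_cancel hF0.ne'])
    hBbound (fun W hW => by
      rw [hα, one_div_mul_eq_div, le_div_iff₀ (by positivity), one_mul]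
      by_contra hlt
      exact hW (accurate_of_abs_lt hpos hs0 hε1 hA (abs_lt_of_sq_lt_sq (not_le.1 hlt) hδA.le)))
    (40 * s * n ^ 3) le_rfl ∅ 0 s (fun _ => 0) (by simp) hn0 (fun _ => rfl)
  rw [goodConf_empty, Finset.sum_singleton, numGood, goodConf_empty, Finset.card_singleton,
    Nat.cast_one, one_mul, potential] at main
  refine main.trans ?_
  -- the expected number of draws is at most an eighth of the bound, by Markov's inequality
  have hdraws : 1 / F * (F - ((40 * s * n ^ 3 : ℕ) : ℝ) + ((s : ℝ) - 1) * remDraws G ∅ +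
      remDraws G ∅ + B) ≤ 1 / 8 := by
    have h1 : remDraws G (∅ : Finset (Fin n)) ≤ n + B := by
      have h2 : (numPopped G Finset.univ : ℝ) / numGood G Finset.univ ≤ B :=
        (div_le_iff₀ (by exact_mod_cast hpos _)).2 (hBbound _)
      have h3 : 0 ≤ (numPopped G ∅ : ℝ) / numGood G ∅ := by positivity
      rw [remDraws, Finset.card_empty, Nat.cast_zero]
      linarith
    rw [one_div_mul_eq_div, div_le_iff₀ hF0, ← hF]
    have hs1 : (1 : ℝ) ≤ s := by linarith
    have hn3 : (n : ℝ) ≤ n ^ 3 := by nlinarith [mul_self_nonneg ((n : ℝ) - 1)]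
    have h4 : (s : ℝ) * remDraws G ∅ ≤ s * (n + B) := mul_le_mul_of_nonneg_left h1 hs0'.le
    have h5 : (s : ℝ) * n ≤ s * n ^ 3 := mul_le_mul_of_nonneg_left hn3 hs0'.le
    have h6 : (1 : ℝ) * n ^ 3 ≤ s * n ^ 3 := mul_le_mul_of_nonneg_right hs1 (by positivity)
    rw [hFeq]
    rw [hB] at h4 ⊢
    nlinarith
  -- the second moment, by Chebyshev's inequality
  have hsq : α * sqDev (meanDraws G) A (fun v => (((fun _ => 0 : Fin n → ℕ) v : ℕ) : ℝ))
      (fun v => (toDo 0 s v : ℝ)) ≤ 1 / 8 := by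
    have h1 : sqDev (meanDraws G) A (fun v => (((fun _ => 0 : Fin n → ℕ) v : ℕ) : ℝ))
        (fun v => (toDo 0 s v : ℝ)) ≤ A ^ 2 * (2 * n / s) := by
      simp only [sqDev, toDo, not_lt_zero, if_false, Nat.cast_zero, zero_add]
      rw [← hA]
      have h2 : ∏ v, ((s * meanDraws G v) ^ 2 + s * (meanDraws G v ^ 2 - meanDraws G v)) ≤
          ∏ v, ((s * meanDraws G v) ^ 2 * (1 + 1 / s)) := by
        refine Finset.prod_le_prod (fun v _ => ?_) fun v _ => ?_
        · have := one_le_meanDraws hpos v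
          have : 0 ≤ meanDraws G v ^ 2 - meanDraws G v := by nlinarith
          positivity
        · have h3 : (s * meanDraws G v) ^ 2 * (1 + 1 / s) =
            (s * meanDraws G v) ^ 2 + s * meanDraws G v ^ 2 := by field_simp
          have := one_le_meanDraws hpos v
          rw [h3]
          nlinarith
      have h3 : ∏ v, ((s * meanDraws G v) ^ 2 * (1 + 1 / (s : ℝ))) =
          A ^ 2 * (1 + 1 / (s : ℝ)) ^ n := by
        rw [Finset.prod_mul_distrib, Finset.prod_pow, ← hA, Finset.prod_const, Finset.card_univ,
          Fintype.card_fin]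
      have h4 := one_add_inv_pow_le n hs0' hsn
      have h5 := mul_le_mul_of_nonneg_left h4 (sq_nonneg A)
      rw [h3] at h2
      linarith
    calc _ ≤ α * (A ^ 2 * (2 * n / s)) := mul_le_mul_of_nonneg_left h1 (by positivity)
      _ = 8 * n * ((q : ℝ) / p) ^ 2 / s := by
        rw [hα, hεR]
        field_simp
        ring
      _ ≤ 1 / 8 := by
        rw [div_le_iff₀ hs0']
        linarith
  linarith

end Estimate

end FunGraph

/-! ### Execution of word RAM programs on natural numbers -/

namespace WordRAM

open Function

/-- Registers and memory with natural numbers as contents. -/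
structure NatState where
  regs : ℕ → ℕ
  mem : ℕ → ℕ

/-- Write into a register. -/
def NatState.setReg (σ : NatState) (r x : ℕ) : NatState := ⟨update σ.regs r x, σ.mem⟩

/-- Write into a memory cell. -/
def NatState.setMem (σ : NatState) (a x : ℕ) : NatState := ⟨σ.regs, update σ.mem a x⟩

@[simp] lemma NatState.regs_setReg (σ : NatState) (r x r' : ℕ) :
    (σ.setReg r x).regs r' = if r' = r then x else σ.regs r' := by
  simp [setReg, update_apply]

@[simp] lemma NatState.mem_setReg (σ : NatState) (r x : ℕ) : (σ.setReg r x).mem = σ.mem := rfl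

@[simp] lemma NatState.regs_setMem (σ : NatState) (a x : ℕ) : (σ.setMem a x).regs = σ.regs := rfl

@[simp] lemma NatState.mem_setMem (σ : NatState) (a x a' : ℕ) :
    (σ.setMem a x).mem a' = if a' = a then x else σ.mem a' := by
  simp [setMem, update_apply]

/-- All contents are smaller than `W`. -/
def NatState.Fits (W : ℕ) (σ : NatState) : Prop := (∀ r, σ.regs r < W) ∧ ∀ a, σ.mem a < W

/-- The machine state with the given contents. -/
def NatState.toState (w : ℕ) (σ : NatState) : State w :=
  ⟨fun r => BitVec.ofNat w (σ.regs r), fun a => BitVec.ofNat w (σ.mem a.toNat)⟩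

/-- The operations on natural numbers smaller than `W`, modulo `W`. -/
def Op.nat (W : ℕ) : Op → ℕ → ℕ → ℕ
  | .add, x, y => (x + y) % W
  | .sub, x, y => (W - y + x) % W
  | .mul, x, y => x * y % W
  | .mulHi, x, y => x * y / W
  | .div, x, y => x / y
  | .mod, x, y => x % y
  | .lt, x, y => if x < y then 1 else 0
  | .eq, x, y => if x = y then 1 else 0

/-- The value of an expression, computed with natural numbers modulo `W`. -/
def Expr.nat (W : ℕ) (σ : NatState) : Expr → ℕ
  | .const a => a % W
  | .reg r => σ.regs r
  | .load a => σ.mem (a.nat W σ)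
  | .op o x y => o.nat W (x.nat W σ) (y.nat W σ)

lemma Op.toNat_eval {w : ℕ} (hw : 0 < w) (o : Op) (x y : BitVec w) :
    (o.eval x y).toNat = o.nat (2 ^ w) x.toNat y.toNat := by
  cases o with
  | add => simp [Op.eval, Op.nat]
  | sub => simp [Op.eval, Op.nat, BitVec.toNat_sub]
  | mul => simp [Op.eval, Op.nat]
  | mulHi =>
    simp only [Op.eval, Op.nat, BitVec.toNat_ofNat]
    refine Nat.mod_eq_of_lt (Nat.div_lt_of_lt_mul ?_)
    exact Nat.mul_lt_mul_of_lt_of_le x.isLt y.isLt.le (by positivity)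
  | div => simp [Op.eval, Op.nat]
  | mod => simp [Op.eval, Op.nat]
  | lt => simp only [Op.eval, Op.nat]; split_ifs <;> simp [hw]
  | eq =>
    simp only [Op.eval, Op.nat, BitVec.toNat_inj]
    split_ifs <;> simp [hw]

lemma Expr.toNat_eval {w : ℕ} (hw : 0 < w) {σ : NatState} (hσ : σ.Fits (2 ^ w)) (e : Expr) :
    (e.eval (σ.toState w)).toNat = e.nat (2 ^ w) σ := by
  induction e with
  | const a => simp [Expr.eval, Expr.nat]
  | reg r => simp [Expr.eval, Expr.nat, NatState.toState, Nat.mod_eq_of_lt (hσ.1 r)]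
  | load a ih =>
    simp only [Expr.eval, Expr.nat, NatState.toState, BitVec.toNat_ofNat]
    rw [← NatState.toState, ih, Nat.mod_eq_of_lt (hσ.2 _)]
  | op o x y ihx ihy => rw [Expr.eval, Op.toNat_eval hw, ihx, ihy, Expr.nat]

lemma Expr.nat_lt {w : ℕ} (hw : 0 < w) {σ : NatState} (hσ : σ.Fits (2 ^ w)) (e : Expr) :
    e.nat (2 ^ w) σ < 2 ^ w :=
  Expr.toNat_eval hw hσ e ▸ (e.eval (σ.toState w)).isLt

lemma Expr.eval_toState {w : ℕ} (hw : 0 < w) {σ : NatState} (hσ : σ.Fits (2 ^ w)) (e : Expr) :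
    e.eval (σ.toState w) = BitVec.ofNat w (e.nat (2 ^ w) σ) := by
  rw [← Expr.toNat_eval hw hσ, BitVec.ofNat_toNat, BitVec.setWidth_eq]

lemma NatState.toState_setReg {w : ℕ} (σ : NatState) (r x : ℕ) :
    (σ.setReg r x).toState w = (σ.toState w).setReg r (BitVec.ofNat w x) := by
  simp only [NatState.toState, NatState.setReg, State.setReg]
  congr 1
  funext r'
  simp only [update_apply]
  split_ifs <;> rfl

lemma NatState.toState_setMem {w : ℕ} (σ : NatState) {a : ℕ} (x : ℕ) (ha : a < 2 ^ w) :
    (σ.setMem a x).toState w = (σ.toState w).setMem (BitVec.ofNat w a) (BitVec.ofNat w x) := by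
  simp only [NatState.toState, NatState.setMem, State.setMem]
  congr 1
  funext b
  simp only [update_apply]
  have : b.toNat = a ↔ b = BitVec.ofNat w a := by
    rw [← BitVec.toNat_inj, BitVec.toNat_ofNat, Nat.mod_eq_of_lt ha]
  simp only [this]
  split_ifs <;> rfl

lemma NatState.Fits.setReg {W : ℕ} {σ : NatState} (h : σ.Fits W) (r : ℕ) {x : ℕ} (hx : x < W) :
    (σ.setReg r x).Fits W := by
  refine ⟨fun r' => ?_, h.2⟩
  rw [NatState.regs_setReg]
  split_ifs
  · exact hx
  · exact h.1 r'

lemma NatState.Fits.setMem {W : ℕ} {σ : NatState} (h : σ.Fits W) (a : ℕ) {x : ℕ} (hx : x < W) :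
    (σ.setMem a x).Fits W := by
  refine ⟨h.1, fun a' => ?_⟩
  rw [NatState.mem_setMem]
  split_ifs
  · exact hx
  · exact h.2 a'

/-- `Exec W c σ σ' t`: the command `c`, which draws no random numbers, leads from `σ` to `σ'` in
`t` steps. -/
inductive Exec (W : ℕ) : Cmd → NatState → NatState → ℕ → Prop
  | skip (σ) : Exec W .skip σ σ 1
  | assign (r x σ) : Exec W (.assign r x) σ (σ.setReg r (x.nat W σ)) 1
  | store (a x σ) : Exec W (.store a x) σ (σ.setMem (a.nat W σ) (x.nat W σ)) 1
  | seq {c d σ σ' σ'' t t'} : Exec W c σ σ' t → Exec W d σ' σ'' t' →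
      Exec W (.seq c d) σ σ'' (t + t' + 1)
  | ite_true {x c d σ σ' t} : x.nat W σ ≠ 0 → Exec W c σ σ' t → Exec W (.ite x c d) σ σ' (t + 1)
  | ite_false {x c d σ σ' t} : x.nat W σ = 0 → Exec W d σ σ' t → Exec W (.ite x c d) σ σ' (t + 1)
  | loop_true {x c σ σ' σ'' t t'} : x.nat W σ ≠ 0 → Exec W c σ σ' t →
      Exec W (.loop x c) σ' σ'' t' → Exec W (.loop x c) σ σ'' (t + t' + 1)
  | loop_false {x c σ} : x.nat W σ = 0 → Exec W (.loop x c) σ σ 1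

lemma run_succ_of_step {w : ℕ} {c c' : Config w} (h : step c = PMF.pure c') (T : ℕ) :
    run (T + 1) c = run T c' := by
  rw [run, h, PMF.pure_bind]

lemma Expr.eval_ne_zero_iff {w : ℕ} (hw : 0 < w) {σ : NatState} (hσ : σ.Fits (2 ^ w)) (e : Expr) :
    e.eval (σ.toState w) ≠ 0 ↔ e.nat (2 ^ w) σ ≠ 0 := by
  rw [← Expr.toNat_eval hw hσ, Ne, Ne, ← BitVec.toNat_inj]
  simp

/-- The execution on natural numbers is what the machine does. -/
lemma Exec.run_eq {w : ℕ} (hw : 0 < w) {c : Cmd} {σ σ' : NatState} {t : ℕ}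
    (h : Exec (2 ^ w) c σ σ' t) (hσ : σ.Fits (2 ^ w)) :
    σ'.Fits (2 ^ w) ∧ ∀ (K : List Cmd) (T : ℕ),
      run (T + t) (c :: K, σ.toState w) = run T (K, σ'.toState w) := by
  induction h with
  | skip σ => exact ⟨hσ, fun K T => run_succ_of_step rfl T⟩
  | assign r x σ =>
    refine ⟨hσ.setReg r (Expr.nat_lt hw hσ x), fun K T => run_succ_of_step ?_ T⟩
    rw [step, NatState.toState_setReg, Expr.eval_toState hw hσ]
  | store a x σ =>
    refine ⟨hσ.setMem _ (Expr.nat_lt hw hσ x), fun K T => run_succ_of_step ?_ T⟩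
    rw [step, NatState.toState_setMem _ _ (Expr.nat_lt hw hσ a), Expr.eval_toState hw hσ,
      Expr.eval_toState hw hσ]
  | @seq c d σ σ' σ'' t t' _ _ ih1 ih2 =>
    obtain ⟨h1, h2⟩ := ih1 hσ
    obtain ⟨h3, h4⟩ := ih2 h1
    refine ⟨h3, fun K T => ?_⟩
    rw [show T + (t + t' + 1) = (T + t') + t + 1 by ring, run_succ_of_step rfl, h2, h4]
  | @ite_true x c d σ σ' t hx _ ih =>
    obtain ⟨h1, h2⟩ := ih hσ
    refine ⟨h1, fun K T => ?_⟩
    rw [← add_assoc, run_succ_of_step rfl, if_pos ((Expr.eval_ne_zero_iff hw hσ x).2 hx), h2]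
  | @ite_false x c d σ σ' t hx _ ih =>
    obtain ⟨h1, h2⟩ := ih hσ
    refine ⟨h1, fun K T => ?_⟩
    rw [← add_assoc, run_succ_of_step rfl,
      if_neg (fun h => (Expr.eval_ne_zero_iff hw hσ x).1 h hx), h2]
  | @loop_true x c σ σ' σ'' t t' hx _ _ ih1 ih2 =>
    obtain ⟨h1, h2⟩ := ih1 hσ
    obtain ⟨h3, h4⟩ := ih2 h1
    refine ⟨h3, fun K T => ?_⟩
    rw [show T + (t + t' + 1) = (T + t') + t + 1 by ring, run_succ_of_step rfl,
      if_pos ((Expr.eval_ne_zero_iff hw hσ x).2 hx), h2, h4]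
  | @loop_false x c σ hx =>
    refine ⟨hσ, fun K T => ?_⟩
    rw [run_succ_of_step rfl, if_neg (fun h => (Expr.eval_ne_zero_iff hw hσ x).1 h hx)]

/-- From `σ`, the command `c` halts within `t` steps in a state that satisfies `Q`. -/
def Ensures (W : ℕ) (c : Cmd) (σ : NatState) (t : ℕ) (Q : NatState → Prop) : Prop :=
  ∃ σ' t', t' ≤ t ∧ Exec W c σ σ' t' ∧ Q σ'

section Rules

variable {W : ℕ} {σ : NatState} {Q : NatState → Prop}

lemma Ensures.mono {c : Cmd} {t t' : ℕ} {Q' : NatState → Prop} (h : Ensures W c σ t Q)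
    (ht : t ≤ t') (hQ : ∀ σ, Q σ → Q' σ) : Ensures W c σ t' Q' := by
  obtain ⟨σ', s, hs, h, hQ'⟩ := h
  exact ⟨σ', s, hs.trans ht, h, hQ _ hQ'⟩

lemma Ensures.skip (h : Q σ) : Ensures W .skip σ 1 Q := ⟨_, _, le_rfl, .skip σ, h⟩

lemma Ensures.assign {r : ℕ} {x : Expr} (h : Q (σ.setReg r (x.nat W σ))) :
    Ensures W (.assign r x) σ 1 Q := ⟨_, _, le_rfl, .assign r x σ, h⟩

lemma Ensures.store {a x : Expr} (h : Q (σ.setMem (a.nat W σ) (x.nat W σ))) :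
    Ensures W (.store a x) σ 1 Q := ⟨_, _, le_rfl, .store a x σ, h⟩

lemma Ensures.seq {c d : Cmd} {t t' : ℕ}
    (h : Ensures W c σ t fun σ' => Ensures W d σ' t' Q) :
    Ensures W (.seq c d) σ (t + t' + 1) Q := by
  obtain ⟨σ', s, hs, h, σ'', s', hs', h', hQ⟩ := h
  exact ⟨σ'', s + s' + 1, by omega, .seq h h', hQ⟩

lemma Ensures.ite {x : Expr} {c d : Cmd} {t : ℕ} (h1 : x.nat W σ ≠ 0 → Ensures W c σ t Q)
    (h2 : ¬ x.nat W σ ≠ 0 → Ensures W d σ t Q) : Ensures W (.ite x c d) σ (t + 1) Q := by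
  by_cases hx : x.nat W σ = 0
  · obtain ⟨σ', s, hs, h, hQ⟩ := h2 (not_not.2 hx)
    exact ⟨σ', s + 1, by omega, .ite_false hx h, hQ⟩
  · obtain ⟨σ', s, hs, h, hQ⟩ := h1 hx
    exact ⟨σ', s + 1, by omega, .ite_true hx h, hQ⟩

/-- The loop rule: `I k` is an invariant that bounds the number of remaining rounds by `k`. -/
lemma Ensures.loop {x : Expr} {c : Cmd} {t : ℕ} (I : ℕ → NatState → Prop)
    (hI : ∀ k σ, I k σ → ¬ x.nat W σ ≠ 0 ∧ Q σ ∨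
      x.nat W σ ≠ 0 ∧ ∃ k', k = k' + 1 ∧ Ensures W c σ t (I k')) {k : ℕ} (h : I k σ) :
    Ensures W (.loop x c) σ (k * (t + 1) + 1) Q := by
  induction k generalizing σ with
  | zero =>
    rcases hI 0 σ h with ⟨hx, hQ⟩ | ⟨-, k', hk', -⟩
    · exact ⟨σ, 1, by omega, .loop_false (not_not.1 hx), hQ⟩
    · omega
  | succ k ih =>
    rcases hI _ σ h with ⟨hx, hQ⟩ | ⟨hx, k', hk', σ', s, hs, hc, hI'⟩
    · exact ⟨σ, 1, by omega, .loop_false (not_not.1 hx), hQ⟩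
    · obtain rfl : k = k' := by omega
      obtain ⟨σ'', s', hs', hc', hQ⟩ := ih hI'
      refine ⟨σ'', s + s' + 1, ?_, .loop_true hx hc hc', hQ⟩
      rw [Nat.succ_mul]
      omega

end Rules

/-- From the configuration `c`, the machine halts within `T` steps, and the final state belongs to
`E` with probability at least `x`. -/
def Achieves {w : ℕ} (E : Set (State w)) (T : ℕ) (c : Config w) (x : ℝ) : Prop :=
  (∀ c' ∈ (run T c).support, c'.1 = []) ∧
    ENNReal.ofReal x ≤ (run T c).toOuterMeasure {c' | c'.2 ∈ E}

section Achieves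

variable {w : ℕ} {E : Set (State w)}

lemma run_nil (T : ℕ) (s : State w) : run T ([], s) = PMF.pure ([], s) := by
  induction T with
  | zero => rfl
  | succ T ih => rw [run_succ_of_step rfl, ih]

lemma run_add (T T' : ℕ) (c : Config w) : run (T + T') c = (run T c).bind (run T') := by
  induction T generalizing c with
  | zero => rw [Nat.zero_add, run, PMF.pure_bind]
  | succ T ih =>
    rw [Nat.succ_add, run, run, PMF.bind_bind]
    exact congrArg _ (funext ih)

lemma Achieves.mono_time {T T' : ℕ} {c : Config w} {x : ℝ} (h : Achieves E T c x) (hT : T ≤ T') :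
    Achieves E T' c x := by
  obtain ⟨k, rfl⟩ := Nat.exists_eq_add_of_le hT
  have : run (T + k) c = run T c := by
    rw [run_add]
    conv_rhs => rw [← PMF.bind_pure (run T c)]
    ext a
    rw [PMF.bind_apply, PMF.bind_apply]
    refine tsum_congr fun c' => ?_
    by_cases hc : c' ∈ (run T c).support
    · obtain ⟨l, s⟩ := c'
      obtain rfl : l = [] := h.1 _ hc
      rw [run_nil]
    · rw [(PMF.apply_eq_zero_iff _ _).2 hc, zero_mul, zero_mul]
  rw [Achieves, this]
  exact h

lemma Achieves.mono {T : ℕ} {c : Config w} {x y : ℝ} (h : Achieves E T c x) (hy : y ≤ x) :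
    Achieves E T c y :=
  ⟨h.1, (ENNReal.ofReal_le_ofReal hy).trans h.2⟩

lemma achieves_nil {s : State w} {x : ℝ} (hx : x ≤ 1) (h : 0 < x → s ∈ E) :
    Achieves E 0 ([], s) x := by
  refine ⟨fun c' hc' => ?_, ?_⟩
  · rw [run, PMF.support_pure, Set.mem_singleton_iff] at hc'
    rw [hc']
  · by_cases hx0 : 0 < x
    · rw [run, PMF.toOuterMeasure_pure_apply, if_pos (by exact h hx0)]
      exact ENNReal.ofReal_le_one.2 hx
    · rw [ENNReal.ofReal_of_nonpos (not_lt.1 hx0)]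
      exact zero_le

lemma Achieves.of_step {T : ℕ} {c c' : Config w} {x : ℝ} (hc : step c = PMF.pure c')
    (h : Achieves E T c' x) : Achieves E (T + 1) c x := by
  rw [Achieves, run_succ_of_step hc]
  exact h

/-- A deterministic part of the program only changes the state. -/
lemma Achieves.of_ensures (hw : 0 < w) {c : Cmd} {σ : NatState} {t T : ℕ} {Q : NatState → Prop}
    {K : List Cmd} {x : ℝ} (hσ : σ.Fits (2 ^ w)) (hc : Ensures (2 ^ w) c σ t Q)
    (h : ∀ σ', σ'.Fits (2 ^ w) → Q σ' → Achieves E T (K, σ'.toState w) x) :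
    Achieves E (T + t) (c :: K, σ.toState w) x := by
  obtain ⟨σ', t', ht, hex, hQ⟩ := hc
  obtain ⟨h1, h2⟩ := hex.run_eq hw hσ
  refine Achieves.mono_time (T := T + t') ?_ (by omega)
  rw [Achieves, h2]
  exact h σ' h1 hQ

/-- Drawing a random number averages the probabilities. -/
lemma Achieves.rand (hw : 0 < w) {r : ℕ} {e : Expr} {K : List Cmd} {σ : NatState} {T v : ℕ}
    (hσ : σ.Fits (2 ^ w)) (he : e.nat (2 ^ w) σ = v) (hv : 0 < v) {x : Fin v → ℝ}
    (hx : ∀ i, 0 ≤ x i)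
    (h : ∀ i : Fin v, Achieves E T (K, (σ.setReg r i).toState w) (x i)) :
    Achieves E (T + 1) (.rand r e :: K, σ.toState w) ((∑ i, x i) / v) := by
  have : NeZero v := ⟨hv.ne'⟩
  have hrun : run (T + 1) (.rand r e :: K, σ.toState w) =
      (PMF.uniformOfFintype (Fin v)).bind fun i => run T (K, (σ.setReg r i).toState w) := by
    rw [run, step, randBelow]
    have he' := Expr.toNat_eval hw hσ e
    rw [he] at he'
    rw [dif_neg (by omega), PMF.map_comp, PMF.bind_map]
    subst he'
    refine (PMF.bind_bind _ _ _).trans (congrArg _ (funext fun i => ?_))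
    refine (PMF.pure_bind _ _).trans ?_
    rw [NatState.toState_setReg]
    rfl
  rw [Achieves, hrun]
  constructor
  · intro c' hc'
    rw [PMF.mem_support_bind_iff] at hc'
    obtain ⟨i, -, hi⟩ := hc'
    exact (h i).1 c' hi
  · rw [PMF.toOuterMeasure_bind_apply, tsum_fintype]
    simp only [PMF.uniformOfFintype_apply, Fintype.card_fin]
    rw [← Finset.mul_sum, div_eq_inv_mul, ENNReal.ofReal_mul (by positivity),
      ENNReal.ofReal_inv_of_pos (by exact_mod_cast hv), ENNReal.ofReal_natCast,
      ENNReal.ofReal_sum_of_nonneg fun i _ => hx i]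
    gcongr with i
    exact (h i).2

end Achieves

end WordRAM

/-! ### The program -/

namespace WordRAM

open Function

/-! Registers: 0 to 3 describe the output, 4 is `n`, 5 is `m`, 6 is the address `4 + 2 * m` of the
configuration, 7 is the stage, 8 the number of runs left, 9 the number of draws left, 10 the current
vertex, 11 its new value, 12 a loop index, 13 a degree, 14 the index of the drawn neighbour, 15 to
18 are used in following a cycle, 19 is the number `s` of runs, 20 the address of a big number, 21 a
factor, 22 a carry, 23 and 24 are auxiliary.

Memory: the input occupies the cells below `4 + 2 * m`. It is followed by the configuration (`n`
cells), the counts (`n` cells), the numerator and the denominator of the output (`n + 1` cells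
each). -/

/-- Inner part of `scan`: register 23 holds a neighbour of the vertex in register 10, and register
13 the number of neighbours found before. -/
def scanHit : Cmd :=
  .seq (.ite (.op .eq (.reg 13) (.reg 14)) (.assign 11 (.reg 23)) .skip)
    (.assign 13 (.op .add (.reg 13) (.const 1)))

/-- Body of the loop over the edges in `scan`; register 12 is the index of the edge. -/
def scanBody : Cmd :=
  .seq
    (.ite (.op .eq (.load (.op .add (.const 4) (.op .mul (.const 2) (.reg 12)))) (.reg 10))
      (.seq (.assign 23 (.load (.op .add (.const 5) (.op .mul (.const 2) (.reg 12))))) scanHit)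
      (.ite (.op .eq (.load (.op .add (.const 5) (.op .mul (.const 2) (.reg 12)))) (.reg 10))
        (.seq (.assign 23 (.load (.op .add (.const 4) (.op .mul (.const 2) (.reg 12))))) scanHit)
        .skip))
    (.assign 12 (.op .add (.reg 12) (.const 1)))

/-- Count the neighbours of the vertex in register 10 into register 13, and put the neighbour whose
index is in register 14 into register 11. -/
def scan : Cmd :=
  .seq (.assign 12 (.const 0)) (.seq (.assign 13 (.const 0))
    (.loop (.op .lt (.reg 12) (.reg 5)) scanBody))

/-- Put the least unassigned vertex into register 10. -/
def findFree : Cmd :=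
  .seq (.assign 10 (.const 0))
    (.loop (.op .eq (.op .eq (.load (.op .add (.reg 6) (.reg 10))) (.reg 10)) (.const 0))
      (.assign 10 (.op .add (.reg 10) (.const 1))))

/-- One step along the orbit: register 15 is the current vertex, register 12 counts the steps,
register 17 is the least vertex seen and register 18 its predecessor. -/
def followBody : Cmd :=
  .seq (.assign 16 (.load (.op .add (.reg 6) (.reg 15))))
    (.seq (.ite (.op .lt (.reg 17) (.reg 16)) .skip
        (.seq (.assign 17 (.reg 16)) (.assign 18 (.reg 15))))
      (.seq (.assign 15 (.reg 16)) (.assign 12 (.op .add (.reg 12) (.const 1)))))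

/-- Follow the orbit of the vertex in register 10 until it returns, for at most `n` steps. -/
def follow : Cmd :=
  .seq (.assign 15 (.reg 10)) (.seq (.assign 17 (.reg 10)) (.seq (.assign 18 (.reg 10))
    (.seq (.assign 12 (.const 0)) (.seq followBody
      (.loop (.op .mul (.op .eq (.op .eq (.reg 15) (.reg 10)) (.const 0))
        (.op .lt (.reg 12) (.reg 4))) followBody)))))

/-- Unassign the vertices of the cycle through the vertex in register 15. -/
def popCycle : Cmd :=
  .loop (.op .eq (.op .eq (.load (.op .add (.reg 6) (.reg 15))) (.reg 15)) (.const 0))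
    (.seq (.assign 16 (.load (.op .add (.reg 6) (.reg 15))))
      (.seq (.store (.op .add (.reg 6) (.reg 15)) (.reg 15)) (.assign 15 (.reg 16))))

/-- Unassign all vertices. -/
def clear : Cmd :=
  .seq (.assign 12 (.const 0)) (.loop (.op .lt (.reg 12) (.reg 4))
    (.seq (.store (.op .add (.reg 6) (.reg 12)) (.reg 12))
      (.assign 12 (.op .add (.reg 12) (.const 1)))))

/-- The part of a draw before the random choice. -/
def beforeDraw : Cmd := .seq findFree (.seq (.assign 14 (.const 0)) scan)

/-- The part of a draw after the random choice: count the draw, assign the vertex, and then pop the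
cycle, or pass to the next vertex or the next run. -/
def afterDraw : Cmd :=
  .seq scan
    (.seq (.ite (.op .eq (.reg 10) (.reg 7))
        (.store (.op .add (.op .add (.reg 6) (.reg 4)) (.reg 10))
          (.op .add (.load (.op .add (.op .add (.reg 6) (.reg 4)) (.reg 10))) (.const 1)))
        .skip)
      (.seq (.store (.op .add (.reg 6) (.reg 10)) (.reg 11))
        (.seq follow
          (.seq
            (.ite (.op .mul (.op .eq (.reg 15) (.reg 10))
                (.op .eq (.op .lt (.load (.op .add (.reg 6) (.reg 17))) (.reg 18)) (.const 0)))
              popCycle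
              (.ite (.op .eq (.reg 10) (.reg 7))
                (.seq (.assign 7 (.op .add (.reg 7) (.const 1)))
                  (.ite (.op .eq (.reg 7) (.reg 4))
                    (.seq (.assign 8 (.op .sub (.reg 8) (.const 1)))
                      (.seq (.assign 7 (.const 0)) clear))
                    .skip))
                .skip))
            (.assign 9 (.op .sub (.reg 9) (.const 1)))))))

/-- The sampling loop: register 8 is the number of remaining runs, register 9 the number of draws
that are still allowed. -/
def sample : Cmd :=
  .loop (.op .mul (.reg 8) (.op .lt (.const 0) (.reg 9)))
    (.seq beforeDraw (.seq (.rand 14 (.reg 13)) afterDraw))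

/-- Body of the loop over the digits in `bigMul`; register 22 is the carry. -/
def bigMulBody : Cmd :=
  .seq (.assign 23 (.op .mul (.load (.op .add (.reg 20) (.reg 12))) (.reg 21)))
    (.seq (.assign 24 (.op .mulHi (.load (.op .add (.reg 20) (.reg 12))) (.reg 21)))
      (.seq (.store (.op .add (.reg 20) (.reg 12)) (.op .add (.reg 23) (.reg 22)))
        (.seq (.assign 22 (.op .add (.reg 24)
            (.op .lt (.load (.op .add (.reg 20) (.reg 12))) (.reg 22))))
          (.assign 12 (.op .add (.reg 12) (.const 1))))))

/-- Multiply the number with `n + 1` digits at the address in register 20 by the word in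
register 21. -/
def bigMul : Cmd :=
  .seq (.assign 22 (.const 0)) (.seq (.assign 12 (.const 0))
    (.loop (.op .lt (.reg 12) (.op .add (.reg 4) (.const 1))) bigMulBody))

/-- Compute the product over all vertices of the values that `c` puts into register 21. -/
def bigProd (c : Cmd) : Cmd :=
  .seq (.store (.reg 20) (.const 1)) (.seq (.assign 10 (.const 0))
    (.loop (.op .lt (.reg 10) (.reg 4))
      (.seq c (.seq bigMul (.assign 10 (.op .add (.reg 10) (.const 1)))))))

/-- Compute the output: the numerator is the product of the degrees times the number of runs, the
denominator is the product of the counts. -/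
def finish : Cmd :=
  .seq (.assign 20 (.op .add (.reg 6) (.op .mul (.const 2) (.reg 4))))
    (.seq (bigProd (.seq scan (.assign 21 (.op .mul (.reg 13) (.reg 19)))))
      (.seq (.assign 0 (.reg 20)) (.seq (.assign 1 (.op .add (.reg 4) (.const 1)))
        (.seq (.assign 20 (.op .add (.op .add (.reg 6) (.op .mul (.const 3) (.reg 4))) (.const 1)))
          (.seq (bigProd (.assign 21
              (.load (.op .add (.op .add (.reg 6) (.reg 4)) (.reg 10)))))
            (.seq (.assign 2 (.reg 20)) (.assign 3 (.op .add (.reg 4) (.const 1)))))))))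

/-- Initialization, with `s = 64 * n * (q ^ 2 / p ^ 2 + 1)` runs and at most `40 * s * n ^ 3`
draws. -/
def start : Cmd :=
  .seq (.assign 4 (.load (.const 0))) (.seq (.assign 5 (.load (.const 1)))
    (.seq (.assign 6 (.op .add (.const 4) (.op .mul (.const 2) (.reg 5))))
      (.seq (.assign 19 (.op .mul (.op .mul (.const 64) (.reg 4))
          (.op .add (.op .div (.op .mul (.load (.const 3)) (.load (.const 3)))
            (.op .mul (.load (.const 2)) (.load (.const 2)))) (.const 1))))
        (.seq (.assign 8 (.reg 19))
          (.seq (.assign 9 (.op .mul (.op .mul (.const 40) (.reg 19))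
              (.op .mul (.op .mul (.reg 4) (.reg 4)) (.reg 4))))
            (.seq (.assign 7 (.const 0)) clear))))))

/-- The approximate counting program. -/
def approxCount : Cmd := .seq start (.seq sample finish)

/-! ### Correctness of the program -/

section Spec

variable {n m : ℕ}

/-- The memory layout: the edges `e`, the configuration `f`, the counts `C`. -/
structure Layout (e : Fin m → Fin n × Fin n) (f : Fin n → Fin n) (C : Fin n → ℕ)
    (σ : NatState) : Prop where
  reg4 : σ.regs 4 = n
  reg5 : σ.regs 5 = m
  reg6 : σ.regs 6 = 4 + 2 * m
  fst : ∀ i : Fin m, σ.mem (4 + 2 * i) = (e i).1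
  snd : ∀ i : Fin m, σ.mem (5 + 2 * i) = (e i).2
  conf : ∀ v : Fin n, σ.mem (4 + 2 * m + v) = f v
  count : ∀ v : Fin n, σ.mem (4 + 2 * m + n + v) = C v

variable {e : Fin m → Fin n × Fin n} {f : Fin n → Fin n} {C : Fin n → ℕ} {σ σ' : NatState} {W : ℕ}

lemma Layout.congr (h : Layout e f C σ) (hmem : σ'.mem = σ.mem) (h4 : σ'.regs 4 = σ.regs 4)
    (h5 : σ'.regs 5 = σ.regs 5) (h6 : σ'.regs 6 = σ.regs 6) : Layout e f C σ' :=
  ⟨h4.trans h.reg4, h5.trans h.reg5, h6.trans h.reg6, hmem ▸ h.fst, hmem ▸ h.snd, hmem ▸ h.conf,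
    hmem ▸ h.count⟩

/-- The registers outside `L` are unchanged. -/
def Frame (L : List ℕ) (σ σ' : NatState) : Prop := ∀ r, r ∉ L → σ'.regs r = σ.regs r

/-- The other end of the edge `x`, if `v` is an end. -/
def otherEnd (v : Fin n) (x : Fin n × Fin n) : Option (Fin n) :=
  if x.1 = v then some x.2 else if x.2 = v then some x.1 else none

/-- The neighbours of `v` along the first `k` edges. -/
def nbrList (e : Fin m → Fin n × Fin n) (v : Fin n) (k : ℕ) : List (Fin n) :=
  ((List.ofFn e).take k).filterMap (otherEnd v)

lemma nbrList_zero (v : Fin n) : nbrList e v 0 = [] := by simp [nbrList]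

lemma nbrList_succ (v : Fin n) {k : ℕ} (hk : k < m) :
    nbrList e v (k + 1) = nbrList e v k ++ (otherEnd v (e ⟨k, hk⟩)).toList := by
  rw [nbrList, List.take_add_one, List.filterMap_append, ← nbrList]
  congr 1
  rw [List.getElem?_ofFn, dif_pos hk]
  cases h : otherEnd v (e ⟨k, hk⟩) <;> simp [h]

lemma length_nbrList_le (v : Fin n) (k : ℕ) : (nbrList e v k).length ≤ k := by
  refine (List.length_filterMap_le _ _).trans ?_
  simp

lemma eval_lt (a b : Expr) : (Expr.op .lt a b).nat W σ ≠ 0 ↔ a.nat W σ < b.nat W σ := by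
  simp [Expr.nat, Op.nat]

lemma eval_eq (a b : Expr) : (Expr.op .eq a b).nat W σ ≠ 0 ↔ a.nat W σ = b.nat W σ := by
  simp [Expr.nat, Op.nat]

lemma eval_not (a : Expr) :
    (Expr.op .eq a (.const 0)).nat W σ ≠ 0 ↔ a.nat W σ = 0 := by
  by_cases h : a.nat W σ = 0 <;> simp [Expr.nat, Op.nat, h]

lemma scanHit_spec (hW : 1 < W) (h13 : σ.regs 13 + 1 < W) :
    Ensures W scanHit σ 4 fun σ' => σ'.mem = σ.mem ∧ Frame [11, 13] σ σ' ∧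
      σ'.regs 13 = σ.regs 13 + 1 ∧
      σ'.regs 11 = if σ.regs 13 = σ.regs 14 then σ.regs 23 else σ.regs 11 := by
  unfold scanHit
  refine Ensures.mono (Ensures.seq (Ensures.ite (t := 1) (fun h => Ensures.assign
    (Ensures.assign ?_)) (fun h => Ensures.skip (Ensures.assign ?_)))) (by norm_num) fun _ h => h
  · rw [eval_eq] at h
    simp only [Expr.nat, Op.nat] at h ⊢
    refine ⟨rfl, fun r hr => ?_, ?_, ?_⟩
    · simp only [List.mem_cons, List.not_mem_nil, or_false, not_or] at hr
      simp [hr]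
    · simp [Nat.mod_eq_of_lt hW, Nat.mod_eq_of_lt h13]
    · simp [h]
  · rw [eval_eq] at h
    simp only [Expr.nat, Op.nat] at h ⊢
    refine ⟨rfl, fun r hr => ?_, ?_, ?_⟩
    · simp only [List.mem_cons, List.not_mem_nil, or_false, not_or] at hr
      simp [hr]
    · simp [Nat.mod_eq_of_lt hW, Nat.mod_eq_of_lt h13]
    · simp [h]

lemma Layout.eval_fst (h : Layout e f C σ) (hW : 6 + 2 * m < W) {i : Fin m}
    (h12 : σ.regs 12 = i) :
    (Expr.load (.op .add (.const 4) (.op .mul (.const 2) (.reg 12)))).nat W σ = (e i).1 := by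
  have hi := i.isLt
  simp only [Expr.nat, Op.nat, h12]
  rw [Nat.mod_eq_of_lt (a := 2) (by omega), Nat.mod_eq_of_lt (a := 4) (by omega),
    Nat.mod_eq_of_lt (a := 2 * i) (by omega), Nat.mod_eq_of_lt (by omega), h.fst]

lemma Layout.eval_snd (h : Layout e f C σ) (hW : 6 + 2 * m < W) {i : Fin m}
    (h12 : σ.regs 12 = i) :
    (Expr.load (.op .add (.const 5) (.op .mul (.const 2) (.reg 12)))).nat W σ = (e i).2 := by
  have hi := i.isLt
  simp only [Expr.nat, Op.nat, h12]
  rw [Nat.mod_eq_of_lt (a := 2) (by omega), Nat.mod_eq_of_lt (a := 5) (by omega),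
    Nat.mod_eq_of_lt (a := 2 * i) (by omega), Nat.mod_eq_of_lt (by omega), h.snd]

lemma Layout.eval_addr (h : Layout e f C σ) (hW : 4 + 2 * m + n < W) {r : ℕ} {v : Fin n}
    (hr : σ.regs r = v) : (Expr.op .add (.reg 6) (.reg r)).nat W σ = 4 + 2 * m + v := by
  have hv := v.isLt
  simp only [Expr.nat, Op.nat, hr, h.reg6]
  rw [Nat.mod_eq_of_lt (by omega)]

lemma Layout.eval_conf (h : Layout e f C σ) (hW : 4 + 2 * m + n < W) {r : ℕ} {v : Fin n}
    (hr : σ.regs r = v) : (Expr.load (.op .add (.reg 6) (.reg r))).nat W σ = f v := by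
  rw [Expr.nat, h.eval_addr hW hr, h.conf]

lemma eval_succ {r x : ℕ} (hr : σ.regs r = x) (hW : x + 1 < W) :
    (Expr.op .add (.reg r) (.const 1)).nat W σ = x + 1 := by
  simp only [Expr.nat, Op.nat, hr]
  rw [Nat.mod_eq_of_lt (a := 1) (by omega), Nat.mod_eq_of_lt hW]

lemma Frame.setReg {L : List ℕ} {r x : ℕ} (h : Frame L σ σ') (hr : r ∈ L) :
    Frame L σ (σ'.setReg r x) := fun r' hr' => by
  rw [NatState.regs_setReg, if_neg (by rintro rfl; exact hr' hr), h r' hr']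

lemma Frame.setMem {L : List ℕ} {a x : ℕ} (h : Frame L σ σ') : Frame L σ (σ'.setMem a x) := h

lemma Frame.refl (L : List ℕ) (σ : NatState) : Frame L σ σ := fun _ _ => rfl

lemma Frame.trans {L L' : List ℕ} {σ'' : NatState} (h : Frame L σ σ') (h' : Frame L' σ' σ'')
    (hL : L' ⊆ L) : Frame L σ σ'' := fun r hr => by rw [h' r fun h => hr (hL h), h r hr]

lemma Layout.frame {L : List ℕ} (h : Layout e f C σ) (hmem : σ'.mem = σ.mem) (hL : Frame L σ σ')
    (h4 : 4 ∉ L) (h5 : 5 ∉ L) (h6 : 6 ∉ L) : Layout e f C σ' :=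
  h.congr hmem (hL 4 h4) (hL 5 h5) (hL 6 h6)

lemma Layout.setReg (h : Layout e f C σ) {r x : ℕ} (hr : r ≠ 4 ∧ r ≠ 5 ∧ r ≠ 6) :
    Layout e f C (σ.setReg r x) :=
  h.congr rfl (by simp [hr.1.symm]) (by simp [hr.2.1.symm]) (by simp [hr.2.2.symm])

lemma scanBody_spec (h : Layout e f C σ) (hW : 6 + 2 * m < W) {v : Fin n} {i : Fin m} {c : ℕ}
    (h10 : σ.regs 10 = v) (h12 : σ.regs 12 = i) (h13 : σ.regs 13 = c) (hc : c ≤ i) :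
    Ensures W scanBody σ 10 fun σ' => σ'.mem = σ.mem ∧ Frame [11, 12, 13, 23] σ σ' ∧
      σ'.regs 12 = i + 1 ∧ σ'.regs 13 = c + (otherEnd v (e i)).toList.length ∧
      σ'.regs 11 = if σ.regs 14 = c then ((otherEnd v (e i)).map Fin.val).getD (σ.regs 11)
        else σ.regs 11 := by
  have hi := i.isLt
  have hit : ∀ (x : Expr) (u : Fin n), x.nat W σ = u → otherEnd v (e i) = some u →
      Ensures W (.seq (.assign 23 x) scanHit) σ 6 fun σ' =>
        Ensures W (.assign 12 (.op .add (.reg 12) (.const 1))) σ' 1 fun σ' =>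
          σ'.mem = σ.mem ∧ Frame [11, 12, 13, 23] σ σ' ∧
      σ'.regs 12 = i + 1 ∧ σ'.regs 13 = c + (otherEnd v (e i)).toList.length ∧
      σ'.regs 11 = if σ.regs 14 = c then ((otherEnd v (e i)).map Fin.val).getD (σ.regs 11)
        else σ.regs 11 := by
    intro x u hx hu
    refine Ensures.seq (Ensures.assign ((scanHit_spec (by omega) (by simp; omega)).mono le_rfl ?_))
    rintro σ' ⟨h1, h2, h3, h4⟩
    have h12' : σ'.regs 12 = i := by rw [h2 12 (by simp)]; simp [h12]
    refine Ensures.assign ⟨h1, ?_, ?_, ?_, ?_⟩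
    · exact (((Frame.refl _ σ).setReg (by simp)).trans h2 (by simp)).setReg (by simp)
    · rw [eval_succ h12' (by omega)]; simp
    · simp [h3, hu, h13]
    · simp only [NatState.regs_setReg, Nat.reduceEqDiff, if_false]
      rw [h4, hu]
      simp [h13, hx, eq_comm]
  unfold scanBody
  refine Ensures.mono (Ensures.seq (t' := 1) (Ensures.ite (t := 7) (fun h1 => ?_) (fun h1 =>
    Ensures.ite (t := 6) (fun h2 => ?_) (fun h2 => ?_)))) (by norm_num) fun _ h => h
  · rw [eval_eq, h.eval_fst hW h12, Expr.nat, h10] at h1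
    exact (hit _ _ (h.eval_snd hW h12) (if_pos (Fin.ext h1))).mono (by norm_num) fun _ h => h
  · rw [eval_eq, h.eval_fst hW h12, Expr.nat, h10] at h1
    rw [eval_eq, h.eval_snd hW h12, Expr.nat, h10] at h2
    refine hit _ _ (h.eval_fst hW h12) ?_
    rw [otherEnd, if_neg (fun h => h1 (congrArg Fin.val h)), if_pos (Fin.ext h2)]
  · rw [eval_eq, h.eval_fst hW h12, Expr.nat, h10] at h1
    rw [eval_eq, h.eval_snd hW h12, Expr.nat, h10] at h2
    have hu : otherEnd v (e i) = none := by
      rw [otherEnd, if_neg (fun h => h1 (congrArg Fin.val h)),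
        if_neg (fun h => h2 (congrArg Fin.val h))]
    refine Ensures.mono (Ensures.skip (Ensures.assign ⟨rfl, (Frame.refl _ σ).setReg (by simp),
      ?_, ?_, ?_⟩)) (by norm_num) fun _ h => h
    · rw [eval_succ h12 (by omega)]; simp
    · simp [hu, h13]
    · simp [hu]

/-- `scan` reads the neighbour whose index is in register 14; if there is none, register 11 is
unchanged. -/
lemma scan_spec (h : Layout e f C σ) (hW : 6 + 2 * m < W) {v : Fin n} (h10 : σ.regs 10 = v) :
    Ensures W scan σ (11 * m + 5) fun σ' => σ'.mem = σ.mem ∧ Frame [11, 12, 13, 23] σ σ' ∧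
      σ'.regs 13 = (nbrList e v m).length ∧
      σ'.regs 11 = ((nbrList e v m)[σ.regs 14]?.map Fin.val).getD (σ.regs 11) := by
  unfold scan
  refine Ensures.mono (Ensures.seq (Ensures.assign (Ensures.seq (Ensures.assign
    (Ensures.loop (t := 10) (k := m) (fun k σ' => σ'.mem = σ.mem ∧ Frame [11, 12, 13, 23] σ σ' ∧
      ∃ i, i + k = m ∧ σ'.regs 12 = i ∧ σ'.regs 13 = (nbrList e v i).length ∧
      σ'.regs 11 = ((nbrList e v i)[σ.regs 14]?.map Fin.val).getD (σ.regs 11)) ?_ ?_)))))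
      (by omega) fun _ h => h
  · rintro k σ' ⟨h1, h2, i, hik, h3, h4, h5⟩
    have hlay := h.frame h1 h2 (by simp) (by simp) (by simp)
    rw [eval_lt]
    simp only [Expr.nat, h3, hlay.reg5]
    by_cases hi : i < m
    · right
      refine ⟨hi, m - (i + 1), by omega, ?_⟩
      refine (scanBody_spec hlay hW (v := v) (i := ⟨i, hi⟩) (by rw [h2 10 (by simp), h10]) h3 h4
        (length_nbrList_le v i)).mono le_rfl ?_
      rintro σ'' ⟨g1, g2, g3, g4, g5⟩
      refine ⟨g1.trans h1, h2.trans g2 (by simp), i + 1, by omega, g3, ?_, ?_⟩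
      · rw [g4, nbrList_succ v hi, List.length_append]
      · rw [g5, h2 14 (by simp), h5, nbrList_succ v hi, List.getElem?_append]
        rcases lt_trichotomy (σ.regs 14) (nbrList e v i).length with hlt | heq | hgt
        · rw [if_neg hlt.ne, if_pos hlt]
        · rw [if_pos heq, if_neg (by omega), heq, Nat.sub_self]
          cases otherEnd v (e ⟨i, hi⟩) <;> simp
        · rw [if_neg hgt.ne', if_neg (by omega), List.getElem?_eq_none (by omega),
            List.getElem?_eq_none]
          have : (otherEnd v (e ⟨i, hi⟩)).toList.length ≤ 1 := by
            cases otherEnd v (e ⟨i, hi⟩) <;> simp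
          omega
    · left
      obtain rfl : i = m := by omega
      exact ⟨hi, h1, h2, h4, h5⟩
  · refine ⟨rfl, ((Frame.refl _ σ).setReg (by simp)).setReg (by simp), 0, by simp, ?_, ?_, ?_⟩
    · simp [Expr.nat]
    · simp [Expr.nat, nbrList_zero]
    · simp [nbrList_zero]

end Spec

end WordRAM

/-! ### Correctness of the operations on the configuration -/

namespace WordRAM

open Function FunGraph

section Orbit

variable {n m : ℕ} {e : Fin m → Fin n × Fin n} {f : Fin n → Fin n} {C : Fin n → ℕ}
  {σ σ' : NatState} {W : ℕ}

@[simp] lemma NatState.setReg_setReg (σ : NatState) (r x y : ℕ) :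
    (σ.setReg r x).setReg r y = σ.setReg r y := by
  simp [NatState.setReg]

lemma eval_ne (a b : Expr) :
    (Expr.op .eq (.op .eq a b) (.const 0)).nat W σ ≠ 0 ↔ a.nat W σ ≠ b.nat W σ := by
  rw [eval_not, ← not_iff_not, ← Ne, eval_eq, not_ne_iff]

lemma eval_not_lt (a b : Expr) :
    (Expr.op .eq (.op .lt a b) (.const 0)).nat W σ ≠ 0 ↔ b.nat W σ ≤ a.nat W σ := by
  rw [eval_not, ← not_iff_not, ← Ne, eval_lt, not_le]

lemma eval_and (a b : Expr) (ha : a.nat W σ < W) (hb : b.nat W σ ≤ 1) :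
    (Expr.op .mul a b).nat W σ ≠ 0 ↔ a.nat W σ ≠ 0 ∧ b.nat W σ ≠ 0 := by
  have h : (Expr.op .mul a b).nat W σ = a.nat W σ * b.nat W σ % W := rfl
  rw [h, Nat.mod_eq_of_lt (lt_of_le_of_lt (Nat.mul_le_mul_left _ hb) (by omega)), Ne,
    Nat.mul_eq_zero, not_or]

lemma eval_lt_le_one (a b : Expr) : (Expr.op .lt a b).nat W σ ≤ 1 := by
  simp only [Expr.nat, Op.nat]
  split_ifs <;> omega

lemma eval_eq_le_one (a b : Expr) : (Expr.op .eq a b).nat W σ ≤ 1 := by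
  simp only [Expr.nat, Op.nat]
  split_ifs <;> omega

lemma Layout.store_conf (h : Layout e f C σ) (u x : Fin n) :
    Layout e (update f u x) C (σ.setMem (4 + 2 * m + u) x) := by
  refine ⟨h.reg4, h.reg5, h.reg6, fun i => ?_, fun i => ?_, fun v => ?_, fun v => ?_⟩
  · have := i.isLt
    rw [NatState.mem_setMem, if_neg (by omega), h.fst]
  · have := i.isLt
    rw [NatState.mem_setMem, if_neg (by omega), h.snd]
  · rw [NatState.mem_setMem, update_apply]
    by_cases hv : v = u
    · rw [if_pos (by rw [hv]), if_pos hv]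
    · rw [if_neg (fun h => hv (Fin.ext (by omega))), if_neg hv, h.conf]
  · have := u.isLt
    rw [NatState.mem_setMem, if_neg (by omega), h.count]

lemma Layout.store_count (h : Layout e f C σ) (u : Fin n) (x : ℕ) :
    Layout e f (update C u x) (σ.setMem (4 + 2 * m + n + u) x) := by
  refine ⟨h.reg4, h.reg5, h.reg6, fun i => ?_, fun i => ?_, fun v => ?_, fun v => ?_⟩
  · have := i.isLt
    rw [NatState.mem_setMem, if_neg (by omega), h.fst]
  · have := i.isLt
    rw [NatState.mem_setMem, if_neg (by omega), h.snd]
  · have := v.isLt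
    rw [NatState.mem_setMem, if_neg (by omega), h.conf]
  · rw [NatState.mem_setMem, update_apply]
    by_cases hv : v = u
    · rw [if_pos (by rw [hv]), if_pos hv]
    · rw [if_neg (fun h => hv (Fin.ext (by omega))), if_neg hv, h.count]

lemma findFree_spec (h : Layout e f C σ) (hW : 4 + 2 * m + n < W) {v : Fin n}
    (hv : IsLeastFree f v) :
    Ensures W findFree σ (2 * n + 3) fun σ' => σ' = σ.setReg 10 v := by
  have hvn := v.isLt
  unfold findFree
  refine Ensures.mono (Ensures.seq (Ensures.assign (Ensures.loop (t := 1) (k := v)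
    (fun k σ' => ∃ i, i + k = v ∧ σ' = σ.setReg 10 i) ?_ ?_))) (by omega) fun _ h => h
  · rintro k _ ⟨i, hik, rfl⟩
    have hlay : Layout e f C (σ.setReg 10 i) := h.setReg (by simp)
    have hval : (Expr.load (.op .add (.reg 6) (.reg 10))).nat W (σ.setReg 10 i) =
        f ⟨i, by omega⟩ := hlay.eval_conf hW (by simp)
    rw [eval_ne, hval]
    simp only [Expr.nat, NatState.regs_setReg, if_true]
    by_cases hi : i = v
    · left
      subst hi
      exact ⟨not_not.2 (congrArg Fin.val hv.1), rfl⟩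
    · right
      have hlt : i < v := by omega
      refine ⟨fun h => hv.2 ⟨i, by omega⟩ hlt (Fin.ext h), v - (i + 1), by omega, ?_⟩
      refine Ensures.assign ⟨i + 1, by omega, ?_⟩
      rw [eval_succ (x := i) (by simp) (by omega), NatState.setReg_setReg]
  · exact ⟨0, by simp, by simp [Expr.nat]⟩

/-- The state of `follow` after `k` steps along the orbit of `v`. -/
def FollowInv (f : Fin n → Fin n) (v : Fin n) (σ : NatState) (k : ℕ) (σ' : NatState) : Prop :=
  σ'.mem = σ.mem ∧ Frame [12, 15, 16, 17, 18] σ σ' ∧ σ'.regs 12 = k ∧ σ'.regs 15 = f^[k] v ∧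
    ∃ x y : Fin n, σ'.regs 17 = x ∧ σ'.regs 18 = y ∧ Hits f v x ∧ (∀ i ≤ k, x ≤ f^[i] v) ∧
      ((Hits f v y ∧ f y = x) ∨ (x = v ∧ ∀ i, 1 ≤ i → i ≤ k → v < f^[i] v)) ∧
      ∀ i, 1 ≤ i → i < k → f^[i] v ≠ v

lemma followBody_spec (h : Layout e f C σ) (hW : 4 + 2 * m + n < W) {v : Fin n} {k : ℕ}
    (hk : k < n) (hkv : k = 0 ∨ f^[k] v ≠ v) (hI : FollowInv f v σ k σ') :
    Ensures W followBody σ' 10 (FollowInv f v σ (k + 1)) := by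
  obtain ⟨h1, h2, h3, h4, x, y, h5, h6, h7, h8, h9, h10⟩ := hI
  have hlay := h.frame h1 h2 (by simp) (by simp) (by simp)
  have hnext : f (f^[k] v) = f^[k + 1] v := (iterate_succ_apply' f k v).symm
  have hno : ∀ i, 1 ≤ i → i < k + 1 → f^[i] v ≠ v := by
    intro i hi hik
    rcases Nat.lt_succ_iff_lt_or_eq.1 hik with hik | rfl
    · exact h10 i hi hik
    · exact hkv.resolve_left (by omega)
  unfold followBody
  refine Ensures.mono (Ensures.seq (t' := 8) (Ensures.assign (Ensures.seq (t' := 3)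
    (Ensures.ite (t := 3) (fun hlt => ?_) fun hlt => ?_)))) (by norm_num) fun _ h => h
  · rw [eval_lt, hlay.eval_conf hW h4] at hlt
    rw [hlay.eval_conf hW h4, hnext]
    simp only [Expr.nat, NatState.regs_setReg, hnext] at hlt
    simp only [Nat.reduceEqDiff, if_true, if_false, h5, Fin.val_fin_lt] at hlt
    refine Ensures.mono (Ensures.skip (Ensures.seq (Ensures.assign (Ensures.assign ?_))))
      (by norm_num) fun _ h => h
    refine ⟨h1, ?_, ?_, ?_, x, y, ?_, ?_, h7, ?_, ?_, hno⟩
    · exact ((h2.setReg (by simp)).setReg (by simp)).setReg (by simp)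
    · rw [eval_succ (x := k) (by simp [h3]) (by omega)]; simp
    · simp [Expr.nat]
    · simp [h5]
    · simp [h6]
    · intro i hi
      rcases Nat.le_succ_iff.1 hi with hi | rfl
      · exact h8 i hi
      · exact hlt.le
    · rcases h9 with h9 | ⟨rfl, h9⟩
      · exact Or.inl h9
      · refine Or.inr ⟨rfl, fun i hi hik => ?_⟩
        rcases Nat.le_succ_iff.1 hik with hik | rfl
        · exact h9 i hi hik
        · exact hlt
  · rw [eval_lt, hlay.eval_conf hW h4] at hlt
    rw [hlay.eval_conf hW h4, hnext]
    simp only [Expr.nat, NatState.regs_setReg, hnext] at hlt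
    simp only [Nat.reduceEqDiff, if_true, if_false, h5, Fin.val_fin_lt, not_lt] at hlt
    refine Ensures.mono (Ensures.seq (Ensures.assign (Ensures.assign (Ensures.seq
      (Ensures.assign (Ensures.assign ?_)))))) (by norm_num) fun _ h => h
    refine ⟨h1, ?_, ?_, ?_, f^[k + 1] v, f^[k] v, ?_, ?_, ⟨k + 1, rfl⟩, ?_,
      Or.inl ⟨⟨k, rfl⟩, hnext⟩, hno⟩
    · exact ((((h2.setReg (by simp)).setReg (by simp)).setReg (by simp)).setReg
        (by simp)).setReg (by simp)
    · rw [eval_succ (x := k) (by simp [h3]) (by omega)]; simp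
    · simp [Expr.nat]
    · simp [Expr.nat]
    · simp [Expr.nat, h4]
    · intro i hi
      rcases Nat.le_succ_iff.1 hi with hi | rfl
      · exact hlt.trans (h8 i hi)
      · exact le_rfl

/-- `follow` finds out whether `v` lies on a cycle, and if so, the least vertex of the cycle and its
predecessor. -/
lemma follow_spec (h : Layout e f C σ) (hW : 4 + 2 * m + n < W) {v : Fin n}
    (h10 : σ.regs 10 = v) :
    Ensures W follow σ (11 * n + 20) fun σ' => σ'.mem = σ.mem ∧
      Frame [12, 15, 16, 17, 18] σ σ' ∧ (σ'.regs 15 = v ↔ Cyc f v) ∧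
      (Cyc f v → ∃ x y : Fin n, σ'.regs 17 = x ∧ σ'.regs 18 = y ∧ Hits f v x ∧
        (∀ z, Hits f v z → x ≤ z) ∧ Hits f x y ∧ f y = x) := by
  have hn : 0 < n := Fin.pos v
  unfold follow
  refine Ensures.mono (Ensures.seq (Ensures.assign (Ensures.seq (Ensures.assign (Ensures.seq
    (Ensures.assign (Ensures.seq (Ensures.assign (Ensures.seq
    ((followBody_spec h hW (v := v) (k := 0) hn (Or.inl rfl) ?_).mono le_rfl
    fun σ' hσ' => Ensures.loop (t := 10) (k := n) (fun r σ' => ∃ k, 1 ≤ k ∧ k ≤ n ∧ n ≤ k + r ∧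
      FollowInv f v σ k σ') ?_ ⟨1, le_rfl, hn, by omega, hσ'⟩)))))))))) (by omega) fun _ h => h
  · refine ⟨rfl, ?_, ?_, ?_, v, v, ?_, ?_, Hits.refl f v, ?_, Or.inr ⟨rfl, ?_⟩, ?_⟩
    · exact ((((Frame.refl _ σ).setReg (by simp)).setReg (by simp)).setReg (by simp)).setReg
        (by simp)
    · simp [Expr.nat]
    · simp [Expr.nat, h10]
    · simp [Expr.nat, h10]
    · simp [Expr.nat, h10]
    · intro i hi
      obtain rfl : i = 0 := by omega
      exact le_rfl
    · intro i h1 h2; omega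
    · intro i h1 h2; omega
  · rintro r σ' ⟨k, hk1, hkn, hkr, hI⟩
    obtain ⟨g1, g2, g3, g4, x, y, g5, g6, g7, g8, g9, g11⟩ := id hI
    rw [eval_and _ _ (lt_of_le_of_lt (eval_eq_le_one _ _) (by omega)) (eval_lt_le_one _ _),
      eval_ne, eval_lt]
    simp only [Expr.nat, g3, g4, g2 10 (by simp), g2 4 (by simp), h10, h.reg4, Ne, Fin.val_inj]
    by_cases hguard : ¬ f^[k] v = v ∧ k < n
    · right
      refine ⟨hguard, r - 1, by omega, ?_⟩
      exact (followBody_spec h hW hguard.2 (Or.inr hguard.1) hI).mono le_rfl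
        fun σ'' hσ'' => ⟨k + 1, by omega, by omega, by omega, hσ''⟩
    · left
      have hiff : f^[k] v = v ↔ Cyc f v := by
        constructor
        · intro hkv
          exact cyc_iff_mem_periodicPts.2 (mk_mem_periodicPts (by omega) hkv)
        · intro hcyc
          by_contra hne
          have hkn' : k = n := by
            by_contra hlt
            exact hguard ⟨hne, by omega⟩
          have hpos := minimalPeriod_pos_of_mem_periodicPts (cyc_iff_mem_periodicPts.1 hcyc)
          have hle := (minimalPeriod_le_card (f := f) (x := v)).trans_eq (Fintype.card_fin n)
          have hper : f^[minimalPeriod f v] v = v := iterate_minimalPeriod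
          -- a return before step `k` has been excluded, so the period is `n = k`
          rcases hle.lt_or_eq with hlt | heq
          · exact g11 _ hpos (by omega) hper
          · exact hne ((congrArg (fun t => f^[t] v) (hkn'.trans heq.symm)).trans hper)
      refine ⟨hguard, g1, g2, hiff, fun hcyc => ⟨x, y, g5, g6, g7, ?_, ?_⟩⟩
      · rintro _ ⟨j, rfl⟩
        have hk : IsPeriodicPt f k v := hiff.2 hcyc
        rw [← hk.iterate_mod_apply j]
        exact g8 _ (Nat.mod_lt _ (by omega)).le
      · rcases g9 with ⟨g9, g10⟩ | ⟨-, g9⟩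
        · exact ⟨(hcyc.hits_symm g7).trans g9, g10⟩
        · exact absurd (g9 k hk1 le_rfl) (by rw [hiff.2 hcyc]; exact lt_irrefl v)

/-- Memory above the counts, where the output will be written. -/
def SameHigh (n m : ℕ) (σ σ' : NatState) : Prop :=
  ∀ a, 4 + 2 * m + 2 * n ≤ a → σ'.mem a = σ.mem a

lemma popCycle_spec (h : Layout e f C σ) (hW : 4 + 2 * m + n < W) {v : Fin n}
    (h15 : σ.regs 15 = v) (hcyc : Cyc f v) (hfv : f v ≠ v) :
    Ensures W popCycle σ (6 * n + 1) fun σ' => Layout e (pop f v) C σ' ∧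
      Frame [15, 16] σ σ' ∧ SameHigh n m σ σ' := by
  classical
  set P := minimalPeriod f v with hP
  have hPn : P ≤ n := (minimalPeriod_le_card (f := f) (x := v)).trans_eq (Fintype.card_fin n)
  have hper : f^[P] v = v := iterate_minimalPeriod
  have hPpos : 0 < P := minimalPeriod_pos_of_mem_periodicPts (cyc_iff_mem_periodicPts.1 hcyc)
  have hinj := iterate_injOn_Iio_minimalPeriod (f := f) (x := v)
  -- the configuration after `i` rounds
  set g : ℕ → Fin n → Fin n := fun i u => if ∃ j < i, f^[j] v = u then u else f u with hg
  have hgP : g P = pop f v := by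
    funext u
    have : (∃ j < P, f^[j] v = u) ↔ Hits f v u := by
      constructor
      · rintro ⟨j, -, hj⟩; exact ⟨j, hj⟩
      · rintro ⟨j, hj⟩
        exact ⟨j % P, Nat.mod_lt _ hPpos, by rw [iterate_mod_minimalPeriod_eq, hj]⟩
    simp only [hg, pop, this]
  have hg0 : g 0 = f := by
    funext u
    simp [hg]
  have hgs : ∀ i, g (i + 1) = update (g i) (f^[i] v) (f^[i] v) := by
    intro i
    funext u
    by_cases hu : u = f^[i] v
    · rw [hu, update_self]
      exact if_pos ⟨i, by omega, rfl⟩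
    · rw [update_of_ne hu]
      have : (∃ j < i + 1, f^[j] v = u) ↔ ∃ j < i, f^[j] v = u := by
        constructor
        · rintro ⟨j, hj, rfl⟩
          rcases Nat.lt_succ_iff_lt_or_eq.1 hj with hj | rfl
          · exact ⟨j, hj, rfl⟩
          · exact absurd rfl hu
        · rintro ⟨j, hj, rfl⟩; exact ⟨j, by omega, rfl⟩
      simp only [hg, this]
  have hgi : ∀ i < P, g i (f^[i] v) = f^[i + 1] v := by
    intro i hi
    rw [iterate_succ_apply']
    refine if_neg ?_
    rintro ⟨j, hj, hji⟩
    exact absurd (hinj (Set.mem_Iio.2 (hj.trans hi)) (Set.mem_Iio.2 hi) hji) hj.ne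
  unfold popCycle
  refine Ensures.mono (Ensures.loop (t := 5) (k := P) (fun r σ' => ∃ i, i + r = P ∧
    Layout e (g i) C σ' ∧ σ'.regs 15 = f^[i] v ∧ Frame [15, 16] σ σ' ∧ SameHigh n m σ σ')
    ?_ ⟨0, by omega, by rwa [hg0], h15, Frame.refl _ _, fun _ _ => rfl⟩) (by omega) fun _ h => h
  rintro r σ' ⟨i, hir, hlay, hcur, hfr, hhigh⟩
  rw [eval_ne, hlay.eval_conf hW hcur]
  simp only [Expr.nat, hcur, Ne, Fin.val_inj]
  by_cases hi : i = P
  · left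
    refine ⟨?_, hgP ▸ hi ▸ hlay, hfr, hhigh⟩
    rw [not_not, hi, hper]
    exact if_pos ⟨0, hPpos, rfl⟩
  · right
    have hiP : i < P := by omega
    rw [hgi i hiP]
    refine ⟨fun h => ?_, r - 1, by omega, ?_⟩
    · rw [iterate_succ_apply'] at h
      have hv : v = f^[i] v := (hcyc.hits_symm ⟨i, rfl⟩).eq_of_fixed h
      rw [← hv] at h
      exact hfv h
    · refine Ensures.mono (Ensures.seq (Ensures.assign (Ensures.seq (Ensures.store
        (Ensures.assign ?_))))) le_rfl fun _ h => h
      have hlay' : Layout e (g i) C (σ'.setReg 16 ((Expr.load (.op .add (.reg 6)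
        (.reg 15))).nat W σ')) := hlay.setReg (by simp)
      rw [hlay'.eval_addr hW (v := f^[i] v) (by simp [hcur]), hlay.eval_conf hW hcur, hgi i hiP]
      have hst := (hlay.setReg (r := 16) (x := f^[i + 1] v) (by simp)).store_conf (f^[i] v)
        (f^[i] v)
      simp only [Expr.nat, NatState.regs_setReg, NatState.regs_setMem, Nat.reduceEqDiff, if_false,
        if_true, hcur]
      refine ⟨i + 1, by omega, ?_, by simp, ?_, ?_⟩
      · rw [hgs i]
        exact hst.setReg (by simp)
      · exact ((hfr.setReg (by simp)).setMem).setReg (by simp)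
      · intro a ha
        have := (f^[i] v).isLt
        rw [NatState.mem_setReg, NatState.mem_setMem, if_neg (by omega)]
        exact hhigh a ha

lemma clear_spec (h : Layout e f C σ) (hW : 4 + 2 * m + n < W) :
    Ensures W clear σ (4 * n + 3) fun σ' => Layout e id C σ' ∧ Frame [12] σ σ' ∧
      SameHigh n m σ σ' := by
  -- the configuration after `i` rounds
  set g : ℕ → Fin n → Fin n := fun i u => if u.val < i then u else f u with hg
  have hgn : g n = id := by
    funext u
    simp [hg]
  have hg0 : g 0 = f := by
    funext u
    simp [hg]
  unfold clear
  refine Ensures.mono (Ensures.seq (Ensures.assign (Ensures.loop (t := 3) (k := n)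
    (fun r σ' => ∃ i, i + r = n ∧ Layout e (g i) C σ' ∧ σ'.regs 12 = i ∧ Frame [12] σ σ' ∧
      SameHigh n m σ σ') ?_ ⟨0, by omega, ?_, by simp [Expr.nat], (Frame.refl _ _).setReg (by simp),
      fun _ _ => rfl⟩))) (by omega) fun _ h => h
  · rintro r σ' ⟨i, hir, hlay, hcur, hfr, hhigh⟩
    rw [eval_lt]
    simp only [Expr.nat, hcur, hlay.reg4]
    by_cases hi : i < n
    · right
      refine ⟨hi, r - 1, by omega, Ensures.seq (Ensures.store (Ensures.assign ?_))⟩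
      rw [hlay.eval_addr hW (v := ⟨i, hi⟩) hcur, eval_succ (x := i) (by simp [hcur]) (by omega)]
      have hst := hlay.store_conf ⟨i, hi⟩ ⟨i, hi⟩
      have hval : (Expr.reg 12).nat W σ' = i := hcur
      rw [hval]
      refine ⟨i + 1, by omega, ?_, by simp, (hfr.setMem).setReg (by simp), ?_⟩
      · have : g (i + 1) = update (g i) ⟨i, hi⟩ ⟨i, hi⟩ := by
          funext u
          by_cases hu : u = ⟨i, hi⟩
          · rw [hu, update_self]; simp [hg]
          · have hu' : u.val ≠ i := fun h => hu (Fin.ext h)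
            rw [update_of_ne hu]
            have : u.val < i + 1 ↔ u.val < i := by omega
            simp only [hg, this]
        rw [this]
        exact hst.setReg (by simp)
      · intro a ha
        rw [NatState.mem_setReg, NatState.mem_setMem, if_neg (by dsimp only; omega)]
        exact hhigh a ha
    · left
      obtain rfl : i = n := by omega
      exact ⟨hi, hgn ▸ hlay, hfr, hhigh⟩
  · rw [hg0]; exact h.setReg (by simp)

end Orbit

end WordRAM

/-! ### Correctness of a draw -/

namespace WordRAM

open Function FunGraph

section Draw

variable {n m : ℕ} {e : Fin m → Fin n × Fin n} {f : Fin n → Fin n} {C : Fin n → ℕ}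
  {σ σ' : NatState} {W : ℕ}

/-- The machine state `σ` stands for the state `a` of the sampling process, with `d` draws left, of
a computation with `s` runs. The memory above the counts is still empty. -/
structure Represents (e : Fin m → Fin n × Fin n) (s d : ℕ) (a : Sim n) (σ : NatState) : Prop where
  layout : Layout e a.conf a.counts σ
  stage : σ.regs 7 = a.stage
  runs : σ.regs 8 = a.runs
  fuel : σ.regs 9 = d
  total : σ.regs 19 = s
  high : ∀ b, 4 + 2 * m + 2 * n ≤ b → σ.mem b = 0

lemma beforeDraw_spec (h : Layout e f C σ) (hW : 6 + 2 * m + 2 * n < W) {v : Fin n}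
    (hv : IsLeastFree f v) :
    Ensures W beforeDraw σ (11 * m + 2 * n + 11) fun σ' => σ'.mem = σ.mem ∧
      Frame [10, 11, 12, 13, 14, 23] σ σ' ∧ σ'.regs 10 = v ∧
      σ'.regs 13 = (nbrList e v m).length := by
  unfold beforeDraw
  refine Ensures.mono (Ensures.seq ((findFree_spec h (by omega) hv).mono le_rfl fun σ' hσ' =>
    Ensures.seq (Ensures.assign ?_))) (t := 2 * n + 3 + (1 + (11 * m + 5) + 1) + 1) (by omega)
    fun _ h => h
  subst hσ'
  have hlay : Layout e f C (((σ.setReg 10 v)).setReg 14 ((Expr.const 0).nat W (σ.setReg 10 v))) :=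
    (h.setReg (by simp)).setReg (by simp)
  refine (scan_spec hlay (by omega) (v := v) (by simp)).mono le_rfl ?_
  rintro σ' ⟨h1, h2, h3, -⟩
  refine ⟨h1, ?_, by rw [h2 10 (by simp)]; simp, h3⟩
  exact (((Frame.refl _ σ).setReg (by simp)).setReg (by simp)).trans h2 (by simp)

/-- The counts after a draw for `v`. -/
def countDraw (C : Fin n → ℕ) (stage : ℕ) (v : Fin n) : Fin n → ℕ :=
  if v.val = stage then update C v (C v + 1) else C

open Classical in
lemma next_eq (a : Sim n) (v w : Fin n) :
    a.next v w = if BadThru (update a.conf v w) v then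
      ⟨pop (update a.conf v w) v, a.stage, a.runs, countDraw a.counts a.stage v⟩
      else if v.val = a.stage then
        if a.stage + 1 = n then ⟨id, 0, a.runs - 1, countDraw a.counts a.stage v⟩
        else ⟨update a.conf v w, a.stage + 1, a.runs, countDraw a.counts a.stage v⟩
      else ⟨update a.conf v w, a.stage, a.runs, countDraw a.counts a.stage v⟩ := rfl

/-- The first half of `afterDraw`: read the drawn neighbour and count the draw. -/
lemma countDraw_spec (h : Layout e f C σ) (hW : 6 + 2 * m + 2 * n < W) {v w : Fin n} {st : ℕ}
    (h10 : σ.regs 10 = v) (h7 : σ.regs 7 = st) (hC : C v + 1 < W)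
    (hw : (nbrList e v m)[σ.regs 14]? = some w) {c : Cmd} {t : ℕ} {Q : NatState → Prop}
    (hc : ∀ σ', Layout e (update f v w) (countDraw C st v) σ' →
      Frame [11, 12, 13, 23] σ σ' → SameHigh n m σ σ' → Ensures W c σ' t Q) :
    Ensures W (.seq scan
      (.seq (.ite (.op .eq (.reg 10) (.reg 7))
        (.store (.op .add (.op .add (.reg 6) (.reg 4)) (.reg 10))
          (.op .add (.load (.op .add (.op .add (.reg 6) (.reg 4)) (.reg 10))) (.const 1)))
        .skip)
      (.seq (.store (.op .add (.reg 6) (.reg 10)) (.reg 11)) c))) σ (11 * m + t + 11) Q := by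
  have hvn := v.isLt
  refine Ensures.mono (Ensures.seq ((scan_spec h (by omega) h10).mono le_rfl ?_))
    (t := 11 * m + 5 + (2 + (1 + t + 1) + 1) + 1) (by omega) fun _ h => h
  rintro σ1 ⟨h1, h2, -, h3⟩
  rw [hw] at h3
  have g10 : σ1.regs 10 = v := by rw [h2 10 (by simp), h10]
  have g7 : σ1.regs 7 = st := by rw [h2 7 (by simp), h7]
  have hlay : Layout e f C σ1 := h.frame h1 h2 (by simp) (by simp) (by simp)
  have hhigh1 : SameHigh n m σ σ1 := fun a _ => by rw [h1]
  have last : ∀ σ2, Layout e f (countDraw C st v) σ2 → Frame [] σ1 σ2 → SameHigh n m σ σ2 →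
      Ensures W (.seq (.store (.op .add (.reg 6) (.reg 10)) (.reg 11)) c) σ2 (1 + t + 1) Q := by
    intro σ2 l2 f2 s2
    refine Ensures.seq (Ensures.store ?_)
    have g10' : σ2.regs 10 = v := by rw [f2 10 (by simp), g10]
    have g11' : (Expr.reg 11).nat W σ2 = w := by
      rw [Expr.nat, f2 11 (by simp), h3]; rfl
    rw [l2.eval_addr (by omega) g10', g11']
    refine hc _ (l2.store_conf v w) (h2.trans f2 (by simp)) fun a ha => ?_
    rw [NatState.mem_setMem, if_neg (by omega), s2 a ha]
  refine Ensures.seq (Ensures.ite (t := 1) (fun heq => Ensures.store ?_)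
    fun heq => Ensures.skip ?_)
  · rw [eval_eq] at heq
    simp only [Expr.nat, g10, g7] at heq
    have haddr : (Expr.op .add (.op .add (.reg 6) (.reg 4)) (.reg 10)).nat W σ1 =
        4 + 2 * m + n + v := by
      simp only [Expr.nat, Op.nat, g10, hlay.reg6, hlay.reg4]
      rw [Nat.mod_eq_of_lt (a := 4 + 2 * m + n) (by omega), Nat.mod_eq_of_lt (by omega)]
    have hval : (Expr.op .add (.load (.op .add (.op .add (.reg 6) (.reg 4)) (.reg 10)))
        (.const 1)).nat W σ1 = C v + 1 := by
      simp only [Expr.nat, Op.nat] at haddr ⊢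
      rw [haddr, hlay.count, Nat.mod_eq_of_lt (a := 1) (by omega), Nat.mod_eq_of_lt hC]
    rw [haddr, hval]
    refine last _ ?_ (Frame.refl _ _) fun a ha => ?_
    · rw [countDraw, if_pos heq]
      exact hlay.store_count v _
    · rw [NatState.mem_setMem, if_neg (by omega), hhigh1 a ha]
  · rw [eval_eq] at heq
    simp only [Expr.nat, g10, g7] at heq
    refine last _ ?_ (Frame.refl _ _) hhigh1
    rw [countDraw, if_neg heq]
    exact hlay

/-- After the choice of a neighbour, the machine performs one step of the sampling process. -/
lemma afterDraw_spec {s d : ℕ} {a : Sim n} (h : Represents e s (d + 1) a σ)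
    (hW : 6 + 2 * m + 2 * n < W) (hd : d + 1 < W) (hr : a.runs ≠ 0) (hrW : a.runs < W)
    {v w : Fin n} (h10 : σ.regs 10 = v)
    (hC : a.counts v + 1 < W)
    (hw : (nbrList e v m)[σ.regs 14]? = some w) (hwv : w ≠ v) :
    Ensures W afterDraw σ (11 * m + 17 * n + 50) (Represents e s d (a.next v w)) := by
  classical
  unfold afterDraw
  refine Ensures.mono (countDraw_spec h.layout hW h10 h.stage hC hw
    (t := 11 * n + 20 + (6 * n + 15 + 1 + 1 + 1) + 1) ?_) (by omega) fun _ h => h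
  intro σ1 l1 f1 s1
  have g10 : σ1.regs 10 = v := by rw [f1 10 (by simp), h10]
  refine Ensures.seq ((follow_spec l1 (by omega) g10).mono le_rfl ?_)
  rintro σ2 ⟨h1, h2, h3, h4⟩
  have l2 : Layout e (update a.conf v w) (countDraw a.counts a.stage v) σ2 :=
    l1.frame h1 h2 (by simp) (by simp) (by simp)
  have f2 : Frame [11, 12, 13, 15, 16, 17, 18, 23] σ σ2 := fun r hr' => by
    simp only [List.mem_cons, List.not_mem_nil, or_false, not_or] at hr'
    rw [h2 r (by simp [hr']), f1 r (by simp [hr'])]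
  have s2 : SameHigh n m σ σ2 := fun b hb => by rw [h1, s1 b hb]
  set f := update a.conf v w with hf
  have hfv : f v ≠ v := by rw [hf, update_self]; exact hwv
  have k10 : σ2.regs 10 = v := by rw [f2 10 (by simp), h10]
  have k7 : σ2.regs 7 = a.stage := by rw [f2 7 (by simp), h.stage]
  have k8 : σ2.regs 8 = a.runs := by rw [f2 8 (by simp), h.runs]
  have hnext := next_eq a v w
  rw [← hf] at hnext
  have done : ∀ (b : Sim n) (σ3 : NatState), Layout e b.conf b.counts σ3 →
      σ3.regs 7 = b.stage → σ3.regs 8 = b.runs → σ3.regs 9 = d + 1 → σ3.regs 19 = s →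
      SameHigh n m σ σ3 →
      Ensures W (.assign 9 (.op .sub (.reg 9) (.const 1))) σ3 1 (Represents e s d b) := by
    intro b σ3 b1 b2 b3 b4 b5 b6
    have hval : (Expr.op .sub (.reg 9) (.const 1)).nat W σ3 = d := by
      simp only [Expr.nat, Op.nat, b4]
      rw [Nat.mod_eq_of_lt (a := 1) (by omega), show W - 1 + (d + 1) = d + W by omega,
        Nat.add_mod_right, Nat.mod_eq_of_lt (by omega)]
    refine Ensures.assign ?_
    rw [hval]
    exact ⟨b1.setReg (by simp), by simp [b2], by simp [b3], by simp, by simp [b5],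
      fun c hc => (b6 c hc).trans (h.high c hc)⟩
  have k9 : σ2.regs 9 = d + 1 := by rw [f2 9 (by simp), h.fuel]
  have k19 : σ2.regs 19 = s := by rw [f2 19 (by simp), h.total]
  have hguard : (Expr.op .mul (.op .eq (.reg 15) (.reg 10))
      (.op .eq (.op .lt (.load (.op .add (.reg 6) (.reg 17))) (.reg 18)) (.const 0))).nat W σ2 ≠ 0 ↔
      BadThru f v := by
    rw [eval_and _ _ (lt_of_le_of_lt (eval_eq_le_one _ _) (by omega)) (eval_eq_le_one _ _),
      eval_eq, eval_not_lt, Expr.nat, Expr.nat, Expr.nat, k10, h3]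
    refine ⟨fun ⟨hcyc, hlt⟩ => ?_, fun hbad => ⟨hbad.cyc, ?_⟩⟩
    · obtain ⟨x, y, x1, x2, x3, x4, x5, x6⟩ := h4 hcyc
      have hfx : f x ≠ x := fun hx => hfv (by
        rwa [← (hcyc.hits_symm x3).eq_of_fixed hx] at hx)
      rw [l2.eval_conf (by omega) x1, x2, Fin.val_fin_le] at hlt
      exact (badThru_iff hcyc x3 hfx x4 x5 x6).2 hlt
    · have hcyc := hbad.cyc
      obtain ⟨x, y, x1, x2, x3, x4, x5, x6⟩ := h4 hcyc
      have hfx : f x ≠ x := fun hx => hfv (by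
        rwa [← (hcyc.hits_symm x3).eq_of_fixed hx] at hx)
      rw [l2.eval_conf (by omega) x1, x2, Fin.val_fin_le]
      exact (badThru_iff hcyc x3 hfx x4 x5 x6).1 hbad
  refine Ensures.seq (t := 6 * n + 15 + 1) (t' := 1) (Ensures.ite (fun hbad => ?_) fun hbad => ?_)
  · rw [hguard] at hbad
    have hcyc := hbad.cyc
    refine (popCycle_spec l2 (by omega) (h3.2 hcyc) hcyc hfv).mono (by omega) ?_
    rintro σ3 ⟨l3, f3, s3⟩
    rw [hnext, if_pos hbad]
    refine done _ σ3 l3 ?_ ?_ ?_ ?_ fun b hb => (s3 b hb).trans (s2 b hb)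
    · rw [f3 7 (by simp), k7]
    · rw [f3 8 (by simp), k8]
    · rw [f3 9 (by simp), k9]
    · rw [f3 19 (by simp), k19]
  · rw [hguard] at hbad
    rw [hnext, if_neg hbad]
    refine Ensures.mono (Ensures.ite (t := 6 * n + 14) (fun heq => ?_) fun heq => ?_) le_rfl
      fun _ h => h
    · rw [eval_eq] at heq
      simp only [Expr.nat, k10, k7] at heq
      rw [if_pos heq]
      refine Ensures.mono (Ensures.seq (Ensures.assign (Ensures.ite (t := 1 + (1 + (4 * n + 3) + 1)
        + 1) (fun heq' => ?_) fun heq' => ?_))) (by omega) fun _ h => h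
      · rw [eval_succ k7 (by omega)] at heq' ⊢
        rw [eval_eq] at heq'
        simp only [Expr.nat, NatState.regs_setReg, if_true, Nat.reduceEqDiff, if_false,
          l2.reg4] at heq'
        rw [if_pos heq']
        refine Ensures.seq (Ensures.assign (Ensures.seq (Ensures.assign ?_)))
        have hval : (Expr.op .sub (.reg 8) (.const 1)).nat W (σ2.setReg 7 (a.stage + 1)) =
            a.runs - 1 := by
          simp only [Expr.nat, Op.nat, NatState.regs_setReg, Nat.reduceEqDiff, if_false, k8]
          rw [Nat.mod_eq_of_lt (a := 1) (by omega), show W - 1 + a.runs = (a.runs - 1) + W by omega,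
            Nat.add_mod_right, Nat.mod_eq_of_lt (by omega)]
        rw [hval]
        have l3 := (((l2.setReg (r := 7) (x := a.stage + 1) (by simp)).setReg (r := 8)
          (x := a.runs - 1) (by simp)).setReg (r := 7) (x := (Expr.const 0).nat W
          ((σ2.setReg 7 (a.stage + 1)).setReg 8 (a.runs - 1))) (by simp))
        refine (clear_spec l3 (by omega)).mono le_rfl ?_
        rintro σ3 ⟨l4, f4, s4⟩
        refine done _ σ3 l4 ?_ ?_ ?_ ?_ fun b hb => (s4 b hb).trans (s2 b hb)
        · rw [f4 7 (by simp)]; simp [Expr.nat]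
        · rw [f4 8 (by simp)]; simp
        · rw [f4 9 (by simp)]; simp [k9]
        · rw [f4 19 (by simp)]; simp [k19]
      · rw [eval_succ k7 (by omega)] at heq' ⊢
        rw [eval_eq] at heq'
        simp only [Expr.nat, NatState.regs_setReg, if_true, Nat.reduceEqDiff, if_false,
          l2.reg4] at heq'
        rw [if_neg heq']
        refine Ensures.mono (Ensures.skip ?_) (t := 1) (by omega) fun _ h => h
        exact done _ _ (l2.setReg (by simp)) (by simp) (by simp [k8]) (by simp [k9])
          (by simp [k19]) s2
    · rw [eval_eq] at heq
      simp only [Expr.nat, k10, k7] at heq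
      rw [if_neg heq]
      exact Ensures.mono (Ensures.skip (done ⟨f, a.stage, a.runs, _⟩ _ l2 k7 k8 k9 k19 s2))
        (by omega) fun _ h => h

end Draw

end WordRAM

/-! ### Products of many words and the output -/

namespace WordRAM

open Function FunGraph

section BigNumbers

variable {n m : ℕ} {e : Fin m → Fin n × Fin n} {f : Fin n → Fin n} {C : Fin n → ℕ}
  {σ σ' : NatState} {W : ℕ}

/-- The number with `k` digits in base `W` at the address `a`. -/
def bigVal (W : ℕ) (σ : NatState) (a k : ℕ) : ℕ := ∑ j ∈ Finset.range k, σ.mem (a + j) * W ^ j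

lemma bigVal_succ (a k : ℕ) : bigVal W σ a (k + 1) = bigVal W σ a k + σ.mem (a + k) * W ^ k :=
  Finset.sum_range_succ _ _

lemma bigVal_congr {a k : ℕ} (h : ∀ j < k, σ'.mem (a + j) = σ.mem (a + j)) :
    bigVal W σ' a k = bigVal W σ a k :=
  Finset.sum_congr rfl fun j hj => by rw [h j (Finset.mem_range.1 hj)]

/-- The memory outside the `n + 1` cells from address `a` on is unchanged. -/
def SameOutside (n a : ℕ) (σ σ' : NatState) : Prop :=
  ∀ b, b < a ∨ a + n < b → σ'.mem b = σ.mem b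

/-- One digit of a multiplication: `d` is the digit, `x` the factor, `c` the carry. -/
lemma mul_add_carry {d x c : ℕ} (hW : 1 < W) (hd : d < W) (hx : x < W) (hc : c < W) :
    (d * x % W + c) % W + (d * x / W + if (d * x % W + c) % W < c then 1 else 0) * W = d * x + c ∧
      (d * x / W + if (d * x % W + c) % W < c then 1 else 0) < W := by
  have hlo : d * x % W < W := Nat.mod_lt _ (by omega)
  have hdiv := Nat.mod_add_div (d * x) W
  have hhi : d * x / W + 1 < W := by
    have : d * x / W < W - 1 := by
      refine Nat.div_lt_of_lt_mul ?_
      have h1 : d * x ≤ (W - 1) * (W - 1) := Nat.mul_le_mul (by omega) (by omega)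
      have h3 : (W - 1) * (W - 1) < W * (W - 1) :=
        Nat.mul_lt_mul_of_pos_right (by omega) (by omega)
      omega
    omega
  rw [Nat.mul_comm] at hdiv
  by_cases h : d * x % W + c < W
  · rw [Nat.mod_eq_of_lt h, if_neg (by omega), Nat.add_zero]
    refine ⟨?_, by omega⟩
    rw [Nat.mul_comm] at hdiv
    rw [Nat.mul_comm (d * x / W)]
    omega
  · have : (d * x % W + c) % W = d * x % W + c - W := by
      rw [Nat.mod_eq_sub_mod (by omega), Nat.mod_eq_of_lt (by omega)]
    rw [this, if_pos (by omega)]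
    refine ⟨?_, hhi⟩
    rw [Nat.mul_comm] at hdiv
    rw [Nat.mul_comm (d * x / W + 1), Nat.mul_add]
    omega

/-- One round of `bigMul`; the test `sum < carry` in the program detects the overflow of the
addition. -/
lemma bigMulBody_spec {a i x c d : ℕ} (hW : a + i + 1 < W) (h20 : σ.regs 20 = a)
    (h12 : σ.regs 12 = i) (h21 : σ.regs 21 = x) (h22 : σ.regs 22 = c) (hd : σ.mem (a + i) = d)
    (hdW : d < W) (hxW : x < W) (hcW : c < W) :
    Ensures W bigMulBody σ 9 fun σ' => Frame [12, 22, 23, 24] σ σ' ∧ σ'.regs 12 = i + 1 ∧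
      (∀ b, b ≠ a + i → σ'.mem b = σ.mem b) ∧ σ'.mem (a + i) < W ∧ σ'.regs 22 < W ∧
      σ'.mem (a + i) + σ'.regs 22 * W = d * x + c := by
  obtain ⟨h1, h2⟩ := mul_add_carry (by omega) hdW hxW hcW
  unfold bigMulBody
  refine Ensures.mono (Ensures.seq (Ensures.assign (Ensures.seq (Ensures.assign (Ensures.seq
    (Ensures.store (Ensures.seq (Ensures.assign (Ensures.assign ?_)))))))))
    (by norm_num) fun _ h => h
  have ha : (a + i) % W = a + i := Nat.mod_eq_of_lt (by omega)
  simp only [Expr.nat, Op.nat, NatState.regs_setReg, NatState.mem_setReg, NatState.regs_setMem,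
    NatState.mem_setMem, Nat.reduceEqDiff, if_true, if_false, h20, h12, h21, h22, ha, hd]
  refine ⟨?_, ?_, fun b hb => if_neg hb, ?_, ?_, ?_⟩
  · exact ((((((Frame.refl _ σ).setReg (by simp)).setReg (by simp)).setMem).setReg
      (by simp)).setReg (by simp))
  · rw [Nat.mod_eq_of_lt (a := 1) (by omega), Nat.mod_eq_of_lt (by omega)]
  · exact Nat.mod_lt _ (by omega)
  · exact Nat.mod_lt _ (by omega)
  · rw [Nat.mod_eq_of_lt h2, h1]

lemma bigMul_spec {a x : ℕ} (hW : a + n + 2 < W) (h4 : σ.regs 4 = n) (h20 : σ.regs 20 = a)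
    (h21 : σ.regs 21 = x) (hx : x < W) (hdig : ∀ j ≤ n, σ.mem (a + j) < W)
    (hval : x * bigVal W σ a (n + 1) < W ^ (n + 1)) :
    Ensures W bigMul σ (10 * n + 20) fun σ' => Frame [12, 22, 23, 24] σ σ' ∧
      SameOutside n a σ σ' ∧ (∀ j ≤ n, σ'.mem (a + j) < W) ∧
      bigVal W σ' a (n + 1) = x * bigVal W σ a (n + 1) := by
  unfold bigMul
  refine Ensures.mono (Ensures.seq (Ensures.assign (Ensures.seq (Ensures.assign
    (Ensures.loop (t := 9) (k := n + 1) (fun r σ' => ∃ i, i + r = n + 1 ∧ σ'.regs 12 = i ∧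
      Frame [12, 22, 23, 24] σ σ' ∧ (∀ b, b < a ∨ a + i ≤ b → σ'.mem b = σ.mem b) ∧
      (∀ j < i, σ'.mem (a + j) < W) ∧ σ'.regs 22 < W ∧
      bigVal W σ' a i + σ'.regs 22 * W ^ i = x * bigVal W σ a i) ?_ ?_)))))
      (by omega) fun _ h => h
  · rintro r σ' ⟨i, hir, h12, hfr, hmem, hdig', hc, hI⟩
    have k4 : σ'.regs 4 = n := by rw [hfr 4 (by simp), h4]
    rw [eval_lt, eval_succ k4 (by omega), Expr.nat, h12]
    by_cases hi : i < n + 1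
    · right
      refine ⟨hi, r - 1, by omega, ?_⟩
      refine (bigMulBody_spec (a := a) (x := x) (by omega) (by rw [hfr 20 (by simp), h20]) h12
        (by rw [hfr 21 (by simp), h21]) rfl (hmem (a + i) (by omega)) (hdig i (by omega)) hx
        hc).mono le_rfl ?_
      rintro σ2 ⟨f2, g12, m2, d2, c2, v2⟩
      refine ⟨i + 1, by omega, g12, hfr.trans f2 (by simp), ?_, ?_, c2, ?_⟩
      · intro b hb
        rw [m2 b (by omega), hmem b (by omega)]
      · intro j hj
        rcases Nat.lt_succ_iff_lt_or_eq.1 hj with hj | rfl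
        · rw [m2 _ (by omega)]; exact hdig' j hj
        · exact d2
      · rw [bigVal_succ, bigVal_succ, bigVal_congr fun j hj => m2 (a + j) (by omega), mul_add, ← hI,
          pow_succ]
        linear_combination W ^ i * v2
    · left
      obtain rfl : i = n + 1 := by omega
      -- the product fits into `n + 1` digits, so the last carry vanishes
      have hc0 : σ'.regs 22 = 0 := by
        by_contra hne
        have : W ^ (n + 1) ≤ σ'.regs 22 * W ^ (n + 1) := Nat.le_mul_of_pos_left _ (by omega)
        omega
      rw [hc0, zero_mul, add_zero] at hI
      exact ⟨hi, hfr, fun b hb => hmem b (by omega), fun j hj => hdig' j (by omega), hI⟩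
  · refine ⟨0, by omega, by simp [Expr.nat], ((Frame.refl _ σ).setReg (by simp)).setReg (by simp),
      fun b _ => rfl, fun j hj => by omega, ?_, ?_⟩
    · simp [Expr.nat]; omega
    · simp [Expr.nat, bigVal]

/-- The registers that change in a computation of a product. -/
def prodRegs : List ℕ := [10, 11, 12, 13, 21, 22, 23, 24]

/-- The partial products stay below `W ^ n`, so `n + 1` digits are enough. -/
lemma bigProd_spec {a t : ℕ} {F : Fin n → ℕ} {c : Cmd} (hW : a + n + 2 < W) (h4 : σ.regs 4 = n)
    (h20 : σ.regs 20 = a) (hzero : ∀ j ≤ n, σ.mem (a + j) = 0) (hF : ∀ v, F v < W)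
    (hc : ∀ (σ' : NatState) (v : Fin n), Frame prodRegs σ σ' → SameOutside n a σ σ' →
      σ'.regs 10 = v → Ensures W c σ' t fun σ'' => σ''.mem = σ'.mem ∧
        Frame [11, 12, 13, 21, 23] σ' σ'' ∧ σ''.regs 21 = F v) :
    Ensures W (bigProd c) σ (n * (t + 10 * n + 24) + 5) fun σ' => Frame prodRegs σ σ' ∧
      SameOutside n a σ σ' ∧ (∀ j ≤ n, σ'.mem (a + j) < W) ∧
      bigVal W σ' a (n + 1) = ∏ v, F v := by
  set F' : ℕ → ℕ := fun i => if h : i < n then F ⟨i, h⟩ else 1 with hF'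
  have hprod : ∏ v, F v = ∏ i ∈ Finset.range n, F' i := by
    rw [Finset.prod_range]
    exact Finset.prod_congr rfl fun v _ => by simp [hF']
  have hF'W : ∀ i, F' i ≤ W := by
    intro i
    simp only [hF']
    split_ifs
    · exact (hF _).le
    · omega
  unfold bigProd
  refine Ensures.mono (Ensures.seq (Ensures.store (Ensures.seq (Ensures.assign
    (Ensures.loop (t := t + (10 * n + 20 + 1 + 1) + 1) (k := n) (fun r σ' => ∃ i, i + r = n ∧
      σ'.regs 10 = i ∧
      Frame prodRegs σ σ' ∧ SameOutside n a σ σ' ∧ (∀ j ≤ n, σ'.mem (a + j) < W) ∧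
      bigVal W σ' a (n + 1) = ∏ u ∈ Finset.range i, F' u) ?_ ?_)))))
      (by ring_nf; omega) fun _ h => h
  · rintro r σ' ⟨i, hir, h10, hfr, hout, hdig, hI⟩
    have k4 : σ'.regs 4 = n := by rw [hfr 4 (by simp [prodRegs]), h4]
    rw [eval_lt, Expr.nat, Expr.nat, h10, k4]
    by_cases hi : i < n
    · right
      refine ⟨hi, r - 1, by omega, Ensures.seq ((hc σ' ⟨i, hi⟩ hfr hout h10).mono le_rfl ?_)⟩
      rintro σ2 ⟨m2, f2, g21⟩
      have hfr2 : Frame prodRegs σ σ2 := hfr.trans f2 (by simp [prodRegs])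
      have hFi : F' i = F ⟨i, hi⟩ := dif_pos hi
      refine Ensures.seq (t := 10 * n + 20) (t' := 1) ((bigMul_spec (x := F' i) hW
        (by rw [f2 4 (by simp), k4])
        (by rw [hfr2 20 (by simp [prodRegs]), h20]) (by rw [g21, hFi]) (hFi ▸ hF _)
        (by rwa [m2]) ?_).mono le_rfl ?_)
      · rw [bigVal_congr (σ := σ') fun j _ => by rw [m2], hI, mul_comm, ← Finset.prod_range_succ]
        calc ∏ u ∈ Finset.range (i + 1), F' u ≤ ∏ u ∈ Finset.range (i + 1), W :=
              Finset.prod_le_prod' fun u _ => hF'W u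
          _ = W ^ (i + 1) := by simp
          _ < W ^ (n + 1) := Nat.pow_lt_pow_right (by omega) (by omega)
      · rintro σ3 ⟨f3, o3, d3, v3⟩
        have k10 : σ3.regs 10 = i := by rw [f3 10 (by simp), f2 10 (by simp), h10]
        refine Ensures.assign ⟨i + 1, by omega, ?_, ?_, ?_, d3, ?_⟩
        · rw [eval_succ k10 (by omega)]; simp
        · exact (hfr2.trans f3 (by simp [prodRegs])).setReg (by simp [prodRegs])
        · intro b hb
          rw [NatState.mem_setReg, o3 b hb, m2, hout b hb]
        · refine (bigVal_congr fun _ _ => rfl).trans (v3.trans ?_)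
          rw [bigVal_congr (σ := σ') fun j _ => by rw [m2], hI, mul_comm, Finset.prod_range_succ]
    · left
      obtain rfl : i = n := by omega
      exact ⟨hi, hfr, hout, hdig, hI.trans hprod.symm⟩
  · have h1 : (Expr.const 1).nat W σ = 1 := Nat.mod_eq_of_lt (by omega)
    have h2 : (Expr.reg 20).nat W σ = a := h20
    rw [h1, h2]
    refine ⟨0, by omega, by simp [Expr.nat], ((Frame.refl _ σ).setMem).setReg (by simp [prodRegs]),
      ?_, ?_, ?_⟩
    · intro b hb
      rw [NatState.mem_setReg, NatState.mem_setMem, if_neg (by omega)]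
    · intro j hj
      rw [NatState.mem_setReg, NatState.mem_setMem]
      split_ifs
      · omega
      · rw [hzero j hj]; omega
    · rw [bigVal, Finset.sum_range_succ', Finset.sum_eq_zero]
      · simp
      · intro j hj
        rw [NatState.mem_setReg, NatState.mem_setMem, if_neg (by omega),
          hzero _ (Finset.mem_range.1 hj), zero_mul]

/-- The second half of `finish`: the address `a` of the numerator is in register 20. -/
lemma finish_denominator_spec {a b : ℕ} (hb : b = 4 + 2 * m + 3 * n + 1)
    (hW : 8 + 2 * m + 4 * n < W) (k4 : σ.regs 4 = n) (k6 : σ.regs 6 = 4 + 2 * m)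
    (k20 : σ.regs 20 = a) (hzero : ∀ j ≤ n, σ.mem (b + j) = 0) (hC : ∀ v, C v < W)
    (hcount : ∀ v : Fin n, σ.mem (4 + 2 * m + n + v) = C v) :
    Ensures W (.seq (.assign 0 (.reg 20)) (.seq (.assign 1 (.op .add (.reg 4) (.const 1)))
        (.seq (.assign 20 (.op .add (.op .add (.reg 6) (.op .mul (.const 3) (.reg 4))) (.const 1)))
          (.seq (bigProd (.assign 21
              (.load (.op .add (.op .add (.reg 6) (.reg 4)) (.reg 10)))))
            (.seq (.assign 2 (.reg 20)) (.assign 3 (.op .add (.reg 4) (.const 1))))))))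
      σ (n * (10 * n + 25) + 15) fun σ' => SameOutside n b σ σ' ∧
        σ'.regs 0 = a ∧ σ'.regs 1 = n + 1 ∧ σ'.regs 2 = b ∧ σ'.regs 3 = n + 1 ∧
        (∀ j ≤ n, σ'.mem (b + j) < W) ∧ bigVal W σ' b (n + 1) = ∏ v, C v := by
  obtain ⟨T, hT⟩ : ∃ T, T = n * (1 + 10 * n + 24) + 5 := ⟨_, rfl⟩
  refine Ensures.mono (Ensures.seq (t := 1) (Ensures.assign (Ensures.seq (t := 1) (Ensures.assign
    (Ensures.seq (t := 1) (Ensures.assign (Ensures.seq (t := T) (t' := 3) ?_)))))))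
    (t := 1 + (1 + (1 + (T + 3 + 1) + 1) + 1) + 1)
    (by rw [hT, show n * (1 + 10 * n + 24) = n * (10 * n + 25) by ring]; omega) fun _ h => h
  rw [show (Expr.reg 20).nat W σ = a from k20,
    eval_succ (r := 4) (x := n) (by simp [k4]) (by omega)]
  have eb : (Expr.op .add (.op .add (.reg 6) (.op .mul (.const 3) (.reg 4))) (.const 1)).nat W
      ((σ.setReg 0 a).setReg 1 (n + 1)) = b := by
    simp only [Expr.nat, Op.nat, NatState.regs_setReg, if_false, k4, k6,
      OfNat.ofNat_ne_zero, OfNat.ofNat_ne_one]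
    rw [Nat.mod_eq_of_lt (a := 3) (by omega), Nat.mod_eq_of_lt (a := 3 * n) (by omega),
      Nat.mod_eq_of_lt (a := 1) (by omega), Nat.mod_eq_of_lt (a := 4 + 2 * m + 3 * n) (by omega),
      Nat.mod_eq_of_lt (by omega), hb]
  rw [eb]
  obtain ⟨σ2, hσ2⟩ : ∃ σ2, σ2 = ((σ.setReg 0 a).setReg 1 (n + 1)).setReg 20 b := ⟨_, rfl⟩
  have m2 : ∀ c, σ2.mem c = σ.mem c := fun _ => by rw [hσ2]; rfl
  rw [← hσ2]
  rw [hT]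
  refine (bigProd_spec (a := b) (F := C) (by omega) (by simp [hσ2, k4]) (by simp [hσ2])
    (fun j hj => by rw [m2, hzero j hj]) hC ?_).mono le_rfl ?_
  · intro σ3 v f3 o3 g10
    have hv := v.isLt
    have g6 : σ3.regs 6 = 4 + 2 * m := by rw [f3 6 (by simp [prodRegs])]; simp [hσ2, k6]
    have g4 : σ3.regs 4 = n := by rw [f3 4 (by simp [prodRegs])]; simp [hσ2, k4]
    have hval : (Expr.load (.op .add (.op .add (.reg 6) (.reg 4)) (.reg 10))).nat W σ3 = C v := by
      simp only [Expr.nat, Op.nat, g6, g4, g10]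
      rw [Nat.mod_eq_of_lt (a := 4 + 2 * m + n) (by omega), Nat.mod_eq_of_lt (by omega),
        o3 _ (by omega), m2, hcount]
    refine Ensures.assign ⟨rfl, (Frame.refl _ σ3).setReg (by simp), ?_⟩
    rw [hval]; simp
  rintro σ3 ⟨f3, o3, d3, v3⟩
  have g20 : σ3.regs 20 = b := by rw [f3 20 (by simp [prodRegs])]; simp [hσ2]
  have g4 : σ3.regs 4 = n := by rw [f3 4 (by simp [prodRegs])]; simp [hσ2, k4]
  have g0 : σ3.regs 0 = a := by rw [f3 0 (by simp [prodRegs])]; simp [hσ2]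
  have g1 : σ3.regs 1 = n + 1 := by rw [f3 1 (by simp [prodRegs])]; simp [hσ2]
  refine Ensures.seq (t := 1) (t' := 1) (Ensures.assign (Ensures.assign ⟨fun c hc => ?_,
    by simp [g0], by simp [g1], by simp [Expr.nat, g20], ?_, d3, v3⟩))
  · exact (o3 c hc).trans (m2 c)
  · rw [eval_succ (r := 4) (x := n) (by simp [g4]) (by omega)]; simp

/-- The time for `finish`. -/
def finishTime (n m : ℕ) : ℕ := n * (11 * m + 20 * n + 56) + 30

lemma finish_spec {s : ℕ} (h : Layout e f C σ) (hW : 8 + 2 * m + 4 * n < W) (h19 : σ.regs 19 = s)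
    (hhigh : ∀ b, 4 + 2 * m + 2 * n ≤ b → σ.mem b = 0) (hC : ∀ v, C v < W)
    (hs : ∀ v, (nbrList e v m).length * s < W) :
    Ensures W finish σ (finishTime n m) fun σ' => ∃ a b, a + n + 2 < W ∧ b + n + 2 < W ∧
      σ'.regs 0 = a ∧ σ'.regs 1 = n + 1 ∧ σ'.regs 2 = b ∧ σ'.regs 3 = n + 1 ∧
      (∀ j ≤ n, σ'.mem (a + j) < W) ∧ (∀ j ≤ n, σ'.mem (b + j) < W) ∧
      bigVal W σ' a (n + 1) = ∏ v, (nbrList e v m).length * s ∧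
      bigVal W σ' b (n + 1) = ∏ v, C v := by
  obtain ⟨a, ha⟩ : ∃ a, a = 4 + 2 * m + 2 * n := ⟨_, rfl⟩
  obtain ⟨b, hb⟩ : ∃ b, b = 4 + 2 * m + 3 * n + 1 := ⟨_, rfl⟩
  have ea : (Expr.op .add (.reg 6) (.op .mul (.const 2) (.reg 4))).nat W σ = a := by
    simp only [Expr.nat, Op.nat, h.reg6, h.reg4]
    rw [Nat.mod_eq_of_lt (a := 2) (by omega), Nat.mod_eq_of_lt (a := 2 * n) (by omega),
      Nat.mod_eq_of_lt (by omega), ha]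
  obtain ⟨T, hT⟩ : ∃ T, T = n * ((11 * m + 5 + 1 + 1) + 10 * n + 24) + 5 := ⟨_, rfl⟩
  obtain ⟨T', hT'⟩ : ∃ T, T = n * (10 * n + 25) + 15 := ⟨_, rfl⟩
  unfold finish
  refine Ensures.mono (Ensures.seq (t := 1) (Ensures.assign (Ensures.seq (t := T) (t' := T') ?_)))
    (t := 1 + (T + T' + 1) + 1)
    (by rw [hT, hT', finishTime]; ring_nf; omega) fun _ h => h
  rw [ea, hT]
  have l1 : Layout e f C (σ.setReg 20 a) := h.setReg (by simp)
  refine (bigProd_spec (a := a) (F := fun v => (nbrList e v m).length * s) (by omega)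
    l1.reg4 (by simp) (fun j _ => hhigh _ (by omega)) hs ?_).mono le_rfl ?_
  · intro σ1 v f1 o1 g10
    have l2 : Layout e f C σ1 := by
      refine ⟨?_, ?_, ?_, fun i => ?_, fun i => ?_, fun v => ?_, fun v => ?_⟩
      · rw [f1 4 (by simp [prodRegs]), l1.reg4]
      · rw [f1 5 (by simp [prodRegs]), l1.reg5]
      · rw [f1 6 (by simp [prodRegs]), l1.reg6]
      · rw [o1 _ (by omega), l1.fst]
      · rw [o1 _ (by omega), l1.snd]
      · rw [o1 _ (by omega), l1.conf]
      · rw [o1 _ (by omega), l1.count]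
    refine Ensures.seq (t := 11 * m + 5) (t' := 1) ((scan_spec l2 (by omega) g10).mono le_rfl ?_)
    rintro σ2 ⟨m2, f2, g13, -⟩
    have k19 : σ2.regs 19 = s := by
      rw [f2 19 (by simp), f1 19 (by simp [prodRegs])]; simp [h19]
    refine Ensures.assign ⟨m2, ?_, ?_⟩
    · exact ((Frame.refl [11, 12, 13, 21, 23] σ1).trans f2 (by simp)).setReg (by simp)
    · simp only [Expr.nat, Op.nat, g13, k19, NatState.regs_setReg, if_true]
      exact Nat.mod_eq_of_lt (hs v)
  rintro σ1 ⟨f1, o1, d1, v1⟩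
  rw [hT']
  refine (finish_denominator_spec (a := a) hb hW ?_ ?_ ?_ (fun j _ => ?_) hC fun v => ?_).mono
    le_rfl ?_
  · rw [f1 4 (by simp [prodRegs]), l1.reg4]
  · rw [f1 6 (by simp [prodRegs]), l1.reg6]
  · rw [f1 20 (by simp [prodRegs])]; simp
  · rw [o1 _ (by omega)]; exact hhigh _ (by omega)
  · rw [o1 _ (by omega), l1.count]
  · rintro σ3 ⟨o3, g0, g1, g2, g3, d3, v3⟩
    have ma : ∀ j < n + 1, σ3.mem (a + j) = σ1.mem (a + j) := fun j hj => o3 _ (by omega)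
    refine ⟨a, b, by omega, by omega, g0, g1, g2, g3, fun j hj => ?_, d3, ?_, v3⟩
    · exact (ma j (by omega)).trans_lt (d1 j hj)
    · exact (bigVal_congr ma).trans v1

lemma bigNat_toState {w a k : ℕ} (ha : a + k < 2 ^ w) (hd : ∀ j < k, σ.mem (a + j) < 2 ^ w) :
    (σ.toState w).bigNat (BitVec.ofNat w a) k = bigVal (2 ^ w) σ a k := by
  refine Finset.sum_congr rfl fun j hj => ?_
  have hj := Finset.mem_range.1 hj
  have h1 : (BitVec.ofNat w a + BitVec.ofNat w j).toNat = a + j := by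
    rw [BitVec.toNat_add, BitVec.toNat_ofNat, BitVec.toNat_ofNat, ← Nat.add_mod,
      Nat.mod_eq_of_lt (by omega)]
  simp only [NatState.toState]
  rw [h1, BitVec.toNat_ofNat, Nat.mod_eq_of_lt (hd j hj), pow_mul]

lemma output_toState {w a b : ℕ} (h0 : σ.regs 0 = a) (h1 : σ.regs 1 = n + 1) (h2 : σ.regs 2 = b)
    (h3 : σ.regs 3 = n + 1) (ha : a + n + 2 < 2 ^ w) (hb : b + n + 2 < 2 ^ w)
    (hda : ∀ j ≤ n, σ.mem (a + j) < 2 ^ w) (hdb : ∀ j ≤ n, σ.mem (b + j) < 2 ^ w) :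
    (σ.toState w).output =
      (bigVal (2 ^ w) σ a (n + 1) : ℚ) / (bigVal (2 ^ w) σ b (n + 1) : ℚ) := by
  have hn : (BitVec.ofNat w (n + 1)).toNat = n + 1 := by
    rw [BitVec.toNat_ofNat, Nat.mod_eq_of_lt (by omega)]
  rw [State.output, ← bigNat_toState (k := n + 1) (by omega) fun j hj => hda j (by omega),
    ← bigNat_toState (k := n + 1) (by omega) fun j hj => hdb j (by omega)]
  simp only [NatState.toState, h0, h1, h2, h3, hn]

end BigNumbers

end WordRAM

/-! ### The sampling loop -/

namespace WordRAM

open Function FunGraph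

section Edges

variable {n m : ℕ} {G : SimpleGraph (Fin n)} {e : Fin m → Fin n × Fin n}

lemma nbrList_eq (v : Fin n) :
    nbrList e v m = (List.finRange m).filterMap fun i => otherEnd v (e i) := by
  rw [nbrList, List.take_of_length_le (by simp), List.ofFn_eq_map, List.filterMap_map]
  rfl

lemma otherEnd_eq_some {v w : Fin n} {x : Fin n × Fin n} (h : otherEnd v x = some w) :
    s(x.1, x.2) = s(v, w) := by
  unfold otherEnd at h
  split_ifs at h with h1 h2
  · rw [← h1, Option.some.inj h]
  · rw [← h2, Option.some.inj h, Sym2.eq_swap]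

lemma nodup_nbrList (he : IsEdgeList G e) (v : Fin n) : (nbrList e v m).Nodup := by
  rw [nbrList_eq]
  refine (List.nodup_finRange m).filterMap fun i j w hi hj => he.1 ?_
  exact (otherEnd_eq_some hi).trans (otherEnd_eq_some hj).symm

lemma mem_nbrList (he : IsEdgeList G e) {v w : Fin n} : w ∈ nbrList e v m ↔ G.Adj v w := by
  rw [nbrList_eq, List.mem_filterMap, ← SimpleGraph.mem_edgeSet, ← he.2]
  constructor
  · rintro ⟨i, -, hi⟩
    exact ⟨i, otherEnd_eq_some hi⟩
  · rintro ⟨i, hi⟩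
    refine ⟨i, List.mem_finRange i, ?_⟩
    simp only at hi
    have hadj : s((e i).1, (e i).2) ∈ G.edgeSet := he.2 ▸ ⟨i, rfl⟩
    have hne : (e i).1 ≠ (e i).2 := G.ne_of_adj hadj
    unfold otherEnd
    rcases Sym2.eq_iff.1 hi with ⟨h1, h2⟩ | ⟨h1, h2⟩
    · rw [if_pos h1, h2]
    · rw [if_neg (fun h => hne (h.trans h2.symm)), if_pos h2, h1]

lemma toFinset_nbrList (he : IsEdgeList G e) (v : Fin n) : (nbrList e v m).toFinset = nbrs G v := by
  ext w
  rw [List.mem_toFinset, mem_nbrList he, mem_nbrs]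

lemma length_nbrList (he : IsEdgeList G e) (v : Fin n) :
    (nbrList e v m).length = (nbrs G v).card := by
  rw [← toFinset_nbrList he, List.toFinset_card_of_nodup (nodup_nbrList he v)]

lemma sum_nbrList (he : IsEdgeList G e) (v : Fin n) (H : Fin n → ℝ) :
    ∑ i : Fin (nbrList e v m).length, H (nbrList e v m)[i] = ∑ w ∈ nbrs G v, H w := by
  rw [← toFinset_nbrList he, List.sum_toFinset _ (nodup_nbrList he v)]
  exact Fin.sum_univ_fun_getElem (nbrList e v m) H

lemma ncard_edgeSet (he : IsEdgeList G e) : G.edgeSet.ncard = m := by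
  rw [← he.2, Set.ncard_range_of_injective he.1, Nat.card_eq_fintype_card, Fintype.card_fin]

end Edges

section Main

variable {n m : ℕ} {G : SimpleGraph (Fin n)} {e : Fin m → Fin n × Fin n}
  {ok : (Fin n → ℕ) → Prop}

lemma failProb_mem_Icc (d : ℕ) (a : Sim n) : failProb G ok d a ∈ Set.Icc (0 : ℝ) 1 := by
  induction d generalizing a with
  | zero => rw [failProb]; split_ifs <;> simp
  | succ d ih =>
    rw [failProb]
    split_ifs with h1 h2 h3
    · simp
    · simp
    · refine ⟨div_nonneg (Finset.sum_nonneg fun w _ => (ih _).1) (Nat.cast_nonneg _),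
        div_le_one_of_le₀ ?_ (Nat.cast_nonneg _)⟩
      refine (Finset.sum_le_card_nsmul _ _ 1 fun w _ => (ih _).2).trans ?_
      simp
    · simp

lemma exists_isLeastFree {f : Fin n → Fin n} {u : Fin n} (hu : f u = u) : ∃ v, IsLeastFree f v := by
  classical
  obtain ⟨v, hv, hmin⟩ := (Finset.univ.filter fun v => f v = v).exists_minimal ⟨u, by simp [hu]⟩
  refine ⟨v, (Finset.mem_filter.1 hv).2, fun w hw hfw => ?_⟩
  exact absurd (hmin (Finset.mem_filter.2 ⟨Finset.mem_univ w, hfw⟩) hw.le) (not_le.2 hw)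

/-- Conditions on the process that hold at all times, with `d` draws left of `F`, in a computation
with `s` runs. -/
structure IsValid (s F d : ℕ) (a : Sim n) : Prop where
  stage_lt : a.stage < n
  free : ∀ v : Fin n, a.stage ≤ v → a.conf v = v
  runs_le : a.runs ≤ s
  counts_le : ∀ v, a.counts v + d ≤ F

lemma IsValid.next {s F d : ℕ} {a : Sim n} (h : IsValid s F (d + 1) a) {v : Fin n}
    (hv : IsLeastFree a.conf v) (w : Fin n) : IsValid s F d (a.next v w) := by
  have hle : v.val ≤ a.stage := by
    by_contra hlt
    exact hv.2 ⟨a.stage, h.stage_lt⟩ (Fin.lt_def.2 (not_le.1 hlt)) (h.free _ le_rfl)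
  have hcount : ∀ u, countDraw a.counts a.stage v u + d ≤ F := by
    intro u
    have := h.counts_le u
    unfold countDraw
    split_ifs with hvs
    · by_cases hu : u = v
      · rw [hu, update_self]; rw [hu] at this; omega
      · rw [update_of_ne hu]; omega
    · omega
  have hup : ∀ u : Fin n, a.stage ≤ u → u ≠ v → update a.conf v w u = u := fun u hu huv => by
    rw [update_of_ne huv, h.free u hu]
  have hlt := h.stage_lt
  rw [next_eq]
  split_ifs with h1 h2 h3
  · refine ⟨hlt, fun u hu => ?_, h.runs_le, hcount⟩
    dsimp only at hu ⊢
    unfold pop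
    split_ifs with hhit
    · rfl
    · exact hup u hu fun huv => hhit (huv ▸ Hits.refl _ _)
  · exact ⟨by dsimp only; omega, fun u _ => rfl, (Nat.sub_le _ _).trans h.runs_le, hcount⟩
  · refine ⟨by dsimp only; omega, fun u hu => ?_, h.runs_le, hcount⟩
    dsimp only at hu ⊢
    exact hup u (by omega) fun huv => by rw [huv] at hu; omega
  · refine ⟨hlt, fun u hu => ?_, h.runs_le, hcount⟩
    dsimp only at hu ⊢
    exact hup u hu fun huv => by rw [huv] at hu; omega

/-- The time for one draw. -/
def drawTime (n m : ℕ) : ℕ := 22 * m + 19 * n + 70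

/-- When the runs or the draws are used up, the machine leaves the sampling loop and computes the
output. -/
lemma achieves_finish {w s d : ℕ} {E : Set (State w)} (he : IsEdgeList G e)
    (hw : 8 + 2 * m + 4 * n < 2 ^ w) (hs : m * s < 2 ^ w)
    (hE : ∀ C, ok C → ∀ σ : State w, σ.output =
      ((∏ v, ((nbrs G v).card * s) : ℕ) : ℚ) / ((∏ v, C v : ℕ) : ℚ) → σ ∈ E)
    {a : Sim n} {σ : NatState} (hσ : σ.Fits (2 ^ w)) (hrep : Represents e s d a σ)
    (hC : ∀ v, a.counts v < 2 ^ w) (hfinal : a.runs = 0 ∨ d = 0) {x : ℝ} (hx : x ≤ 1)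
    (hok : 0 < x → ok a.counts) :
    Achieves E (finishTime n m + 1) ([sample, finish], σ.toState w) x := by
  have hw0 : 0 < w := Nat.pos_of_ne_zero fun h => by simp [h] at hw
  have hguard : ¬ (Expr.op .mul (.reg 8) (.op .lt (.const 0) (.reg 9))).nat (2 ^ w) σ ≠ 0 := by
    rw [eval_and _ _ (hσ.1 8) (eval_lt_le_one _ _), eval_lt]
    simp only [Expr.nat, hrep.runs, hrep.fuel, Nat.zero_mod]
    omega
  rw [← Expr.eval_ne_zero_iff hw0 hσ] at hguard
  refine Achieves.of_step (c' := ([finish], σ.toState w)) ?_ ?_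
  · rw [sample, step, if_neg hguard]
  · rw [← Nat.zero_add (finishTime n m)]
    refine Achieves.of_ensures hw0 hσ (finish_spec hrep.layout hw hrep.total hrep.high hC
      fun v => (Nat.mul_le_mul_right s (length_nbrList_le v m)).trans_lt hs) ?_
    rintro σ' - ⟨A, B, hA, hB, h0, h1, h2, h3, hdA, hdB, hvA, hvB⟩
    refine achieves_nil hx fun hx0 => hE _ (hok hx0) _ ?_
    rw [output_toState h0 h1 h2 h3 hA hB hdA hdB, hvA, hvB]
    simp only [length_nbrList he]

/-- The sampling loop follows the sampling process. -/
theorem achieves_sample {w s F : ℕ} {E : Set (State w)} (he : IsEdgeList G e)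
    (hG : ∀ v, ∃ u, G.Adj v u) (hw : 8 + 2 * m + 4 * n < 2 ^ w) (hF : F < 2 ^ w)
    (hs : m * s < 2 ^ w) (hsw : s < 2 ^ w)
    (hE : ∀ C, ok C → ∀ σ : State w, σ.output =
      ((∏ v, ((nbrs G v).card * s) : ℕ) : ℚ) / ((∏ v, C v : ℕ) : ℚ) → σ ∈ E)
    {d : ℕ} {a : Sim n} {σ : NatState} (hσ : σ.Fits (2 ^ w)) (hrep : Represents e s d a σ)
    (ha : IsValid s F d a) :
    Achieves E (d * drawTime n m + finishTime n m + 1) ([sample, finish], σ.toState w)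
      (1 - failProb G ok d a) := by
  classical
  have hw0 : 0 < w := Nat.pos_of_ne_zero fun h => by simp [h] at hw
  have hC : ∀ {d a}, IsValid (n := n) s F d a → ∀ v, a.counts v < 2 ^ w := fun h v =>
    lt_of_le_of_lt (le_trans (Nat.le_add_right _ _) (h.counts_le v)) hF
  have hle : ∀ d a, 1 - failProb G ok d a ≤ 1 := fun d a =>
    sub_le_self _ (failProb_mem_Icc d a).1
  have hfinal : ∀ d (a : Sim n), a.runs = 0 → 0 < 1 - failProb G ok d a → ok a.counts := by
    intro d a h0 h
    rw [failProb_of_runs_eq_zero d h0] at h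
    by_contra hok
    rw [if_neg hok] at h
    linarith
  induction d generalizing a σ with
  | zero =>
    refine (achieves_finish he hw hs hE hσ hrep (hC ha) (Or.inr rfl) (hle 0 a)
      fun h => ?_).mono_time (by omega)
    by_cases h0 : a.runs = 0
    · exact hfinal 0 a h0 h
    · rw [failProb_zero h0] at h
      linarith
  | succ d ih =>
    by_cases h0 : a.runs = 0
    · exact (achieves_finish he hw hs hE hσ hrep (hC ha) (Or.inl h0) (hle _ a)
        (hfinal _ a h0)).mono_time (by omega)
    · obtain ⟨v, hv⟩ := exists_isLeastFree (ha.free ⟨a.stage, ha.stage_lt⟩ le_rfl)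
      have hlen : 0 < (nbrList e v m).length := by
        obtain ⟨u, hu⟩ := hG v
        exact List.length_pos_of_mem ((mem_nbrList he).2 hu)
      have hguard : (Expr.op .mul (.reg 8) (.op .lt (.const 0) (.reg 9))).nat (2 ^ w) σ ≠ 0 := by
        rw [eval_and _ _ (hσ.1 8) (eval_lt_le_one _ _), eval_lt]
        simp only [Expr.nat, hrep.runs, hrep.fuel, Nat.zero_mod]
        omega
      rw [← Expr.eval_ne_zero_iff hw0 hσ] at hguard
      have hT : (d + 1) * drawTime n m + finishTime n m + 1 =
          ((((d * drawTime n m + finishTime n m + 1) + (11 * m + 17 * n + 50) + 1) + 1) +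
            (11 * m + 2 * n + 11) + 1 + 1) + 5 := by
        rw [Nat.succ_mul, drawTime]; ring
      rw [hT]
      refine Achieves.mono_time (Achieves.of_step (c' := (_ :: sample :: [finish], σ.toState w))
        (by rw [sample, step, if_pos hguard]) (Achieves.of_step rfl
        (Achieves.of_ensures hw0 hσ (beforeDraw_spec hrep.layout (by omega) hv) ?_)))
        (Nat.le_add_right _ _)
      rintro σ1 hσ1 ⟨m1, f1, g10, g13⟩
      refine Achieves.of_step rfl ?_
      rw [failProb_succ d h0 hv, ← sum_nbrList he v fun u => failProb G ok d (a.next v u),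
        ← length_nbrList he]
      have hsplit : 1 - (∑ i : Fin (nbrList e v m).length,
          failProb G ok d (a.next v (nbrList e v m)[i])) / ((nbrList e v m).length : ℝ) =
          (∑ i : Fin (nbrList e v m).length,
            (1 - failProb G ok d (a.next v (nbrList e v m)[i]))) /
              ((nbrList e v m).length : ℝ) := by
        have : ((nbrList e v m).length : ℝ) ≠ 0 := by exact_mod_cast hlen.ne'
        rw [Finset.sum_sub_distrib, Finset.sum_const, Finset.card_univ, Fintype.card_fin,
          nsmul_one, sub_div, div_self this]
      rw [hsplit]
      refine Achieves.rand hw0 hσ1 (by rw [Expr.nat, g13]) hlen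
        (fun i => sub_nonneg.2 (failProb_mem_Icc _ _).2) fun i => ?_
      have hrep1 : Represents e s (d + 1) a (σ1.setReg 14 i) := by
        refine ⟨(hrep.layout.frame m1 f1 (by simp) (by simp) (by simp)).setReg (by simp),
          ?_, ?_, ?_, ?_, fun b hb => ?_⟩
        · simpa using (f1 7 (by simp)).trans hrep.stage
        · simpa using (f1 8 (by simp)).trans hrep.runs
        · simpa using (f1 9 (by simp)).trans hrep.fuel
        · simpa using (f1 19 (by simp)).trans hrep.total
        · rw [NatState.mem_setReg, m1, hrep.high b hb]
      have hmem : (nbrList e v m)[i] ∈ nbrList e v m := List.getElem_mem _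
      have hcv := ha.counts_le v
      refine Achieves.of_ensures hw0 (hσ1.setReg 14 ?_) (afterDraw_spec hrep1 (by omega)
        (by omega) h0 (lt_of_le_of_lt ha.runs_le hsw) (v := v) (w := (nbrList e v m)[i])
        (by simp [g10]) (by omega) (by simp)
        (G.ne_of_adj ((mem_nbrList he).1 hmem)).symm) fun σ2 hσ2 hrep2 =>
          ih hσ2 hrep2 (ha.next hv _)
      have := length_nbrList_le (e := e) v m
      have := i.isLt
      omega

end Main

end WordRAM

/-! ### Initialization, word size and running time -/

namespace WordRAM

open Function FunGraph

section Start

variable {n m : ℕ} {e : Fin m → Fin n × Fin n} {W : ℕ}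

lemma length_pairs {α : Type*} (a b : α → ℕ) (l : List α) :
    (l.flatMap fun x => [a x, b x]).length = 2 * l.length := by
  induction l with
  | nil => rfl
  | cons x l ih => simp only [List.flatMap_cons, List.length_append, ih, List.length_cons,
      List.length_nil]; omega

lemma getD_pairs {α : Type*} (a b : α → ℕ) (l : List α) {i : ℕ} (hi : i < l.length) :
    (l.flatMap fun x => [a x, b x]).getD (2 * i) 0 = a l[i] ∧
      (l.flatMap fun x => [a x, b x]).getD (2 * i + 1) 0 = b l[i] := by
  induction l generalizing i with
  | nil => simp at hi
  | cons x l ih =>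
    cases i with
    | zero => simp
    | succ i =>
      obtain ⟨h1, h2⟩ := ih (i := i) (by simpa using hi)
      exact ⟨h1, h2⟩

/-- The initial state on the given input. -/
def inputState (input : List ℕ) : NatState := ⟨fun _ => 0, fun a => input.getD a 0⟩

lemma toState_inputState (w : ℕ) (input : List ℕ) :
    (inputState input).toState w = initState w input := rfl

lemma mem_inputState (e : Fin m → Fin n × Fin n) (p q : ℕ) :
    (inputState (inputWords e p q)).mem 0 = n ∧ (inputState (inputWords e p q)).mem 1 = m ∧
      (inputState (inputWords e p q)).mem 2 = p ∧ (inputState (inputWords e p q)).mem 3 = q :=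
  ⟨rfl, rfl, rfl, rfl⟩

lemma mem_inputState_edge (e : Fin m → Fin n × Fin n) (p q : ℕ) (i : Fin m) :
    (inputState (inputWords e p q)).mem (4 + 2 * i) = (e i).1 ∧
      (inputState (inputWords e p q)).mem (5 + 2 * i) = (e i).2 := by
  have h := getD_pairs (fun x : Fin n × Fin n => (x.1 : ℕ)) (fun x => (x.2 : ℕ)) (List.ofFn e)
    (i := i) (by simp)
  rw [List.getElem_ofFn] at h
  rw [show 4 + 2 * i.val = 2 * i.val + 1 + 1 + 1 + 1 by omega,
    show 5 + 2 * i.val = 2 * i.val + 1 + 1 + 1 + 1 + 1 by omega]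
  exact h

lemma mem_inputState_high (e : Fin m → Fin n × Fin n) (p q : ℕ) {b : ℕ} (hb : 4 + 2 * m ≤ b) :
    (inputState (inputWords e p q)).mem b = 0 := by
  refine List.getD_eq_default _ _ ?_
  have := length_pairs (fun x : Fin n × Fin n => (x.1 : ℕ)) (fun x => (x.2 : ℕ)) (List.ofFn e)
  rw [inputWords, List.length_append, this]
  simpa using hb

lemma inputState_fits (e : Fin m → Fin n × Fin n) {p q : ℕ} (hn : n < W) (hm : m < W) (hp : p < W)
    (hq : q < W) : (inputState (inputWords e p q)).Fits W := by
  refine ⟨fun _ => by simp only [inputState]; omega, fun a => ?_⟩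
  obtain ⟨h0, h1, h2, h3⟩ := mem_inputState e p q
  by_cases ha : a < 4
  · interval_cases a <;> omega
  by_cases ha' : 4 + 2 * m ≤ a
  · rw [mem_inputState_high e p q ha']; omega
  · obtain ⟨g1, g2⟩ := mem_inputState_edge e p q ⟨(a - 4) / 2, by omega⟩
    dsimp only at g1 g2
    rcases Nat.even_or_odd' a with ⟨c, hc | hc⟩
    · rw [show 4 + 2 * ((a - 4) / 2) = a by omega] at g1
      rw [g1]; omega
    · rw [show 5 + 2 * ((a - 4) / 2) = a by omega] at g2
      rw [g2]; omega

lemma start_spec {p q s F : ℕ} (hn : 0 < n) (hW : 64 * n + 2 * m + 8 < W) (hpp : p * p < W)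
    (hqq : q * q + 1 < W) (hs : s = 64 * n * (q * q / (p * p) + 1)) (hsW : 40 * s < W)
    (hF : F = 40 * s * (n * n * n)) (hn3 : n * n * n < W) (hFW : F < W) :
    Ensures W start (inputState (inputWords e p q)) (4 * n + 17)
      (Represents e s F ⟨id, 0, s, fun _ => 0⟩) := by
  obtain ⟨σ, hσ⟩ : ∃ σ, σ = inputState (inputWords e p q) := ⟨_, rfl⟩
  obtain ⟨i0, i1, i2, i3⟩ := mem_inputState e p q
  have hedge := mem_inputState_edge e p q
  have hhigh := fun b => mem_inputState_high e p q (b := b)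
  rw [← hσ] at i0 i1 i2 i3 hedge hhigh ⊢
  have hq1 : q * q / (p * p) + 1 < W :=
    lt_of_le_of_lt (Nat.succ_le_succ (Nat.div_le_self _ _)) hqq
  have hn2 : n * n < W := lt_of_le_of_lt (Nat.le_mul_of_pos_right _ hn) hn3
  have h64 : 64 * n < W := by omega
  unfold start
  refine Ensures.mono (Ensures.seq (Ensures.assign (Ensures.seq (Ensures.assign (Ensures.seq
    (Ensures.assign (Ensures.seq (Ensures.assign (Ensures.seq (Ensures.assign (Ensures.seq
    (Ensures.assign (Ensures.seq (t' := 4 * n + 3) (Ensures.assign ?_)))))))))))))) (by omega)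
    fun _ h => h
  simp only [Expr.nat, Op.nat, NatState.regs_setReg, NatState.mem_setReg, Nat.reduceEqDiff,
    if_true, if_false, i0, i1, i2, i3, Nat.zero_mod, Nat.mod_eq_of_lt (show 1 < W by omega),
    Nat.mod_eq_of_lt (show 2 < W by omega), Nat.mod_eq_of_lt (show 3 < W by omega)]
  have e6 : (4 % W + 2 * m % W) % W = 4 + 2 * m := by
    rw [Nat.mod_eq_of_lt (a := 4) (by omega), Nat.mod_eq_of_lt (a := 2 * m) (by omega),
      Nat.mod_eq_of_lt (by omega)]
  have es : 64 % W * n % W * ((q * q % W / (p * p % W) + 1) % W) % W = s := by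
    rw [Nat.mod_eq_of_lt (a := 64) (by omega), Nat.mod_eq_of_lt h64,
      Nat.mod_eq_of_lt (a := q * q) (by omega), Nat.mod_eq_of_lt hpp, Nat.mod_eq_of_lt hq1, ← hs,
      Nat.mod_eq_of_lt (by omega)]
  have eF : 40 % W * s % W * (n * n % W * n % W) % W = F := by
    rw [Nat.mod_eq_of_lt (a := 40) (by omega), Nat.mod_eq_of_lt hsW, Nat.mod_eq_of_lt hn2,
      Nat.mod_eq_of_lt hn3, ← hF, Nat.mod_eq_of_lt hFW]
  rw [e6, es, eF]
  have hlay : Layout e (fun _ => ⟨0, hn⟩) (fun _ => 0)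
      (((((((σ.setReg 4 n).setReg 5 m).setReg 6 (4 + 2 * m)).setReg 19 s).setReg 8 s).setReg
        9 F).setReg 7 0) := by
    refine ⟨by simp, by simp, by simp, fun i => (hedge i).1, fun i => (hedge i).2,
      fun v => ?_, fun v => ?_⟩
    · exact hhigh _ (by omega)
    · exact hhigh _ (by omega)
  refine (clear_spec hlay (by omega)).mono le_rfl ?_
  rintro σ' ⟨h1, h2, h3⟩
  refine ⟨h1, ?_, ?_, ?_, ?_, fun b hb => (h3 b hb).trans (hhigh b (by omega))⟩
  · rw [h2 7 (by simp)]; simp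
  · rw [h2 8 (by simp)]; simp
  · rw [h2 9 (by simp)]; simp
  · rw [h2 19 (by simp)]; simp

/-- The number of runs is large enough, but not too large. -/
lemma runs_bounds {p q s : ℕ} (hp : 0 < p) (hpq : p < q)
    (hs : s = 64 * n * (q * q / (p * p) + 1)) :
    64 * (n : ℝ) * ((q : ℝ) / p) ^ 2 ≤ s ∧ (s : ℝ) ≤ 128 * n * ((q : ℝ) / p) ^ 2 := by
  have hp' : (0 : ℝ) < p := by exact_mod_cast hp
  have hpp : 0 < p * p := Nat.mul_pos hp hp
  have h1 : ((q : ℝ) / p) ^ 2 ≤ (q * q / (p * p) : ℕ) + 1 := by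
    rw [div_pow, div_le_iff₀ (by positivity)]
    have := (Nat.lt_mul_div_succ (q * q) hpp).le
    rw [mul_comm (p * p)] at this
    calc (q : ℝ) ^ 2 = ((q * q : ℕ) : ℝ) := by push_cast; ring
      _ ≤ (((q * q / (p * p) + 1) * (p * p) : ℕ) : ℝ) := by exact_mod_cast this
      _ = _ := by push_cast; ring
  have h2 : ((q * q / (p * p) : ℕ) : ℝ) ≤ ((q : ℝ) / p) ^ 2 := by
    refine Nat.cast_div_le.trans_eq ?_
    push_cast
    field_simp
  have h3 : 1 ≤ ((q : ℝ) / p) ^ 2 := by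
    refine one_le_pow₀ ((one_le_div hp').2 ?_)
    exact_mod_cast hpq.le
  rw [hs]
  push_cast
  constructor
  · gcongr
  · rw [show (128 : ℝ) * n * ((q : ℝ) / p) ^ 2 =
      64 * n * (((q : ℝ) / p) ^ 2 + ((q : ℝ) / p) ^ 2) by ring]
    gcongr

/-- All numbers that occur fit into a word: they are at most `N ^ 12`, where `N ≥ 4` absorbs the
constants. -/
lemma size_bounds {p q s N : ℕ} (hn : 0 < n) (hnm : n ≤ m) (hp : 0 < p) (hpq : p < q)
    (hN : N = n + m + q) (hs : s = 64 * n * (q * q / (p * p) + 1)) :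
    64 * n + 2 * m + 8 < N ^ 20 ∧ q * q + 1 < N ^ 20 ∧ 40 * s < N ^ 20 ∧ m * s < N ^ 20 ∧
      n * n * n < N ^ 20 ∧ 40 * s * (n * n * n) < N ^ 20 := by
  have hN4 : 4 ≤ N := by omega
  have h64 : 64 ≤ N ^ 3 := by
    calc 64 = 4 ^ 3 := by norm_num
      _ ≤ N ^ 3 := Nat.pow_le_pow_left hN4 3
  have hn' : n ≤ N := by omega
  have hm' : m ≤ N := by omega
  have hq' : q + 1 ≤ N := by omega
  have hqq : q * q + 1 ≤ N ^ 2 := by nlinarith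
  have hsN : s ≤ N ^ 6 := by
    rw [hs, show N ^ 6 = N ^ 3 * N * N ^ 2 by ring]
    exact Nat.mul_le_mul (Nat.mul_le_mul h64 hn')
      ((Nat.succ_le_succ (Nat.div_le_self _ _)).trans hqq)
  have h40 : 40 * s ≤ N ^ 9 := by
    rw [show N ^ 9 = N ^ 3 * N ^ 6 by ring]
    exact Nat.mul_le_mul (by omega) hsN
  have hn3 : n * n * n ≤ N ^ 3 := by
    rw [show N ^ 3 = N * N * N by ring]
    exact Nat.mul_le_mul (Nat.mul_le_mul hn' hn') hn'
  have hlt : ∀ {x k : ℕ}, k < 20 → x ≤ N ^ k → x < N ^ 20 := fun hk hx =>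
    hx.trans_lt (Nat.pow_lt_pow_right (by omega) hk)
  refine ⟨hlt (k := 5) (by norm_num) ?_, hlt (by norm_num) hqq, hlt (by norm_num) h40,
    hlt (k := 7) (by norm_num) ?_, hlt (by norm_num) hn3, hlt (k := 12) (by norm_num) ?_⟩
  · have : 128 * N ≤ N ^ 5 := by
      calc 128 * N ≤ 4 ^ 4 * N := by omega
        _ ≤ N ^ 4 * N := Nat.mul_le_mul_right _ (Nat.pow_le_pow_left hN4 4)
        _ = N ^ 5 := by ring
    omega
  · rw [show N ^ 7 = N * N ^ 6 by ring]
    exact Nat.mul_le_mul hm' hsN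
  · rw [show N ^ 12 = N ^ 9 * N ^ 3 by ring]
    exact Nat.mul_le_mul h40 hn3

/-- The total running time. The first summand dominates: `s` is of order `n * (q / p) ^ 2`, the time
for a draw is of order `m`, and `n ≤ m`. -/
lemma time_bound {p q s : ℕ} (hn : 0 < n) (hnm : n ≤ m) (hp : 0 < p) (hpq : p < q)
    (hs : s = 64 * n * (q * q / (p * p) + 1)) :
    ((40 * s * (n * n * n) * drawTime n m + finishTime n m + 1 + 1 + (4 * n + 17) + 1 : ℕ) : ℝ) ≤
      (600000 : ℕ) * ((n : ℝ) ^ 3 * (m : ℝ) ^ 2 * ((p : ℝ) / (q : ℝ))⁻¹ ^ 2) := by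
  have hs' := (runs_bounds (n := n) hp hpq hs).2
  rw [inv_div]
  have hp' : (0 : ℝ) < p := by exact_mod_cast hp
  have hr : 1 ≤ ((q : ℝ) / p) ^ 2 := by
    refine one_le_pow₀ ((one_le_div hp').2 ?_)
    exact_mod_cast hpq.le
  set r := ((q : ℝ) / p) ^ 2 with hrdef
  have h1 : (drawTime n m : ℝ) ≤ 111 * m := by
    have : drawTime n m ≤ 111 * m := by unfold drawTime; omega
    exact_mod_cast this
  have h2 : (finishTime n m + 1 + 1 + (4 * n + 17) + 1 : ℕ) ≤ 141 * (n ^ 3 * m ^ 2) := by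
    have hn1 : 1 ≤ n := hn
    have hm1 : 1 ≤ m := by omega
    have g0 : n * m ≤ n ^ 3 * m ^ 2 := Nat.mul_le_mul (Nat.le_self_pow (by norm_num) n)
      (Nat.le_self_pow (by norm_num) m)
    have g1 : n * (11 * m + 20 * n + 56) ≤ n * (87 * m) := Nat.mul_le_mul_left _ (by omega)
    have g2 : n ≤ n * m := Nat.le_mul_of_pos_right _ hm1
    have g3 : n * (87 * m) = 87 * (n * m) := by ring
    unfold finishTime
    omega
  have h2' : ((finishTime n m + 1 + 1 + (4 * n + 17) + 1 : ℕ) : ℝ) ≤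
      141 * ((n : ℝ) ^ 3 * (m : ℝ) ^ 2) := by exact_mod_cast h2
  have hnm' : (n : ℝ) ≤ m := by exact_mod_cast hnm
  have h3 : 40 * (s : ℝ) * (n * n * n) * drawTime n m ≤
      568320 * ((n : ℝ) ^ 3 * (m : ℝ) ^ 2 * r) := by
    calc 40 * (s : ℝ) * (n * n * n) * drawTime n m
        ≤ 40 * (128 * n * r) * (n * n * n) * (111 * m) := by gcongr
      _ = 568320 * ((n : ℝ) ^ 3 * (n * m) * r) := by ring
      _ ≤ 568320 * ((n : ℝ) ^ 3 * (m * m) * r) := by gcongr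
      _ = _ := by ring
  have h4 : (n : ℝ) ^ 3 * (m : ℝ) ^ 2 ≤ (n : ℝ) ^ 3 * (m : ℝ) ^ 2 * r :=
    le_mul_of_one_le_right (by positivity) hr
  have h5 : 0 ≤ (n : ℝ) ^ 3 * (m : ℝ) ^ 2 := by positivity
  rw [show (40 * s * (n * n * n) * drawTime n m + finishTime n m + 1 + 1 + (4 * n + 17) + 1) =
    40 * s * (n * n * n) * drawTime n m + (finishTime n m + 1 + 1 + (4 * n + 17) + 1) by ring,
    Nat.cast_add]
  refine (add_le_add (b := 568320 * ((n : ℝ) ^ 3 * (m : ℝ) ^ 2 * r)) ?_ h2').trans ?_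
  · refine le_of_eq_of_le ?_ h3
    push_cast
    ring
  · push_cast
    linarith

end Start

end WordRAM

/-- One program, for all graphs, tolerances `ε = p / q` in `(0, 1)` and word sizes `w` of at least
`k * log₂ (n + m + q)` bits. -/
theorem theorem3 :
    ∃ (P : WordRAM.Cmd) (k C : ℕ),
      ∀ (n m : ℕ) (G : SimpleGraph (Fin n)) (e : Fin m → Fin n × Fin n) (p q w : ℕ),
        G.Connected → n ≤ m → IsEdgeList G e → 0 < p → p < q → (n + m + q) ^ k ≤ 2 ^ w →
        ∃ T : ℕ,
          (T : ℝ) ≤ C * ((n : ℝ) ^ 3 * (m : ℝ) ^ 2 * ((p : ℝ) / (q : ℝ))⁻¹ ^ 2) ∧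
          WordRAM.Approximates P w (inputWords e p q) T (numBicircularBases G)
            ((p : ℚ) / (q : ℚ)) := by
  refine ⟨WordRAM.approxCount, 20, 600000, ?_⟩
  intro n m G e p q w hG hnm he hp hpq hw
  have hn : 0 < n := Fin.pos_iff_nonempty.2 hG.nonempty
  have hcard : G.edgeSet.ncard = m := WordRAM.ncard_edgeSet he
  obtain ⟨s, hs⟩ : ∃ s, s = 64 * n * (q * q / (p * p) + 1) := ⟨_, rfl⟩
  refine ⟨_, WordRAM.time_bound hn hnm hp hpq hs, ?_⟩
  obtain ⟨b1, b2, b3, b4, b5, b6⟩ := WordRAM.size_bounds hn hnm hp hpq rfl hs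
  have hw0 : 0 < w := Nat.pos_of_ne_zero fun h => by
    rw [h, pow_zero] at hw
    omega
  have hppqq : p * p ≤ q * q := Nat.mul_le_mul hpq.le hpq.le
  have hqq : q ≤ q * q := Nat.le_mul_of_pos_left _ (by omega)
  have hadj : ∀ v, ∃ u, G.Adj v u := by
    have hne : (e ⟨0, by omega⟩).1 ≠ (e ⟨0, by omega⟩).2 :=
      G.ne_of_adj (show s(_, _) ∈ G.edgeSet from he.2 ▸ ⟨⟨0, by omega⟩, rfl⟩)
    have : Nontrivial (Fin n) := ⟨_, _, hne⟩
    exact fun v => hG.preconnected.exists_adj_of_nontrivial v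
  have hbases : numBicircularBases G = FunGraph.numGood G Finset.univ :=
    FunGraph.numBicircularBases_eq hG (by rw [Fintype.card_fin, hcard]; exact hnm)
  have hfail := FunGraph.failProb_le hG (hcard.symm ▸ hnm) hp hpq
    (WordRAM.runs_bounds (n := n) hp hpq hs).1
  have main : WordRAM.Achieves {σ : WordRAM.State w |
      |σ.output - (numBicircularBases G : ℚ)| ≤ (p : ℚ) / q * (numBicircularBases G : ℚ)}
      (40 * s * (n * n * n) * WordRAM.drawTime n m + WordRAM.finishTime n m + 1 + 1 +
        (4 * n + 17) + 1)
      ([WordRAM.approxCount], WordRAM.initState w (inputWords e p q)) (3 / 4) := by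
    have hfits : (WordRAM.inputState (inputWords e p q)).Fits (2 ^ w) :=
      WordRAM.inputState_fits e (by omega) (by omega) (by omega) (by omega)
    refine WordRAM.Achieves.of_step rfl ?_
    rw [← WordRAM.toState_inputState]
    refine WordRAM.Achieves.of_ensures hw0 hfits (WordRAM.start_spec hn (by omega) (by omega)
      (by omega) hs (by omega) rfl (by omega) (by omega)) fun σ hσ hrep => ?_
    refine WordRAM.Achieves.of_step rfl ?_
    refine (WordRAM.achieves_sample (F := 40 * s * (n * n * n))
      (ok := FunGraph.Accurate G s ((p : ℚ) / q)) he hadj (by omega) (by omega) (by omega)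
      (by omega) (fun C hC σ hout => ?_) hσ hrep ⟨hn, fun _ _ => rfl, le_rfl,
        fun v => by simp⟩).mono ?_
    · rw [Set.mem_ofPred_eq, hout, hbases]
      exact hC
    · rw [show n * n * n = n ^ 3 by ring]
      linarith
  refine ⟨main.1, le_trans (le_of_eq ?_) main.2⟩
  rw [ENNReal.ofReal_div_of_pos (by norm_num)]
  norm_num
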